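/- Let $p$ be a prime and $S$ a finite $p$-group. For finite groups $G,H$ let $A(G,H)$ be the Grothendieck group, under disjoint union, of isomorphism classes of finite sets with commuting right $G$-action and free left $H$-action, and put $A(G,H)_{(p)}=A(G,H)\otimes\mathbb Z_{(p)}$. Composition $A(H,K)_{(p)}\times A(G,H)_{(p)}\to A(G,K)_{(p)}$ is the bilinear pairing with $[X]\circ[Y]=[X\times_H Y]$, and $\times$ is the bilinear pairing $A(G,H)_{(p)}\times A(G',H')_{(p)}\to A(G\times G',H\times H')_{(p)}$ given by Cartesian product. For $L\le G$ and a homomorphism $\varphi\colon L\to H$ let $[L,\varphi]\in A(G,H)_{(p)}$ be the class of $(H\times G)/\!\sim$ with $(x,ky)\sim(x\varphi(k),y)$ for $k\in L$. For $x,y\in A(S,S)_{(p)}$ set $\kappa(x,y)=(x\times y)\circ[S,\Delta]\in A(S,S\times S)_{(p)}$, where $\Delta\colon S\to S\times S$ is the diagonal. The Nishida ideal $J(S)_{(p)}\subseteq A(S,S)_{(p)}$ is the $\mathbb Z_{(p)}$-span of the classes $[P,\psi]$ with $\psi(P)$ a proper subgroup of $S$. A $\kappa$-preserving submodule of $A(S,S)_{(p)}$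 is a pair $(R,R')$, where $R\subseteq A(S,S)_{(p)}$ is a left $A(S,S)_{(p)}$-submodule and $R'\subseteq A(S,S\times S)_{(p)}$ is a left $A(S\times S,S\times S)_{(p)}$-submodule, such that $h\circ R\subseteq R'$ for every $h\in A(S,S\times S)_{(p)}$, and $\kappa(x,y)\in R'$ for all $x,y\in R$. A retractive transfer for $(R,R')$ consists of a morphism of left $A(S,S)_{(p)}$-modules $t\colon A(S,S)_{(p)}\to R$ with $t|_R=\mathrm{id}_R$ and a morphism of left $A(S\times S,S\times S)_{(p)}$-modules $t'\colon A(S,S\times S)_{(p)}\to R'$ with $t'|_{R'}=\mathrm{id}_{R'}$, such that $t'(h\circ x)=h\circ t(x)$ for all $h\in A(S,S\times S)_{(p)}$ and $x\in A(S,S)_{(p)}$, and $t'(\kappa(x,y))=\kappa(x,t(y))$ for all $x\in R$ and $y\in A(S,S)_{(p)}$. For a fusion system $\mathcal F$ on $S$ and $T\in\{S,S\times S\}$, an element $X\in A(S,T)_{(p)}$ is right $\mathcal F$-stable if $X\circ[P,\varphi]=X\circ[P,\mathrm{incl}]$ in $A(P,T)_{(p)}$ for all $P\le S$ and all $\varphi\in\mathrm{Hom}_{\mathcal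 F}(P,S)$, where $[P,\varphi],[P,\mathrm{incl}]\in A(P,S)_{(p)}$. Theorem. Let $S$ be a finite $p$-group and let $(R,R')$ be a $\kappa$-preserving submodule of $A(S,S)_{(p)}$ such that $R$ is not contained in $J(S)_{(p)}$. There exists a saturated fusion system $\mathcal F$ on $S$ (in the sense of Broto, Levi and Oliver) such that $R$ is the set of right $\mathcal F$-stable elements of $A(S,S)_{(p)}$ and $R'$ is the set of right $\mathcal F$-stable elements of $A(S,S\times S)_{(p)}$ if and only if $(R,R')$ has a retractive transfer. -/

import Mathlib

namespace DoubleBurnside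

universe u

/-! ### Bisets -/

/-- A finite left-free `(G, H)`-biset: a finite set with a right action of `G` and a free left
action of `H` that commute. The right action is a (left) action of the opposite group, so that
`MulOpposite.op g • x` is the element `x g`. -/
structure Biset (G H : Type u) [Group G] [Group H] where
  carrier : Type u
  [finite : Finite carrier]
  [leftAct : MulAction H carrier]
  [rightAct : MulAction Gᵐᵒᵖ carrier]
  [commute : SMulCommClass H Gᵐᵒᵖ carrier]
  left_free : ∀ (h : H) (x : carrier), h • x = x → h = 1

namespace Biset

attribute [instance] Biset.finite Biset.leftAct Biset.rightAct Biset.commute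

open MulOpposite (op)

section

variable {G H K G' H' : Type u} [Group G] [Group H] [Group K] [Group G'] [Group H']

/-- Two `(G, H)`-bisets are isomorphic if there is a bijection compatible with both actions. -/
def Iso (X Y : Biset G H) : Prop :=
  ∃ e : X.carrier ≃ Y.carrier,
    (∀ (h : H) (x : X.carrier), e (h • x) = h • e x) ∧
    (∀ (g : G) (x : X.carrier), e (op g • x) = op g • e x)

/-- The disjoint union of two bisets. -/
def sum (X Y : Biset G H) : Biset G H where
  carrier := X.carrier ⊕ Y.carrier
  leftAct :=
    { smul := fun h => Sum.map (h • ·) (h • ·)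
      one_smul := by
        rintro (x | x)
        · exact congrArg Sum.inl (one_smul H x)
        · exact congrArg Sum.inr (one_smul H x)
      mul_smul := by
        rintro a b (x | x)
        · exact congrArg Sum.inl (mul_smul a b x)
        · exact congrArg Sum.inr (mul_smul a b x) }
  rightAct :=
    { smul := fun g => Sum.map (g • ·) (g • ·)
      one_smul := by
        rintro (x | x)
        · exact congrArg Sum.inl (one_smul Gᵐᵒᵖ x)
        · exact congrArg Sum.inr (one_smul Gᵐᵒᵖ x)
      mul_smul := by
        rintro a b (x | x)
        · exact congrArg Sum.inl (mul_smul a b x)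
        · exact congrArg Sum.inr (mul_smul a b x) }
  commute := by
    refine @SMulCommClass.mk _ _ _ (_) (_) ?_
    rintro h g (x | x)
    · exact congrArg Sum.inl (smul_comm h g x)
    · exact congrArg Sum.inr (smul_comm h g x)
  left_free := by
    rintro h (x | x) e
    · exact X.left_free h x (Sum.inl_injective e)
    · exact Y.left_free h x (Sum.inr_injective e)

/-- The equivalence relation `(x h, y) ∼ (x, h y)` on `X × Y`. -/
def tensorSetoid (X : Biset H K) (Y : Biset G H) : Setoid (X.carrier × Y.carrier) where
  r a b := ∃ h : H, op h • b.1 = a.1 ∧ b.2 = h • a.2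
  iseqv :=
    { refl := fun a => ⟨1, by simp, by simp⟩
      symm := by
        rintro a b ⟨h, h1, h2⟩
        refine ⟨h⁻¹, ?_, ?_⟩
        · rw [← h1, smul_smul, ← MulOpposite.op_mul]; simp
        · rw [h2, smul_smul]; simp
      trans := by
        rintro a b c ⟨h, h1, h2⟩ ⟨k, k1, k2⟩
        refine ⟨k * h, ?_, ?_⟩
        · rw [MulOpposite.op_mul, mul_smul, k1, h1]
        · rw [mul_smul, ← h2, k2] }

/-- The composite `X ∘ Y = X ×_H Y` of an `(H, K)`-biset and a `(G, H)`-biset: the quotient of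
`X × Y` by `(x h, y) ∼ (x, h y)`, with `k (x, y) g = (k x, y g)`. -/
def comp (X : Biset H K) (Y : Biset G H) : Biset G K where
  carrier := Quotient (tensorSetoid X Y)
  leftAct :=
    { smul := fun k => Quotient.map (fun a => (k • a.1, a.2)) (by
        rintro a b ⟨h, h1, h2⟩
        exact ⟨h, by simp only [← h1, smul_comm k (op h)], h2⟩)
      one_smul := by
        rintro ⟨x, y⟩
        exact congrArg (Quotient.mk _) (Prod.ext (one_smul K x) rfl)
      mul_smul := by
        rintro a b ⟨x, y⟩
        exact congrArg (Quotient.mk _) (Prod.ext (mul_smul a b x) rfl) }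
  rightAct :=
    { smul := fun g => Quotient.map (fun a => (a.1, g • a.2)) (by
        rintro a b ⟨h, h1, h2⟩
        exact ⟨h, h1, by simp only [h2, smul_comm h g]⟩)
      one_smul := by
        rintro ⟨x, y⟩
        exact congrArg (Quotient.mk _) (Prod.ext rfl (one_smul Gᵐᵒᵖ y))
      mul_smul := by
        rintro a b ⟨x, y⟩
        exact congrArg (Quotient.mk _) (Prod.ext rfl (mul_smul a b y)) }
  commute := by
    refine @SMulCommClass.mk _ _ _ (_) (_) ?_
    rintro k g ⟨x, y⟩
    rfl
  left_free := by
    rintro k ⟨x, y⟩ e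
    obtain ⟨h, h1, h2⟩ := Quotient.exact e
    have hh : h = 1 := Y.left_free h y h2.symm
    subst hh
    refine X.left_free k x ?_
    simpa using h1.symm

/-- The Cartesian product of a `(G, H)`-biset and a `(G', H')`-biset, a
`(G × G', H × H')`-biset with componentwise actions. -/
def prod (X : Biset G H) (Y : Biset G' H') : Biset (G × G') (H × H') where
  carrier := X.carrier × Y.carrier
  leftAct :=
    { smul := fun h a => (h.1 • a.1, h.2 • a.2)
      one_smul := fun a => Prod.ext (one_smul H a.1) (one_smul H' a.2)
      mul_smul := fun h k a => Prod.ext (mul_smul h.1 k.1 a.1) (mul_smul h.2 k.2 a.2) }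
  rightAct :=
    { smul := fun g a => (op g.unop.1 • a.1, op g.unop.2 • a.2)
      one_smul := fun a => Prod.ext (one_smul Gᵐᵒᵖ a.1) (one_smul G'ᵐᵒᵖ a.2)
      mul_smul := fun g k a =>
        Prod.ext (mul_smul (op g.unop.1) (op k.unop.1) a.1)
          (mul_smul (op g.unop.2) (op k.unop.2) a.2) }
  commute := by
    refine @SMulCommClass.mk _ _ _ (_) (_) ?_
    intro h g a
    exact Prod.ext (smul_comm h.1 (op g.unop.1) a.1) (smul_comm h.2 (op g.unop.2) a.2)
  left_free := fun h a e =>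
    Prod.ext (X.left_free h.1 a.1 (congrArg Prod.fst e))
      (Y.left_free h.2 a.2 (congrArg Prod.snd e))

/-- The equivalence relation `(x, k y) ∼ (x φ(k), y)` on `H × G`. -/
def basicSetoid (L : Subgroup G) (φ : L →* H) : Setoid (H × G) where
  r a b := ∃ k : L, b.1 * φ k = a.1 ∧ b.2 = k * a.2
  iseqv :=
    { refl := fun a => ⟨1, by simp, by simp⟩
      symm := by
        rintro a b ⟨k, h1, h2⟩
        exact ⟨k⁻¹, by simp [← h1], by simp [h2]⟩
      trans := by
        rintro a b c ⟨k, h1, h2⟩ ⟨l, l1, l2⟩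
        exact ⟨l * k, by simp [← h1, ← l1, mul_assoc], by simp [h2, l2, mul_assoc]⟩ }

/-- The transitive biset `[L, φ] = H ×_{(L, φ)} G`, for a subgroup `L ≤ G` and a homomorphism
`φ : L → H`: the quotient of `H × G` by `(x, k y) ∼ (x φ(k), y)` for `k ∈ L`, with
`h (x, y) g = (h x, y g)`. -/
def basic [Finite G] [Finite H] (L : Subgroup G) (φ : L →* H) : Biset G H where
  carrier := Quotient (basicSetoid L φ)
  leftAct :=
    { smul := fun h => Quotient.map (fun a => (h * a.1, a.2)) (by
        rintro a b ⟨k, h1, h2⟩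
        exact ⟨k, by simp only [← h1, mul_assoc], h2⟩)
      one_smul := by
        rintro ⟨x, y⟩
        exact congrArg (Quotient.mk _) (Prod.ext (one_mul x) rfl)
      mul_smul := by
        rintro a b ⟨x, y⟩
        exact congrArg (Quotient.mk _) (Prod.ext (mul_assoc a b x) rfl) }
  rightAct :=
    { smul := fun g => Quotient.map (fun a => (a.1, a.2 * g.unop)) (by
        rintro a b ⟨k, h1, h2⟩
        exact ⟨k, h1, by simp only [h2, mul_assoc]⟩)
      one_smul := by
        rintro ⟨x, y⟩
        exact congrArg (Quotient.mk _) (Prod.ext rfl (mul_one y))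
      mul_smul := by
        rintro a b ⟨x, y⟩
        exact congrArg (Quotient.mk _) (Prod.ext rfl (mul_assoc y b.unop a.unop).symm) }
  commute := by
    refine @SMulCommClass.mk _ _ _ (_) (_) ?_
    rintro h g ⟨x, y⟩
    rfl
  left_free := by
    rintro h ⟨x, y⟩ e
    obtain ⟨k, h1, h2⟩ := Quotient.exact e
    have hk : k = 1 := by
      have h2' : y = (k : G) * y := h2
      exact Subtype.ext (by simpa using h2')
    subst hk
    simpa using h1

/-! Compatibility of composition and products with isomorphisms and disjoint unions. -/

theorem Iso.comp {X X' : Biset H K} {Y Y' : Biset G H} (hX : X.Iso X') (hY : Y.Iso Y') :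
    (X.comp Y).Iso (X'.comp Y') := by
  obtain ⟨e, e1, e2⟩ := hX
  obtain ⟨f, f1, f2⟩ := hY
  refine ⟨Quotient.congr (Equiv.prodCongr e f) ?_, ?_, ?_⟩
  · intro a b
    constructor
    · rintro ⟨h, h1, h2⟩
      refine ⟨h, ?_, ?_⟩
      · change op h • e b.1 = e a.1
        rw [← e2, h1]
      · change f b.2 = h • f a.2
        rw [← f1, h2]
    · rintro ⟨h, h1, h2⟩
      refine ⟨h, e.injective ?_, f.injective ?_⟩
      · rw [e2]; exact h1
      · rw [f1]; exact h2
  · rintro k ⟨x, y⟩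
    exact congrArg (Quotient.mk _) (Prod.ext (e1 k x) rfl)
  · rintro g ⟨x, y⟩
    exact congrArg (Quotient.mk _) (Prod.ext rfl (f2 g y))

theorem Iso.prod {X X' : Biset G H} {Y Y' : Biset G' H'} (hX : X.Iso X') (hY : Y.Iso Y') :
    (X.prod Y).Iso (X'.prod Y') := by
  obtain ⟨e, e1, e2⟩ := hX
  obtain ⟨f, f1, f2⟩ := hY
  exact ⟨Equiv.prodCongr e f, fun h a => Prod.ext (e1 h.1 a.1) (f1 h.2 a.2),
    fun g a => Prod.ext (e2 g.1 a.1) (f2 g.2 a.2)⟩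

theorem Iso.refl (X : Biset G H) : X.Iso X := ⟨Equiv.refl _, fun _ _ => rfl, fun _ _ => rfl⟩

theorem sum_comp (X X' : Biset H K) (Y : Biset G H) :
    ((X.sum X').comp Y).Iso ((X.comp Y).sum (X'.comp Y)) := by
  refine ⟨⟨Quotient.lift (fun a => Sum.elim
      (fun x => Sum.inl (Quotient.mk (tensorSetoid X Y) (x, a.2)))
      (fun x => Sum.inr (Quotient.mk (tensorSetoid X' Y) (x, a.2))) a.1) ?_,
    Sum.elim
      (Quotient.map (fun a => (Sum.inl a.1, a.2)) ?_)
      (Quotient.map (fun a => (Sum.inr a.1, a.2)) ?_), ?_, ?_⟩, ?_, ?_⟩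
  · rintro ⟨x | x, y⟩ ⟨x' | x', y'⟩ ⟨h, h1, h2⟩
    · exact congrArg Sum.inl (Quotient.sound ⟨h, Sum.inl_injective h1, h2⟩)
    · exact absurd h1 (by rintro ⟨⟩)
    · exact absurd h1 (by rintro ⟨⟩)
    · exact congrArg Sum.inr (Quotient.sound ⟨h, Sum.inr_injective h1, h2⟩)
  · rintro a b ⟨h, h1, h2⟩
    exact ⟨h, congrArg Sum.inl h1, h2⟩
  · rintro a b ⟨h, h1, h2⟩
    exact ⟨h, congrArg Sum.inr h1, h2⟩
  · rintro ⟨x | x, y⟩ <;> rfl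
  · rintro (⟨x, y⟩ | ⟨x, y⟩) <;> rfl
  · rintro k ⟨x | x, y⟩ <;> rfl
  · rintro g ⟨x | x, y⟩ <;> rfl

theorem comp_sum (X : Biset H K) (Y Y' : Biset G H) :
    (X.comp (Y.sum Y')).Iso ((X.comp Y).sum (X.comp Y')) := by
  refine ⟨⟨Quotient.lift (fun a => Sum.elim
      (fun y => Sum.inl (Quotient.mk (tensorSetoid X Y) (a.1, y)))
      (fun y => Sum.inr (Quotient.mk (tensorSetoid X Y') (a.1, y))) a.2) ?_,
    Sum.elim
      (Quotient.map (fun a => (a.1, Sum.inl a.2)) ?_)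
      (Quotient.map (fun a => (a.1, Sum.inr a.2)) ?_), ?_, ?_⟩, ?_, ?_⟩
  · rintro ⟨x, y | y⟩ ⟨x', y' | y'⟩ ⟨h, h1, h2⟩
    · exact congrArg Sum.inl (Quotient.sound ⟨h, h1, Sum.inl_injective h2⟩)
    · exact absurd h2 (by rintro ⟨⟩)
    · exact absurd h2 (by rintro ⟨⟩)
    · exact congrArg Sum.inr (Quotient.sound ⟨h, h1, Sum.inr_injective h2⟩)
  · rintro a b ⟨h, h1, h2⟩
    exact ⟨h, h1, congrArg Sum.inl h2⟩
  · rintro a b ⟨h, h1, h2⟩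
    exact ⟨h, h1, congrArg Sum.inr h2⟩
  · rintro ⟨x, y | y⟩ <;> rfl
  · rintro (⟨x, y⟩ | ⟨x, y⟩) <;> rfl
  · rintro k ⟨x, y | y⟩ <;> rfl
  · rintro g ⟨x, y | y⟩ <;> rfl

theorem sum_prod (X X' : Biset G H) (Y : Biset G' H') :
    ((X.sum X').prod Y).Iso ((X.prod Y).sum (X'.prod Y)) := by
  refine ⟨Equiv.sumProdDistrib _ _ _, ?_, ?_⟩
  · rintro h ⟨x | x, y⟩ <;> rfl
  · rintro g ⟨x | x, y⟩ <;> rfl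

theorem prod_sum (X : Biset G H) (Y Y' : Biset G' H') :
    (X.prod (Y.sum Y')).Iso ((X.prod Y).sum (X.prod Y')) := by
  refine ⟨Equiv.prodSumDistrib _ _ _, ?_, ?_⟩
  · rintro h ⟨x, y | y⟩ <;> rfl
  · rintro g ⟨x, y | y⟩ <;> rfl

end

end Biset

/-! ### Burnside modules -/

section Burnside

variable (k : Type) [CommRing k]

/-- The relations `[X] = [Y]` for isomorphic bisets and `[X ⊔ Y] = [X] + [Y]`. -/
noncomputable def relations (G H : Type u) [Group G] [Group H] : Submodule k (Biset G H →₀ k) :=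
  Submodule.span k
    ({z | ∃ X Y : Biset G H, X.Iso Y ∧ z = Finsupp.single X 1 - Finsupp.single Y 1} ∪
     {z | ∃ X Y : Biset G H,
        z = Finsupp.single (X.sum Y) 1 - Finsupp.single X 1 - Finsupp.single Y 1})

/-- The Burnside module `A(G, H) ⊗ k`: the Grothendieck group, with coefficients in `k`, of
isomorphism classes of finite left-free `(G, H)`-bisets under disjoint union. -/
def Burnside (G H : Type u) [Group G] [Group H] : Type (u + 1) :=
  (Biset G H →₀ k) ⧸ relations k G H

variable {G H K G' H' : Type u} [Group G] [Group H] [Group K] [Group G'] [Group H']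

noncomputable instance : AddCommGroup (Burnside k G H) :=
  inferInstanceAs (AddCommGroup ((Biset G H →₀ k) ⧸ relations k G H))

noncomputable instance : Module k (Burnside k G H) :=
  inferInstanceAs (Module k ((Biset G H →₀ k) ⧸ relations k G H))

namespace Burnside

/-- The class `[X]` of a biset. -/
noncomputable def cls (X : Biset G H) : Burnside k G H :=
  (relations k G H).mkQ (Finsupp.single X 1)

theorem cls_eq_of_iso {X Y : Biset G H} (h : X.Iso Y) : cls k X = cls k Y :=
  (Submodule.Quotient.eq _).2 (Submodule.subset_span (Or.inl ⟨X, Y, h, rfl⟩))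

theorem cls_sum (X Y : Biset G H) : cls k (X.sum Y) = cls k X + cls k Y := by
  refine (Submodule.Quotient.eq _).2 (Submodule.subset_span (Or.inr ⟨X, Y, ?_⟩))
  rw [sub_add_eq_sub_sub]

variable {k} in
/-- An additive isomorphism invariant of bisets extends linearly to the Burnside module. -/
noncomputable def lift {M : Type*} [AddCommGroup M] [Module k M] (f : Biset G H → M)
    (hiso : ∀ X Y, X.Iso Y → f X = f Y) (hsum : ∀ X Y, f (X.sum Y) = f X + f Y) :
    Burnside k G H →ₗ[k] M :=
  (relations k G H).liftQ (Finsupp.linearCombination k f) (by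
    refine Submodule.span_le.2 ?_
    rintro z (⟨X, Y, h, rfl⟩ | ⟨X, Y, rfl⟩)
    · simp [hiso X Y h]
    · simp [hsum X Y])

variable {k} in
@[simp]
theorem lift_cls {M : Type*} [AddCommGroup M] [Module k M] (f : Biset G H → M)
    (hiso : ∀ X Y, X.Iso Y → f X = f Y) (hsum : ∀ X Y, f (X.sum Y) = f X + f Y)
    (X : Biset G H) : lift (k := k) f hiso hsum (cls k X) = f X := by
  unfold lift cls
  rw [Submodule.mkQ_apply]
  erw [Submodule.liftQ_apply]
  simp

variable {k} in
theorem hom_ext {M : Type*} [AddCommGroup M] [Module k M] {f g : Burnside k G H →ₗ[k] M}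
    (h : ∀ X, f (cls k X) = g (cls k X)) : f = g := by
  refine Submodule.linearMap_qext _ (Finsupp.lhom_ext' fun X => LinearMap.ext_ring ?_)
  exact h X


variable {k} in
theorem lift_ext {M : Type*} [AddCommGroup M] [Module k M] {f g : Biset G H → M}
    {hf hf' hg hg'} (h : ∀ X, f X = g X) :
    lift (k := k) f hf hf' = lift (k := k) g hg hg' :=
  hom_ext fun X => by rw [lift_cls, lift_cls, h X]

variable {k} in
theorem lift_add {M : Type*} [AddCommGroup M] [Module k M] {e f g : Biset G H → M}
    {he he' hf hf' hg hg'} (h : ∀ X, e X = f X + g X) :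
    lift (k := k) e he he' = lift (k := k) f hf hf' + lift (k := k) g hg hg' :=
  hom_ext fun X => by rw [LinearMap.add_apply, lift_cls, lift_cls, lift_cls, h X]

variable {k} in
/-- The composition pairing `A(H, K) × A(G, H) → A(G, K)`, the bilinear map with
`[X] ∘ [Y] = [X ×_H Y]`. -/
noncomputable def comp : Burnside k H K →ₗ[k] Burnside k G H →ₗ[k] Burnside k G K :=
  lift (fun X => lift (fun Y => cls k (X.comp Y))
      (fun _ _ h => cls_eq_of_iso k ((Biset.Iso.refl X).comp h))
      (fun Y Y' => (cls_eq_of_iso k (Biset.comp_sum X Y Y')).trans (cls_sum k _ _)))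
    (fun _ _ h => lift_ext fun Y => cls_eq_of_iso k (h.comp (Biset.Iso.refl Y)))
    (fun X X' => lift_add fun Y =>
      (cls_eq_of_iso k (Biset.sum_comp X X' Y)).trans (cls_sum k _ _))

variable {k} in
/-- The Cartesian product pairing `A(G, H) × A(G', H') → A(G × G', H × H')`, the bilinear map
with `[X] × [Y] = [X × Y]`. -/
noncomputable def prod :
    Burnside k G H →ₗ[k] Burnside k G' H' →ₗ[k] Burnside k (G × G') (H × H') :=
  lift (fun X => lift (fun Y => cls k (X.prod Y))
      (fun _ _ h => cls_eq_of_iso k ((Biset.Iso.refl X).prod h))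
      (fun Y Y' => (cls_eq_of_iso k (Biset.prod_sum X Y Y')).trans (cls_sum k _ _)))
    (fun _ _ h => lift_ext fun Y => cls_eq_of_iso k (h.prod (Biset.Iso.refl Y)))
    (fun X X' => lift_add fun Y =>
      (cls_eq_of_iso k (Biset.sum_prod X X' Y)).trans (cls_sum k _ _))

/-- The class `[L, φ]` for a subgroup `L ≤ G` and a homomorphism `φ : L → H`. -/
noncomputable def basic [Finite G] [Finite H] (L : Subgroup G) (φ : L →* H) : Burnside k G H :=
  cls k (Biset.basic L φ)

/-- The class `[G, φ]` for a homomorphism `φ : G → H` defined on all of `G`. -/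
noncomputable def ofHom [Finite G] [Finite H] (φ : G →* H) : Burnside k G H :=
  basic k ⊤ (φ.comp (⊤ : Subgroup G).subtype)

variable {k} in
/-- The pairing `κ(x, y) = (x × y) ∘ [G, Δ]` from `A(G, H) × A(G, H)` to `A(G, H × H)`, where
`Δ : G → G × G` is the diagonal. -/
noncomputable def kappa [Finite G] (x y : Burnside k G H) : Burnside k G (H × H) :=
  comp (prod x y) (ofHom k ((MonoidHom.id G).prod (MonoidHom.id G)))

/-- The Nishida ideal of `A(G, G) ⊗ k`: the `k`-span of the classes `[P, ψ]` where `ψ(P)` is a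
proper subgroup of `G`. -/
noncomputable def nishida (G : Type u) [Group G] [Finite G] : Submodule k (Burnside k G G) :=
  Submodule.span k {z | ∃ (P : Subgroup G) (ψ : P →* G), ψ.range < ⊤ ∧ z = basic k P ψ}

end Burnside

end Burnside

/-! ### Submodules preserving `κ` and retractive transfers -/

section Kappa

open Burnside

variable {k : Type} [CommRing k] {S : Type u} [Group S] [Finite S]

/-- A `κ`-preserving submodule of `A(S, S) ⊗ k`: a left `A(S, S)`-submodule `R` of `A(S, S)`
together with a left `A(S × S, S × S)`-submodule `R'` of `A(S, S × S)`, such that every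
`h ∈ A(S, S × S)` maps `R` into `R'` and such that `κ` restricts to a pairing `R × R → R'`. -/
structure IsKappaPreserving (R : Submodule k (Burnside k S S))
    (R' : Submodule k (Burnside k S (S × S))) : Prop where
  comp_mem : ∀ (a : Burnside k S S), ∀ x ∈ R, comp a x ∈ R
  comp_mem' : ∀ (a : Burnside k (S × S) (S × S)), ∀ z ∈ R', comp a z ∈ R'
  natural : ∀ (h : Burnside k S (S × S)), ∀ x ∈ R, comp h x ∈ R'
  kappa_mem : ∀ x ∈ R, ∀ y ∈ R, kappa x y ∈ R'

/-- A retractive transfer for `(R, R')`: an `A(S, S)`-linear retraction `t : A(S, S) → R` and an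
`A(S × S, S × S)`-linear retraction `t' : A(S, S × S) → R'` of the two inclusions, compatible with
composition with every `h ∈ A(S, S × S)` and satisfying `t'(κ(x, y)) = κ(x, t(y))` for `x ∈ R`
and `y ∈ A(S, S)`. -/
structure RetractiveTransfer (R : Submodule k (Burnside k S S))
    (R' : Submodule k (Burnside k S (S × S))) where
  t : Burnside k S S →ₗ[k] R
  t' : Burnside k S (S × S) →ₗ[k] R'
  map_comp : ∀ a x : Burnside k S S, (t (comp a x) : Burnside k S S) = comp a (t x)
  map_comp' : ∀ (a : Burnside k (S × S) (S × S)) (z : Burnside k S (S × S)),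
    (t' (comp a z) : Burnside k S (S × S)) = comp a (t' z)
  retract : ∀ x : R, t x = x
  retract' : ∀ z : R', t' z = z
  natural : ∀ (h : Burnside k S (S × S)) (x : Burnside k S S),
    (t' (comp h x) : Burnside k S (S × S)) = comp h (t x)
  frobenius : ∀ (x : R) (y : Burnside k S S),
    (t' (kappa (x : Burnside k S S) y) : Burnside k S (S × S)) = kappa (x : Burnside k S S) (t y)

end Kappa

/-! ### Fusion systems -/

/-- Conjugation by `g`, as a homomorphism `P → Q` when `g P g⁻¹ ≤ Q`. -/
def conjHom {S : Type u} [Group S] {P Q : Subgroup S} (g : S) (hg : ∀ x ∈ P, g * x * g⁻¹ ∈ Q) :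
    P →* Q where
  toFun x := ⟨g * x * g⁻¹, hg x x.2⟩
  map_one' := by simp
  map_mul' x y := by simp

/-- The image of a homomorphism `P → Q`, as a subgroup of the ambient group. -/
def image {S : Type u} [Group S] {P Q : Subgroup S} (φ : P →* Q) : Subgroup S :=
  φ.range.map Q.subtype

/-- A fusion system on `S`: sets `Hom(P, Q)` of injective homomorphisms between the subgroups of
`S` that form a category under composition, contain all conjugations by elements of `S` (in
particular inclusions and identities), and contain, for each `φ ∈ Hom(P, Q)`, the induced
isomorphism `P → φ(P)` and its inverse. -/
structure FusionSystem (S : Type u) [Group S] where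
  Hom : ∀ P Q : Subgroup S, Set (P →* Q)
  injective : ∀ {P Q : Subgroup S}, ∀ φ ∈ Hom P Q, Function.Injective φ
  conj_mem : ∀ {P Q : Subgroup S} (g : S) (hg : ∀ x ∈ P, g * x * g⁻¹ ∈ Q), conjHom g hg ∈ Hom P Q
  iso_mem : ∀ {P Q : Subgroup S}, ∀ φ ∈ Hom P Q, ∀ e : P ≃* image φ,
    (∀ x, (e x : S) = φ x) →
      e.toMonoidHom ∈ Hom P (image φ) ∧ e.symm.toMonoidHom ∈ Hom (image φ) P
  comp_mem : ∀ {P Q R : Subgroup S}, ∀ φ ∈ Hom P Q, ∀ ψ ∈ Hom Q R, ψ.comp φ ∈ Hom P R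

namespace FusionSystem

variable {S : Type u} [Group S] (F : FusionSystem S)

/-- Two subgroups are `F`-conjugate if they are isomorphic in `F`. -/
def Conj (P Q : Subgroup S) : Prop := ∃ φ ∈ F.Hom P Q, Function.Bijective φ

/-- `P` is fully `F`-centralized if `|C_S(P)| ≥ |C_S(Q)|` for all `F`-conjugates `Q` of `P`. -/
def FullyCentralized (P : Subgroup S) : Prop :=
  ∀ Q : Subgroup S, F.Conj P Q →
    Nat.card (Subgroup.centralizer (Q : Set S)) ≤ Nat.card (Subgroup.centralizer (P : Set S))

/-- `P` is fully `F`-normalized if `|N_S(P)| ≥ |N_S(Q)|` for all `F`-conjugates `Q` of `P`. -/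
def FullyNormalized (P : Subgroup S) : Prop :=
  ∀ Q : Subgroup S, F.Conj P Q →
    Nat.card (Subgroup.normalizer (Q : Set S)) ≤ Nat.card (Subgroup.normalizer (P : Set S))

/-- The group `Aut_F(P)` of automorphisms of `P` in `F`. -/
def aut (P : Subgroup S) : Subgroup (MulAut P) where
  carrier := {e | (e : P ≃* P).toMonoidHom ∈ F.Hom P P}
  one_mem' := by
    have h := F.conj_mem (P := P) (Q := P) 1 (by simp)
    have h' : conjHom (P := P) (Q := P) (1 : S) (by simp) =
        (MulEquiv.refl P).toMonoidHom := by
      ext x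
      simp [conjHom]
    rw [h'] at h
    exact h
  mul_mem' := by
    intro a b ha hb
    exact F.comp_mem _ hb _ ha
  inv_mem' := by
    intro a ha
    have him : image (a : P ≃* P).toMonoidHom = P := by
      ext x
      simp only [image, Subgroup.mem_map, MonoidHom.mem_range]
      constructor
      · rintro ⟨y, -, rfl⟩
        exact y.2
      · intro hx
        exact ⟨⟨x, hx⟩, ⟨a.symm ⟨x, hx⟩, a.apply_symm_apply _⟩, rfl⟩
    have h1 := F.iso_mem _ ha (a.trans (MulEquiv.subgroupCongr him.symm)) (fun x => rfl)
    have h2 := F.conj_mem (P := P) (Q := image (a : P ≃* P).toMonoidHom) 1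
      (by rw [him]; simp)
    have h3 := F.comp_mem _ h2 _ h1.2
    refine Set.mem_of_eq_of_mem (s := F.Hom P P) (MonoidHom.ext fun x => ?_) h3
    change a.symm x = a.symm _
    exact congrArg a.symm (Subtype.ext (show (x : S) = 1 * x * 1⁻¹ by simp))

/-- The group `Aut_S(P)` of automorphisms of `P` induced by conjugation in `S`. -/
def autS (P : Subgroup S) : Subgroup (MulAut P) := P.normalizerMonoidHom.range

/-- The subgroup `N_φ` of those `x ∈ N_S(P)` for which there is `y ∈ N_S(φ(P))` such that
`φ(x u x⁻¹) = y φ(u) y⁻¹` for all `u ∈ P`. -/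
def extender {P Q : Subgroup S} (φ : P →* Q) : Subgroup S where
  carrier := {x | ∃ hx : x ∈ Subgroup.normalizer (P : Set S),
    ∃ y ∈ Subgroup.normalizer (image φ : Set S),
      ∀ u : P, (φ (P.normalizerMonoidHom ⟨x, hx⟩ u) : S) = y * φ u * y⁻¹}
  one_mem' := ⟨one_mem _, 1, one_mem _, fun u => by
    have : (⟨1, one_mem _⟩ : Subgroup.normalizer (P : Set S)) = 1 := rfl
    rw [this, map_one]
    simp⟩
  mul_mem' := by
    rintro a b ⟨ha, y, hy, h⟩ ⟨hb, z, hz, h'⟩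
    refine ⟨mul_mem ha hb, y * z, mul_mem hy hz, fun u => ?_⟩
    have : (⟨a * b, mul_mem ha hb⟩ : Subgroup.normalizer (P : Set S)) = ⟨a, ha⟩ * ⟨b, hb⟩ := rfl
    rw [this, map_mul, MulAut.mul_apply, h, h']
    group
  inv_mem' := by
    rintro a ⟨ha, y, hy, h⟩
    refine ⟨inv_mem ha, y⁻¹, inv_mem hy, fun u => ?_⟩
    have : (⟨a⁻¹, inv_mem ha⟩ : Subgroup.normalizer (P : Set S)) = ⟨a, ha⟩⁻¹ := rfl
    rw [this, map_inv]
    have h2 := h ((P.normalizerMonoidHom ⟨a, ha⟩)⁻¹ u)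
    rw [MulAut.apply_inv_self] at h2
    rw [h2]
    group

theorem le_extender {P Q : Subgroup S} (φ : P →* Q) : P ≤ extender φ := by
  intro x hx
  refine ⟨Subgroup.le_normalizer hx, φ ⟨x, hx⟩,
    Subgroup.le_normalizer ⟨φ ⟨x, hx⟩, ⟨⟨x, hx⟩, rfl⟩, rfl⟩, fun u => ?_⟩
  have h : P.normalizerMonoidHom ⟨x, Subgroup.le_normalizer hx⟩ u
      = ⟨x, hx⟩ * u * (⟨x, hx⟩ : P)⁻¹ := Subtype.ext rfl
  rw [h]
  simp

/-- A fusion system on a finite `p`-group `S` is saturated if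

(I) every fully normalized `P` is fully centralized and `Aut_S(P)` is a Sylow `p`-subgroup of
`Aut_F(P)`;

(II) every `φ ∈ Hom_F(P, S)` with `φ(P)` fully centralized extends to a morphism in
`Hom_F(N_φ, S)`. -/
structure IsSaturated (p : ℕ) : Prop where
  sylow : ∀ P : Subgroup S, F.FullyNormalized P →
    F.FullyCentralized P ∧
      ∃ T : Sylow p (F.aut P), (T : Subgroup (F.aut P)).map (F.aut P).subtype = autS P
  extension : ∀ (P : Subgroup S), ∀ φ ∈ F.Hom P ⊤, F.FullyCentralized (image φ) →
    ∃ ψ ∈ F.Hom (extender φ) ⊤, ψ.comp (Subgroup.inclusion (le_extender φ)) = φ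

/-- An element `X` of `A(S, T) ⊗ k` is right `F`-stable if `X ∘ [P, φ] = X ∘ [P, incl]` in
`A(P, T) ⊗ k` for all `P ≤ S` and all `φ ∈ Hom_F(P, S)`. -/
def RightStable {k : Type} [CommRing k] {T : Type u} [Group T] [Finite S]
    (X : Burnside k S T) : Prop :=
  ∀ (P : Subgroup S), ∀ φ ∈ F.Hom P ⊤,
    Burnside.comp X (Burnside.ofHom k ((⊤ : Subgroup S).subtype.comp φ)) =
      Burnside.comp X (Burnside.ofHom k P.subtype)

end FusionSystem

/-- The localization `ℤ_(p)` of the integers at the prime ideal `(p)`. -/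
abbrev IntLoc (p : ℕ) [Fact p.Prime] : Type := Localization.AtPrime (Ideal.span {(p : ℤ)})

end DoubleBurnside

namespace DoubleBurnside

universe u

open MulOpposite (op)

/-! For homomorphisms `α : Q → H` and `β : Q → G`, the mark at `(α, β)` counts the points of a biset
with `α(q) x = x β(q)`. Over a domain of characteristic zero, marks determine an element of the
Burnside module (`eq_of_mark_eq`). In marks, composition is matrix multiplication up to the factor
`|H|` (`mark_comp`), and `κ` multiplies two marks with the same right homomorphism (`mark_kappa`).
Both directions thus concern the matrix `mark α β ω` of one element `ω` of `A(S, S)`; its column at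
`β` is the function `α ↦ mark α β ω`.

From a transfer to a fusion system: `t` and `t'` are right composition with `ω = t(id)`, so `R` and
`R'` consist of the `X` with `X ∘ ω = X`. Frobenius reciprocity for `ω` and the identity reads `κ(ω,
id) ∘ ω = κ(ω, ω)`; in marks, a nonzero entry at `(β, γ)` forces the columns at `β` and `γ` to
coincide. Idempotence then makes each nonzero column sum to `|S|`. Since `R` is not in the Nishida
ideal, one column over the identity of `S` is nonzero, and a congruence modulo `p |S|` between
column sums spreads this to all columns (`sum_mark`). The morphisms of `F` are the `φ` whose column
equals that of the inclusion. Closure under restriction, injectivity and saturation rest on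
`mark_congruence`, which compares marks over `Q` with marks of extensions to a larger `p`-group
normalizing `Q`. Orbit counting finds in each conjugacy class a subgroup that is receptive and
automized (`exists_automized`, `receptive_of_not_dvd`), which suffices for saturation
(`isSaturated_of_exists`).

From a fusion system to a transfer: it is enough to find `ω` with marks only at pairs related by
`F`, right stable, and with all column sums `|S|`. Starting from `[S, id]` and descending over the
orders of subgroups, multiples of `[Q, ψ]` are subtracted to make the marks stable. The divisibility
this needs comes from orbit counting for the normalizer of the graph of `ψ`, whose two projections
saturation carries into `F` (`IsSaturated.mark_basic_self_dvd_sub`). The resulting column sums are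
`|S|` times units, because `Aut_S(S)` has index prime to `p` in `Aut_F(S)`; a finite correction
makes them equal to `|S|` (`exists_sum_mark_eq`). -/

noncomputable instance fintypeMonoidHom {Q H : Type*} [Group Q] [Group H] [Finite Q] [Finite H] :
    Fintype (Q →* H) :=
  @Fintype.ofFinite _ (DFunLike.finite _)

theorem card_eq_card_mul_of_fibers {A B : Type*} [Finite A] [Finite B] (f : A → B) (n : ℕ)
    (h : ∀ b, Nat.card {a // f a = b} = n) : Nat.card A = Nat.card B * n := by
  have := Fintype.ofFinite B
  rw [Nat.card_congr (Equiv.sigmaFiberEquiv f).symm, Nat.card_sigma, Finset.sum_congr rfl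
    (fun b _ => h b), Finset.sum_const, Finset.card_univ, smul_eq_mul, Nat.card_eq_fintype_card]

/-! ### Fixed points of bisets along pairs of homomorphisms. -/

namespace Biset

section

variable {G H K G' H' : Type u} [Group G] [Group H] [Group K] [Group G'] [Group H']
variable {Q Q' : Type*} [Group Q] [Group Q']

/-- The points `x` of a biset with `α(q) x = x β(q)` for all `q`. -/
def fixed (X : Biset G H) (α : Q →* H) (β : Q →* G) : Set X.carrier :=
  {x | ∀ q, α q • x = op (β q) • x}

theorem mem_fixed {X : Biset G H} {α : Q →* H} {β : Q →* G} {x : X.carrier} :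
    x ∈ X.fixed α β ↔ ∀ q, α q • x = op (β q) • x := Iff.rfl

theorem smul_left_cancel_of_free (X : Biset G H) {h h' : H} {x : X.carrier}
    (e : h • x = h' • x) : h = h' := by
  have := X.left_free (h'⁻¹ * h) x (by rw [mul_smul, e, inv_smul_smul])
  rwa [inv_mul_eq_one, eq_comm] at this

/-- Freeness on the left leaves a point and a right homomorphism at most one left homomorphism, so
sums over left homomorphisms count points without repetition. -/
theorem left_unique {X : Biset G H} {α α' : Q →* H} {β : Q →* G} {x : X.carrier}
    (h : x ∈ X.fixed α β) (h' : x ∈ X.fixed α' β) : α = α' :=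
  MonoidHom.ext fun q => X.smul_left_cancel_of_free ((h q).trans (h' q).symm)

/-- If `x β(q) ∈ H x` for all `q`, then `x` is fixed by the graph of a homomorphism. -/
theorem exists_mem_fixed (X : Biset G H) (β : Q →* G) (x : X.carrier)
    (h : ∀ q, ∃ a : H, a • x = op (β q) • x) : ∃ α : Q →* H, x ∈ X.fixed α β := by
  choose a ha using h
  refine ⟨MonoidHom.mk' a fun q r => X.smul_left_cancel_of_free (x := x) ?_, ha⟩
  rw [ha, map_mul, MulOpposite.op_mul, mul_smul, ← ha q, mul_smul, ha r, ← smul_comm]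

theorem Iso.card_fixed {X Y : Biset G H} (e : X.Iso Y) (α : Q →* H) (β : Q →* G) :
    Nat.card (X.fixed α β) = Nat.card (Y.fixed α β) := by
  obtain ⟨e, e1, e2⟩ := e
  refine Nat.card_congr (e.subtypeEquiv fun x => ?_)
  refine forall_congr' fun q => ?_
  rw [← e1, ← e2, e.injective.eq_iff]

theorem card_fixed_sum (X Y : Biset G H) (α : Q →* H) (β : Q →* G) :
    Nat.card ((X.sum Y).fixed α β) = Nat.card (X.fixed α β) + Nat.card (Y.fixed α β) := by
  rw [← Nat.card_sum]
  refine Nat.card_congr (Equiv.trans (Equiv.subtypeSum (p := fun x => x ∈ (X.sum Y).fixed α β)) ?_)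
  refine Equiv.sumCongr (Equiv.subtypeEquivRight fun x => ?_) (Equiv.subtypeEquivRight fun x => ?_)
  · exact forall_congr' fun q => Sum.inl_injective.eq_iff
  · exact forall_congr' fun q => Sum.inr_injective.eq_iff

/-- The elements of `H` witnessing that a class is fixed are unique, because `Y` is free; uniqueness
makes them a homomorphism. -/
theorem mk_mem_fixed_comp {X : Biset H K} {Y : Biset G H} {α : Q →* K} {γ : Q →* G}
    {x : X.carrier} {y : Y.carrier} :
    (Quotient.mk (tensorSetoid X Y) (x, y) : (X.comp Y).carrier) ∈ (X.comp Y).fixed α γ ↔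
      ∃ β : Q →* H, x ∈ X.fixed α β ∧ y ∈ Y.fixed β γ := by
  constructor
  · intro h
    have h' : ∀ q, ∃ a : H, op a • x = α q • x ∧ a • y = op (γ q) • y := by
      intro q
      obtain ⟨a, h1, h2⟩ := Quotient.exact (h q)
      exact ⟨a, h1, h2.symm⟩
    choose a h1 h2 using h'
    obtain ⟨β, hβ⟩ := Y.exists_mem_fixed γ y fun q => ⟨a q, h2 q⟩
    refine ⟨β, fun q => ?_, hβ⟩
    rw [← h1 q, Y.smul_left_cancel_of_free ((hβ q).trans (h2 q).symm)]
  · rintro ⟨β, h1, h2⟩ q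
    exact Quotient.sound ⟨β q, (h1 q).symm, (h2 q).symm⟩

/-- The empty biset. -/
def empty : Biset G H where
  carrier := PEmpty
  leftAct := { smul := fun _ => id, one_smul := fun _ => rfl, mul_smul := fun _ _ _ => rfl }
  rightAct := { smul := fun _ => id, one_smul := fun _ => rfl, mul_smul := fun _ _ _ => rfl }
  commute := @SMulCommClass.mk _ _ _ (_) (_) fun _ _ _ => rfl
  left_free := fun _ x => x.elim

/-- Both sides count the pairs `(x, y)` with fixed class: the quotient map has fibres of size `|H|`,
since `H` acts freely on `y`, and each pair determines its middle homomorphism. -/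
theorem card_fixed_comp [Finite Q] [Finite G] [Finite H] [Finite K] (X : Biset H K) (Y : Biset G H)
    (α : Q →* K) (γ : Q →* G) :
    Nat.card ((X.comp Y).fixed α γ) * Nat.card H =
      ∑ β : Q →* H, Nat.card (X.fixed α β) * Nat.card (Y.fixed β γ) := by
  let A := {a : X.carrier × Y.carrier //
    (Quotient.mk (tensorSetoid X Y) a : (X.comp Y).carrier) ∈ (X.comp Y).fixed α γ}
  let f : A → (X.comp Y).fixed α γ := fun a => ⟨Quotient.mk _ a.1, a.2⟩
  have h1 : Nat.card A = Nat.card ((X.comp Y).fixed α γ) * Nat.card H := by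
    refine card_eq_card_mul_of_fibers f _ ?_
    rintro ⟨⟨x, y⟩, hxy⟩
    symm
    have hs : ∀ h : H, Quotient.mk (tensorSetoid X Y) (op h⁻¹ • x, h • y) =
        Quotient.mk (tensorSetoid X Y) (x, y) := fun h =>
      Quotient.sound ⟨h⁻¹, rfl, by simp⟩
    refine Nat.card_eq_of_bijective
      (fun h : H => ⟨⟨(op h⁻¹ • x, h • y), Set.mem_of_eq_of_mem (hs h) hxy⟩, Subtype.ext (hs h)⟩)
      ⟨?_, ?_⟩
    · intro h h' e
      exact Y.smul_left_cancel_of_free (congrArg (fun a => a.1.1.2) e)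
    · rintro ⟨⟨⟨x', y'⟩, h'⟩, e⟩
      obtain ⟨h, e1, e2⟩ := Quotient.exact (congrArg Subtype.val e)
      refine ⟨h⁻¹, Subtype.ext (Subtype.ext (Prod.ext ?_ ?_))⟩
      · change op h⁻¹⁻¹ • x = x'
        rw [inv_inv]
        exact e1
      · change h⁻¹ • y = y'
        rw [inv_smul_eq_iff]
        exact e2
  rw [← h1]
  simp_rw [← Nat.card_prod]
  rw [← Nat.card_sigma]
  symm
  refine Nat.card_eq_of_bijective
    (fun a => ⟨(a.2.1.1, a.2.2.1), mk_mem_fixed_comp.2 ⟨a.1, a.2.1.2, a.2.2.2⟩⟩) ⟨?_, ?_⟩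
  · rintro ⟨β, ⟨x, hx⟩, ⟨y, hy⟩⟩ ⟨β', ⟨x', hx'⟩, ⟨y', hy'⟩⟩ e
    obtain ⟨rfl, rfl⟩ := Prod.ext_iff.1 (congrArg Subtype.val e)
    obtain rfl := Y.left_unique hy hy'
    rfl
  · rintro ⟨⟨x, y⟩, h⟩
    obtain ⟨β, hx, hy⟩ := mk_mem_fixed_comp.1 h
    exact ⟨⟨β, ⟨x, hx⟩, ⟨y, hy⟩⟩, rfl⟩

theorem card_fixed_prod (X : Biset G H) (Y : Biset G' H') (α : Q →* H × H') (β : Q →* G × G') :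
    Nat.card ((X.prod Y).fixed α β) =
      Nat.card (X.fixed ((MonoidHom.fst H H').comp α) ((MonoidHom.fst G G').comp β)) *
      Nat.card (Y.fixed ((MonoidHom.snd H H').comp α) ((MonoidHom.snd G G').comp β)) := by
  rw [← Nat.card_prod]
  refine Nat.card_congr (Equiv.trans (Equiv.subtypeEquivRight fun x => ?_)
    (Equiv.Set.prod _ _))
  constructor
  · intro h
    exact ⟨fun q => congrArg Prod.fst (h q), fun q => congrArg Prod.snd (h q)⟩
  · intro h q
    exact Prod.ext (h.1 q) (h.2 q)

/-- Composing with `[G, φ]` restricts the right action along `φ`: pairing `x` with the class of `(1,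
1)` is a bijection onto the composite. -/
theorem card_fixed_comp_hom [Finite G] [Finite H] (X : Biset H K) (φ : G →* H) (α : Q →* K)
    (γ : Q →* G) :
    Nat.card ((X.comp (basic ⊤ (φ.comp (⊤ : Subgroup G).subtype))).fixed α γ) =
      Nat.card (X.fixed α (φ.comp γ)) := by
  symm
  let B := basic (⊤ : Subgroup G) (φ.comp (⊤ : Subgroup G).subtype)
  let o : B.carrier := Quotient.mk _ (1, 1)
  have ho : ∀ g : G, φ g • o = op g • o := fun g =>
    Quotient.sound ⟨⟨g, trivial⟩, by simp, by simp⟩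
  let f : X.carrier → (X.comp B).carrier := fun x => Quotient.mk _ (x, o)
  have hf : Function.Bijective f := by
    constructor
    · intro x x' e
      obtain ⟨h, e1, e2⟩ := Quotient.exact e
      have : h = 1 := B.left_free h o e2.symm
      subst this
      simpa using e1.symm
    · rintro ⟨x, ⟨h, g⟩⟩
      refine ⟨op (h * φ g) • x, Quotient.sound ⟨h * φ g, rfl, ?_⟩⟩
      exact Quotient.sound ⟨⟨g⁻¹, trivial⟩, by simp, by simp⟩
  have h1 : ∀ (a : K) x, f (a • x) = a • f x := fun a x => rfl
  have h2 : ∀ (g : G) x, f (op (φ g) • x) = op g • f x := fun g x =>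
    Quotient.sound ⟨φ g, rfl, (ho g).symm⟩
  refine Nat.card_congr ((Equiv.ofBijective f hf).subtypeEquiv fun x => ?_)
  refine forall_congr' fun q => ?_
  rw [Equiv.ofBijective_apply, ← h1, ← h2, hf.1.eq_iff]
  rfl

theorem fixed_comp_of_surjective (X : Biset G H) (α : Q →* H) (β : Q →* G) (e : Q' →* Q)
    (he : Function.Surjective e) : X.fixed (α.comp e) (β.comp e) = X.fixed α β := by
  ext x
  exact (he.forall (p := fun q => α q • x = op (β q) • x)).symm

theorem card_fixed_conj (X : Biset G H) {α α' : Q →* H} {β β' : Q →* G} (h : H) (g : G)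
    (hα : ∀ q, α' q = h * α q * h⁻¹) (hβ : ∀ q, β' q = g * β q * g⁻¹) :
    Nat.card (X.fixed α' β') = Nat.card (X.fixed α β) := by
  symm
  refine Nat.card_congr (((MulAction.toPerm h).trans (MulAction.toPerm (op g⁻¹))).subtypeEquiv
    fun x => ?_)
  refine forall_congr' fun q => ?_
  simp only [Equiv.trans_apply, MulAction.toPerm_apply, hα, hβ]
  have e1 : (h * α q * h⁻¹) • op g⁻¹ • h • x = op g⁻¹ • h • α q • x := by
    rw [smul_comm, ← mul_smul, ← mul_smul]; simp
  have e2 : op (g * β q * g⁻¹) • op g⁻¹ • h • x = op g⁻¹ • h • op (β q) • x := by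
    rw [← mul_smul, ← MulOpposite.op_mul, smul_comm h, ← mul_smul, ← MulOpposite.op_mul]
    simp [mul_assoc]
  rw [e1, e2, smul_left_cancel_iff, smul_left_cancel_iff]

theorem eq_one_of_mem_fixed {X : Biset G H} {α : Q →* H} {β : Q →* G} {x : X.carrier}
    (hx : x ∈ X.fixed α β) {q : Q} (hq : β q = 1) : α q = 1 :=
  X.left_free _ x (by rw [hx q, hq]; simp)

end

end Biset

/-! ### Marks as linear functionals. -/

namespace Burnside

variable {k : Type} [CommRing k]
variable {G H K G' H' : Type u} [Group G] [Group H] [Group K] [Group G'] [Group H']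
variable {Q Q' : Type*} [Group Q] [Group Q']

theorem span_cls : Submodule.span k (Set.range (cls k : Biset G H → Burnside k G H)) = ⊤ := by
  rw [eq_top_iff]
  rintro z -
  obtain ⟨f, rfl⟩ := Submodule.mkQ_surjective (relations k G H) z
  induction f using Finsupp.induction_linear with
  | zero => rw [map_zero]; exact zero_mem _
  | add f g hf hg => rw [map_add]; exact add_mem hf hg
  | single X a =>
    have : (Finsupp.single X a : Biset G H →₀ k) = a • Finsupp.single X 1 := by simp
    rw [this, map_smul]
    exact Submodule.smul_mem _ _ (Submodule.subset_span ⟨X, rfl⟩)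

@[elab_as_elim]
theorem induction {P : Burnside k G H → Prop} (z : Burnside k G H) (cls : ∀ X, P (cls k X))
    (add : ∀ x y, P x → P y → P (x + y)) (smul : ∀ (a : k) x, P x → P (a • x)) : P z := by
  have hz : z ∈ Submodule.span k (Set.range (Burnside.cls k : Biset G H → Burnside k G H)) := by
    rw [span_cls]; trivial
  have zero : P 0 := by
    rw [← zero_smul k (Burnside.cls k (Biset.empty : Biset G H))]
    exact smul _ _ (cls _)
  induction hz using Submodule.span_induction with
  | mem x h =>
    obtain ⟨X, rfl⟩ := h
    exact cls X
  | zero => exact zero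
  | add x y _ _ hx hy => exact add x y hx hy
  | smul a x _ hx => exact smul a x hx

/-- The mark homomorphism counting the points `x` with `α(q) x = x β(q)` for all `q`. -/
noncomputable def mark (α : Q →* H) (β : Q →* G) : Burnside k G H →ₗ[k] k :=
  lift (fun X => (Nat.card (X.fixed α β) : k)) (fun _ _ e => by rw [e.card_fixed])
    (fun X Y => by rw [Biset.card_fixed_sum, Nat.cast_add])

@[simp]
theorem mark_cls (α : Q →* H) (β : Q →* G) (X : Biset G H) :
    mark α β (cls k X) = (Nat.card (X.fixed α β) : k) := lift_cls _ _ _ X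

@[simp]
theorem comp_cls (X : Biset H K) (Y : Biset G H) :
    comp (cls k X) (cls k Y) = cls k (X.comp Y) := by
  simp [comp]

@[simp]
theorem prod_cls (X : Biset G H) (Y : Biset G' H') :
    prod (cls k X) (cls k Y) = cls k (X.prod Y) := by
  simp [prod]

/-- The factor `|H|` stays on the left because it need not be invertible in `k`. -/
theorem mark_comp [Finite Q] [Finite G] [Finite H] [Finite K] (α : Q →* K) (γ : Q →* G)
    (x : Burnside k H K) (y : Burnside k G H) :
    mark α γ (comp x y) * (Nat.card H : k) = ∑ β : Q →* H, mark α β x * mark β γ y := by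
  induction x using induction with
  | add x x' hx hx' =>
    simp only [map_add, LinearMap.add_apply, add_mul, Finset.sum_add_distrib, hx, hx']
  | smul a x hx =>
    simp only [map_smul, LinearMap.smul_apply, smul_eq_mul, mul_assoc, hx, Finset.mul_sum]
  | cls X =>
    induction y using induction with
    | add x x' hx hx' =>
      simp only [map_add, add_mul, mul_add, Finset.sum_add_distrib, hx, hx']
    | smul a x hx =>
      simp only [map_smul, smul_eq_mul, mul_assoc, hx, Finset.mul_sum, mul_left_comm a]
    | cls Y =>
      simp only [comp_cls, mark_cls]
      have := congrArg (Nat.cast (R := k)) (Biset.card_fixed_comp X Y α γ)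
      push_cast at this
      exact this

theorem mark_prod (α : Q →* H × H') (β : Q →* G × G') (x : Burnside k G H)
    (y : Burnside k G' H') :
    mark α β (prod x y) =
      mark ((MonoidHom.fst H H').comp α) ((MonoidHom.fst G G').comp β) x *
      mark ((MonoidHom.snd H H').comp α) ((MonoidHom.snd G G').comp β) y := by
  induction x using induction with
  | add x x' hx hx' => simp only [map_add, LinearMap.add_apply, add_mul, hx, hx']
  | smul a x hx => simp only [map_smul, LinearMap.smul_apply, smul_eq_mul, mul_assoc, hx]
  | cls X =>
    induction y using induction with
    | add x x' hx hx' => simp only [map_add, mul_add, hx, hx']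
    | smul a x hx => simp only [map_smul, smul_eq_mul, mul_left_comm a, hx]
    | cls Y =>
      simp only [prod_cls, mark_cls]
      have := congrArg (Nat.cast (R := k)) (Biset.card_fixed_prod X Y α β)
      push_cast at this
      exact this

theorem mark_comp_ofHom [Finite G] [Finite H] (α : Q →* K) (γ : Q →* G)
    (x : Burnside k H K) (φ : G →* H) :
    mark α γ (comp x (ofHom k φ)) = mark α (φ.comp γ) x := by
  induction x using induction with
  | add x x' hx hx' => simp only [map_add, LinearMap.add_apply, hx, hx']
  | smul a x hx => simp only [map_smul, LinearMap.smul_apply, hx]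
  | cls X =>
    simp only [ofHom, basic, comp_cls, mark_cls]
    exact congrArg (Nat.cast (R := k)) (Biset.card_fixed_comp_hom X φ α γ)

theorem mark_kappa [Finite G] (α : Q →* H × H) (β : Q →* G) (x y : Burnside k G H) :
    mark α β (kappa x y) =
      mark ((MonoidHom.fst H H).comp α) β x * mark ((MonoidHom.snd H H).comp α) β y := by
  rw [kappa, mark_comp_ofHom, mark_prod]
  rfl

theorem mark_comp_surjective (α : Q →* H) (β : Q →* G) (e : Q' →* Q)
    (he : Function.Surjective e) (z : Burnside k G H) :
    mark (α.comp e) (β.comp e) z = mark α β z := by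
  induction z using induction with
  | add x x' hx hx' => simp only [map_add, hx, hx']
  | smul a x hx => simp only [map_smul, hx]
  | cls X => rw [mark_cls, mark_cls, X.fixed_comp_of_surjective α β e he]

theorem mark_conj {α α' : Q →* H} {β β' : Q →* G} (h : H) (g : G)
    (hα : ∀ q, α' q = h * α q * h⁻¹) (hβ : ∀ q, β' q = g * β q * g⁻¹) (z : Burnside k G H) :
    mark α' β' z = mark α β z := by
  induction z using induction with
  | add x x' hx hx' => simp only [map_add, hx, hx']
  | smul a x hx => simp only [map_smul, hx]
  | cls X => rw [mark_cls, mark_cls, X.card_fixed_conj h g hα hβ]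

theorem mark_conj_left {α α' : Q →* H} {β : Q →* G} (h : H) (hα : ∀ q, α' q = h * α q * h⁻¹)
    (z : Burnside k G H) : mark α' β z = mark α β z :=
  mark_conj h 1 hα (by simp) z

theorem mark_conj_right {α : Q →* H} {β β' : Q →* G} (g : G) (hβ : ∀ q, β' q = g * β q * g⁻¹)
    (z : Burnside k G H) : mark α β' z = mark α β z :=
  mark_conj 1 g (by simp) hβ z

/-- At a fixed point `β(q) = 1` gives `α(q) x = x`, hence `α(q) = 1`. This is how injectivity is
recovered from nonvanishing marks. -/
theorem ker_le_of_mark_ne_zero {α : Q →* H} {β : Q →* G} {z : Burnside k G H}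
    (hz : mark α β z ≠ 0) : β.ker ≤ α.ker := by
  intro q hq
  by_contra hα
  refine hz ?_
  clear hz
  induction z using induction with
  | add x x' hx hx' => rw [map_add, hx, hx', add_zero]
  | smul a x hx => rw [map_smul, hx, smul_zero]
  | cls X =>
    have : X.fixed α β = ∅ := Set.eq_empty_of_forall_notMem fun x hx =>
      hα (Biset.eq_one_of_mem_fixed hx hq)
    rw [mark_cls, this]
    simp

theorem mark_range {β : Q →* G} (φ : β.range →* H) (z : Burnside k G H) :
    mark (φ.comp β.rangeRestrict) β z = mark φ β.range.subtype z :=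
  mark_comp_surjective φ β.range.subtype β.rangeRestrict β.rangeRestrict_surjective z

end Burnside

/-! ### Transitive bisets. -/

namespace Biset

section

variable {G H : Type u} [Group G] [Group H]

/-- The restriction of a biset to an invariant subset. -/
def restrict (X : Biset G H) (s : Set X.carrier)
    (hl : ∀ (h : H), ∀ x ∈ s, h • x ∈ s) (hr : ∀ (g : Gᵐᵒᵖ), ∀ x ∈ s, g • x ∈ s) :
    Biset G H where
  carrier := s
  leftAct :=
    { smul := fun h x => ⟨h • x.1, hl h x x.2⟩
      one_smul := fun x => Subtype.ext (one_smul H x.1)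
      mul_smul := fun a b x => Subtype.ext (mul_smul a b x.1) }
  rightAct :=
    { smul := fun g x => ⟨g • x.1, hr g x x.2⟩
      one_smul := fun x => Subtype.ext (one_smul Gᵐᵒᵖ x.1)
      mul_smul := fun a b x => Subtype.ext (mul_smul a b x.1) }
  commute := @SMulCommClass.mk _ _ _ (_) (_) fun h g x => Subtype.ext (smul_comm h g x.1)
  left_free := fun h x e => X.left_free h x (congrArg Subtype.val e)

theorem iso_restrict_sum (X : Biset G H) (s : Set X.carrier) (hl hr) (hl' hr') :
    ((X.restrict s hl hr).sum (X.restrict sᶜ hl' hr')).Iso X := by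
  classical
  refine ⟨Equiv.Set.sumCompl s, ?_, ?_⟩
  · rintro h (x | x) <;> rfl
  · rintro h (x | x) <;> rfl

variable [Finite G] [Finite H]

/-- A transitive biset is determined by the stabilizer of a point. -/
theorem basic_iso_of_transitive {X : Biset G H} (x : X.carrier) {Q : Subgroup G} {α : Q →* H}
    (hx : x ∈ X.fixed α Q.subtype) (hmax : ∀ (h : H) (g : G), h • x = op g • x → g ∈ Q)
    (htrans : ∀ y : X.carrier, ∃ (h : H) (g : G), h • op g • x = y) : (basic Q α).Iso X := by
  let f : (basic Q α).carrier → X.carrier := Quotient.lift (fun a => a.1 • op a.2 • x) (by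
    rintro ⟨a, b⟩ ⟨c, d⟩ ⟨l, h1, h2⟩
    dsimp only at h1 h2 ⊢
    rw [← h1, h2, MulOpposite.op_mul, mul_smul, mul_smul, smul_comm (α l), hx l]
    rfl)
  have hf : Function.Bijective f := by
    constructor
    · rintro ⟨a, b⟩ ⟨c, d⟩ e
      have e' : a • op b • x = c • op d • x := e
      have e2 : (c⁻¹ * a) • x = op (d * b⁻¹) • x := by
        have := congrArg (op b⁻¹ • ·) e'
        simp only [← smul_comm _ (op b⁻¹), ← mul_smul (op b⁻¹), ← MulOpposite.op_mul] at this
        rw [mul_smul, inv_smul_eq_iff, ← this]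
        simp
      have hQ := hmax _ _ e2
      have e3 : α ⟨d * b⁻¹, hQ⟩ = c⁻¹ * a :=
        X.smul_left_cancel_of_free ((hx ⟨_, hQ⟩).trans e2.symm)
      refine Quotient.sound ⟨⟨d * b⁻¹, hQ⟩, ?_, ?_⟩
      · rw [e3, mul_inv_cancel_left]
      · rw [inv_mul_cancel_right]
    · intro y
      obtain ⟨h, g, e⟩ := htrans y
      exact ⟨Quotient.mk _ (h, g), e⟩
  refine ⟨Equiv.ofBijective f hf, ?_, ?_⟩
  · rintro h ⟨a, b⟩
    exact mul_smul h a _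
  · rintro g ⟨a, b⟩
    change a • op (b * g) • x = op g • a • op b • x
    rw [MulOpposite.op_mul, mul_smul, smul_comm]

/-- The class of `(a, b)` in `[Q, α]`. -/
def basicMk (Q : Subgroup G) (α : Q →* H) (a : H) (b : G) : (basic Q α).carrier :=
  Quotient.mk (basicSetoid Q α) (a, b)

theorem exists_basicMk_eq {Q : Subgroup G} {α : Q →* H} (x : (basic Q α).carrier) :
    ∃ a b, basicMk Q α a b = x := by
  obtain ⟨⟨a, b⟩, h⟩ := Quotient.exists_rep x
  exact ⟨a, b, h⟩

theorem smul_basic_eq_iff {Q : Subgroup G} {α : Q →* H} {h : H} {g : G} {a : H} {b : G} :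
    h • basicMk Q α a b = op g • basicMk Q α a b ↔
      ∃ hg : b * g * b⁻¹ ∈ Q, α ⟨b * g * b⁻¹, hg⟩ = a⁻¹ * h * a := by
  constructor
  · intro e
    obtain ⟨l, h1, h2⟩ := Quotient.exact e
    have h1 : a * α l = h * a := h1
    have h2 : b * g = l * b := h2
    have hl : b * g * b⁻¹ = l := by rw [h2]; group
    refine ⟨hl ▸ l.2, ?_⟩
    have : (⟨b * g * b⁻¹, hl ▸ l.2⟩ : Q) = l := Subtype.ext hl
    rw [this, mul_assoc, ← h1]
    group
  · rintro ⟨hg, e⟩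
    refine Quotient.sound ⟨⟨b * g * b⁻¹, hg⟩, ?_, ?_⟩
    · change a * α _ = h * a
      rw [e]; group
    · change b * g = b * g * b⁻¹ * b
      group

/-- A fixed point represented by `(a, b)` conjugates `Q` into `Q'` by `b`. The orders force
equality, so the graph of `α` is the full stabilizer of that point. -/
theorem basic_iso_of_mem_fixed {Q Q' : Subgroup G} {α : Q →* H} {α' : Q' →* H}
    {x : (basic Q' α').carrier} (hx : x ∈ (basic Q' α').fixed α Q.subtype)
    (hQ : Nat.card Q' ≤ Nat.card Q) : (basic Q α).Iso (basic Q' α') := by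
  obtain ⟨a, b, rfl⟩ := exists_basicMk_eq x
  have hle : Q.map (MulAut.conj b).toMonoidHom ≤ Q' := by
    rintro _ ⟨q, hq, rfl⟩
    exact (smul_basic_eq_iff.1 (hx ⟨q, hq⟩)).1
  have heq : Q.map (MulAut.conj b).toMonoidHom = Q' := by
    refine Subgroup.eq_of_le_of_card_ge hle ?_
    rwa [Subgroup.card_map_of_injective (MulAut.conj b).injective]
  refine basic_iso_of_transitive _ hx ?_ ?_
  · intro h g e
    obtain ⟨hg, -⟩ := smul_basic_eq_iff.1 e
    rw [← heq] at hg
    obtain ⟨q, hq, e⟩ := hg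
    have : q = g := (MulAut.conj b).injective e
    rwa [← this]
  · intro y
    obtain ⟨c, d, rfl⟩ := exists_basicMk_eq y
    refine ⟨c * a⁻¹, b⁻¹ * d, congrArg (Quotient.mk _) (Prod.ext ?_ ?_)⟩
    · exact inv_mul_cancel_right c a
    · exact mul_inv_cancel_left b d

/-- Because the left action is free, the stabilizer of a point is the graph of a homomorphism. -/
theorem exists_basic_iso (X : Biset G H) (x : X.carrier)
    (htrans : ∀ y : X.carrier, ∃ (h : H) (g : G), h • op g • x = y) :
    ∃ (Q : Subgroup G) (α : Q →* H), (basic Q α).Iso X := by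
  let Q : Subgroup G :=
    { carrier := {g | ∃ h : H, h • x = op g • x}
      one_mem' := ⟨1, by simp⟩
      mul_mem' := by
        rintro a b ⟨h, e⟩ ⟨l, f⟩
        exact ⟨h * l, by rw [mul_smul, f, MulOpposite.op_mul, mul_smul, ← e, smul_comm]⟩
      inv_mem' := by
        rintro a ⟨h, e⟩
        exact ⟨h⁻¹, by rw [inv_smul_eq_iff, smul_comm, e, ← mul_smul, ← MulOpposite.op_mul]; simp⟩ }
  obtain ⟨α, hα⟩ := X.exists_mem_fixed Q.subtype x fun q => q.2
  exact ⟨Q, α, basic_iso_of_transitive x hα (fun h g e => ⟨h, e⟩) htrans⟩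

end

end Biset

/-! ### Triangularity of the marks and its consequences. -/

namespace Burnside

section

variable {k : Type} [CommRing k]
variable {G H : Type u} [Group G] [Group H] [Finite G] [Finite H]

theorem cls_mem_span_basic (n : ℕ) : ∀ X : Biset G H, Nat.card X.carrier = n →
    cls k X ∈ Submodule.span k
      (Set.range fun i : Σ Q : Subgroup G, Q →* H => basic k i.1 i.2) := by
  induction n using Nat.strong_induction_on with
  | _ n ih =>
    intro X hX
    by_cases hne : Nonempty X.carrier
    · obtain ⟨x⟩ := hne
      let s : Set X.carrier := {y | ∃ (h : H) (g : G), h • op g • x = y}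
      have hx : x ∈ s := ⟨1, 1, by simp⟩
      have hl : ∀ (h : H), ∀ x ∈ s, h • x ∈ s := by
        rintro h _ ⟨a, b, rfl⟩
        exact ⟨h * a, b, mul_smul _ _ _⟩
      have hr : ∀ (g : Gᵐᵒᵖ), ∀ x ∈ s, g • x ∈ s := by
        rintro g _ ⟨a, b, rfl⟩
        exact ⟨a, b * g.unop, by rw [MulOpposite.op_mul, mul_smul, smul_comm]; rfl⟩
      have hl' : ∀ (h : H), ∀ x ∈ sᶜ, h • x ∈ sᶜ := fun h x hx hx' =>
        hx (inv_smul_smul h x ▸ hl h⁻¹ _ hx')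
      have hr' : ∀ (g : Gᵐᵒᵖ), ∀ x ∈ sᶜ, g • x ∈ sᶜ := fun h x hx hx' =>
        hx (inv_smul_smul h x ▸ hr h⁻¹ _ hx')
      rw [← cls_eq_of_iso k (X.iso_restrict_sum s hl hr hl' hr'), cls_sum]
      refine add_mem ?_ (ih _ ?_ _ rfl)
      · obtain ⟨Q, α, e⟩ := (X.restrict s hl hr).exists_basic_iso ⟨x, hx⟩ (by
          rintro ⟨_, h, g, rfl⟩
          exact ⟨h, g, rfl⟩)
        rw [← cls_eq_of_iso k e]
        exact Submodule.subset_span ⟨⟨Q, α⟩, rfl⟩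
      · rw [← hX]
        exact Set.ncard_lt_card (fun h => (h ▸ Set.mem_univ x : x ∈ sᶜ) hx)
    -- The empty biset is isomorphic to its double, so its class is zero.
    · have e : X.Iso (X.sum X) := by
        have : IsEmpty X.carrier := not_nonempty_iff.1 hne
        have : IsEmpty (X.sum X).carrier := inferInstanceAs (IsEmpty (X.carrier ⊕ X.carrier))
        exact ⟨Equiv.equivOfIsEmpty _ _, fun _ x => isEmptyElim x, fun _ x => isEmptyElim x⟩
      have := cls_eq_of_iso k e
      rw [cls_sum, left_eq_add] at this
      rw [this]
      exact zero_mem _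

theorem span_basic : Submodule.span k
    (Set.range fun i : Σ Q : Subgroup G, Q →* H => basic k i.1 i.2) = ⊤ := by
  rw [eq_top_iff, ← span_cls, Submodule.span_le]
  rintro _ ⟨X, rfl⟩
  exact cls_mem_span_basic _ X rfl

theorem exists_of_mark_basic_ne_zero {Q : Type*} [Group Q] {α : Q →* H} {β : Q →* G}
    {L : Subgroup G} {φ : L →* H} (h : mark α β (basic k L φ) ≠ 0) :
    ∃ (a : H) (b : G), ∀ q, ∃ hq : b * β q * b⁻¹ ∈ L, φ ⟨b * β q * b⁻¹, hq⟩ = a⁻¹ * α q * a := by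
  have : Nonempty ((Biset.basic L φ).fixed α β) := by
    by_contra h'
    rw [not_nonempty_iff] at h'
    exact h (by rw [basic, mark_cls, Nat.card_of_isEmpty, Nat.cast_zero])
  obtain ⟨⟨x, hx⟩⟩ := this
  obtain ⟨a, b, rfl⟩ := Biset.exists_basicMk_eq x
  exact ⟨a, b, fun q => Biset.smul_basic_eq_iff.1 (hx q)⟩

theorem basic_eq_of_mark_ne_zero {Q Q' : Subgroup G} {α : Q →* H} {α' : Q' →* H}
    (h : mark α Q.subtype (basic k Q' α') ≠ 0) (hQ : Nat.card Q' ≤ Nat.card Q) :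
    basic k Q α = basic k Q' α' := by
  have : Nonempty ((Biset.basic Q' α').fixed α Q.subtype) := by
    by_contra h'
    rw [not_nonempty_iff] at h'
    exact h (by rw [basic, mark_cls, Nat.card_of_isEmpty, Nat.cast_zero])
  obtain ⟨⟨x, hx⟩⟩ := this
  exact cls_eq_of_iso k (Biset.basic_iso_of_mem_fixed hx hQ)

theorem mark_basic_self_ne_zero [CharZero k] (Q : Subgroup G) (α : Q →* H) :
    mark α Q.subtype (basic k Q α) ≠ 0 := by
  rw [basic, mark_cls, Nat.cast_ne_zero]
  have : Nonempty ((Biset.basic Q α).fixed α Q.subtype) :=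
    ⟨⟨Biset.basicMk Q α 1 1, fun q => Biset.smul_basic_eq_iff.2 (by simp)⟩⟩
  exact Nat.card_pos.ne'

variable [IsDomain k] [CharZero k]

/-- If the marks of `z` vanish at all `(Q, α)` with `[Q, α] ∉ N`, then `z ∈ N`. -/
theorem mem_of_mark_eq_zero {N : Submodule k (Burnside k G H)} {z : Burnside k G H}
    (hN : ∀ (Q : Subgroup G) (α : Q →* H), basic k Q α ∉ N → mark α Q.subtype z = 0)
    (htop : ∀ (Q Q' : Subgroup G) (α : Q →* H) (α' : Q' →* H), basic k Q α ∉ N →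
      basic k Q' α' ∈ N → mark α Q.subtype (basic k Q' α') = 0) : z ∈ N := by
  classical
  let ι := Σ Q : Subgroup G, Q →* H
  let b : ι → Burnside k G H := fun i => basic k i.1 i.2
  have : Fintype ι := @Fintype.ofFinite _ (inferInstanceAs (Finite (Σ Q : Subgroup G, Q →* H)))
  -- The combination runs over distinct classes rather than pairs `(Q, α)`, so that conjugate pairs
  -- are not listed twice.
  have hz : z ∈ Submodule.span k ((Finset.univ.image b : Finset _) : Set (Burnside k G H)) := by
    rw [Finset.coe_image, Finset.coe_univ, Set.image_univ, span_basic]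
    trivial
  obtain ⟨c, -, hc⟩ := Submodule.mem_span_finset.1 hz
  have hc0 : ∀ v ∈ Finset.univ.image b, v ∉ N → c v = 0 := by
    by_contra! hcon
    let J : Finset ι := Finset.univ.filter fun i => b i ∉ N ∧ c (b i) ≠ 0
    have hJ : J.Nonempty := by
      obtain ⟨v, hv, hvN, hcv⟩ := hcon
      obtain ⟨i, -, rfl⟩ := Finset.mem_image.1 hv
      exact ⟨i, by simp [J, hvN, hcv]⟩
    -- Triangularity: at a pair with `|Q|` maximal among the nonzero coefficients outside `N`, only
    -- its own class contributes to the mark.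
    obtain ⟨j, hj, hmax⟩ := J.exists_max_image (fun i => Nat.card i.1) hJ
    have hj' : b j ∉ N ∧ c (b j) ≠ 0 := by simpa [J] using hj
    have h0 := hN j.1 j.2 hj'.1
    rw [← hc, map_sum, Finset.sum_eq_single (b j)] at h0
    · rw [map_smul, smul_eq_mul] at h0
      exact (mul_ne_zero hj'.2 (mark_basic_self_ne_zero j.1 j.2)) h0
    · intro v hv hne
      obtain ⟨i, -, rfl⟩ := Finset.mem_image.1 hv
      rw [map_smul, smul_eq_mul]
      by_contra hmul
      have hci := left_ne_zero_of_mul hmul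
      have hm := right_ne_zero_of_mul hmul
      by_cases hi : b i ∈ N
      · exact hm (htop _ _ _ _ hj'.1 hi)
      · exact hne (basic_eq_of_mark_ne_zero hm (hmax i (by simp [J, hi, hci]))).symm
    · exact fun h => absurd (Finset.mem_image_of_mem b (Finset.mem_univ j)) h
  rw [← hc]
  refine Submodule.sum_mem _ fun v hv => ?_
  by_cases hvN : v ∈ N
  · exact Submodule.smul_mem _ _ hvN
  · rw [hc0 v hv hvN, zero_smul]
    exact zero_mem _

/-- The mark homomorphisms are jointly injective. -/
theorem eq_of_mark_eq {x y : Burnside k G H}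
    (h : ∀ (Q : Subgroup G) (α : Q →* H), mark α Q.subtype x = mark α Q.subtype y) : x = y := by
  rw [← sub_eq_zero, ← Submodule.mem_bot k]
  refine mem_of_mark_eq_zero (fun Q α _ => by rw [map_sub, h, sub_self]) fun Q Q' α α' _ h' => ?_
  rw [(Submodule.mem_bot k).1 h', map_zero]

/-- A subgroup of `G` that surjects onto `G` is `G` itself, so classes outside the ideal come from
automorphisms. A class in the ideal has zero mark there, since otherwise it would equal the class of
the automorphism. -/
theorem mem_nishida {x : Burnside k G G}
    (h : ∀ σ : G →* G, Function.Bijective σ → mark σ (MonoidHom.id G) x = 0) : x ∈ nishida k G := by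
  have hsurj : ∀ (Q : Subgroup G) (α : Q →* G), basic k Q α ∉ nishida k G →
      Q = ⊤ ∧ Function.Bijective α := by
    intro Q α hQ
    have hr : α.range = ⊤ := by
      by_contra hne
      exact hQ (Submodule.subset_span ⟨Q, α, lt_top_iff_ne_top.2 hne, rfl⟩)
    have hα := MonoidHom.range_eq_top.1 hr
    have hcard : Nat.card G ≤ Nat.card Q := Nat.card_le_card_of_surjective α hα
    have hQ' : Q = ⊤ := Subgroup.eq_top_of_le_card Q hcard
    refine ⟨hQ', ?_⟩
    rw [Nat.bijective_iff_surjective_and_card]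
    exact ⟨hα, le_antisymm (Subgroup.card_le_card_group Q) hcard⟩
  refine mem_of_mark_eq_zero ?_ ?_
  · intro Q α hQ
    obtain ⟨rfl, hα⟩ := hsurj Q α hQ
    let e : (⊤ : Subgroup G) ≃* G := Subgroup.topEquiv
    rw [← mark_comp_surjective α (⊤ : Subgroup G).subtype e.symm.toMonoidHom e.symm.surjective]
    exact h _ (hα.comp e.symm.bijective)
  · intro Q Q' α α' hQ hQ'
    obtain ⟨rfl, -⟩ := hsurj Q α hQ
    by_contra hm
    rw [basic_eq_of_mark_ne_zero hm
      (by rw [Subgroup.card_top]; exact Subgroup.card_le_card_group Q')] at hQ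
    exact hQ hQ'

/-- In marks, after cancelling `|H|` and `|K|`, associativity is the exchange of two finite sums. -/
theorem comp_assoc {K L : Type u} [Group K] [Group L] [Finite K] [Finite L]
    (x : Burnside k K L) (y : Burnside k H K) (z : Burnside k G H) :
    comp (comp x y) z = comp x (comp y z) := by
  refine eq_of_mark_eq fun Q α => ?_
  have hH : (Nat.card H : k) ≠ 0 := Nat.cast_ne_zero.2 Nat.card_pos.ne'
  have hK : (Nat.card K : k) ≠ 0 := Nat.cast_ne_zero.2 Nat.card_pos.ne'
  refine mul_right_cancel₀ hH (mul_right_cancel₀ hK ?_)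
  rw [mark_comp, mul_right_comm, mark_comp, Finset.sum_mul, Finset.sum_mul]
  simp_rw [mul_right_comm _ _ (Nat.card K : k), mark_comp, mul_assoc, mark_comp, Finset.sum_mul,
    Finset.mul_sum, mul_assoc]
  exact Finset.sum_comm

theorem comp_ofHom_id (x : Burnside k G H) : comp x (ofHom k (MonoidHom.id G)) = x :=
  eq_of_mark_eq fun Q α => by rw [mark_comp_ofHom, MonoidHom.id_comp]

end

end Burnside

/-! ### Congruences between marks. -/

theorem dvd_sum_of_dvd_orbits {Γ Y k : Type*} [Group Γ] [MulAction Γ Y] [Fintype Y]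
    [CommRing k] (F : Y → k) (hF : ∀ (γ : Γ) y, F (γ • y) = F y) (d : k)
    (h : ∀ y, d ∣ (Nat.card (MulAction.orbit Γ y) : k) * F y) : d ∣ ∑ y, F y := by
  classical
  rw [← Finset.sum_fiberwise (s := Finset.univ) (g := Quotient.mk (MulAction.orbitRel Γ Y))]
  refine Finset.dvd_sum fun ω _ => ?_
  obtain ⟨y, rfl⟩ := Quotient.exists_rep ω
  convert h y using 1
  rw [Finset.sum_congr rfl (g := fun _ => F y), Finset.sum_const, nsmul_eq_mul]
  · congr 2
    rw [← Fintype.card_coe, ← Nat.card_eq_fintype_card]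
    refine Nat.card_congr (Equiv.subtypeEquivRight fun x => ?_)
    rw [Finset.mem_filter, and_iff_right (Finset.mem_univ x)]
    exact Quotient.eq
  · intro x hx
    obtain ⟨γ, rfl⟩ := Quotient.exact (Finset.mem_filter.1 hx).2
    exact hF γ y

theorem dvd_card_of_dvd_orbits {Γ Y : Type*} [Group Γ] [MulAction Γ Y] [Finite Y] (d : ℕ)
    (h : ∀ y : Y, d ∣ Nat.card (MulAction.orbit Γ y)) : d ∣ Nat.card Y := by
  have := Fintype.ofFinite Y
  have := dvd_sum_of_dvd_orbits (Γ := Γ) (fun _ : Y => (1 : ℤ)) (fun _ _ => rfl) d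
    (fun y => by rw [mul_one]; exact_mod_cast h y)
  rw [Nat.card_eq_fintype_card]
  simpa [Int.natCast_dvd_natCast] using this

namespace Biset

section

variable {G H : Type u} [Group G] [Group H] [Finite H]
variable {Q N : Type*} [Group Q] [Group N] [Finite Q] [Finite N]

open scoped Classical in
theorem card_iUnion_fixed (X : Biset G H) (β : Q →* G) (C : Set (Q →* H)) :
    Nat.card {x // ∃ ξ ∈ C, x ∈ X.fixed ξ β} = ∑ ξ with ξ ∈ C, Nat.card (X.fixed ξ β) := by
  rw [← Finset.sum_coe_sort, ← Nat.card_sigma]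
  symm
  refine Nat.card_eq_of_bijective (fun a => ⟨a.2.1, a.1, (Finset.mem_filter.1 a.1.2).2, a.2.2⟩) ⟨?_, ?_⟩
  · rintro ⟨⟨ξ, h⟩, x, hx⟩ ⟨⟨ξ', h'⟩, x', hx'⟩ e
    obtain rfl := congrArg Subtype.val e
    obtain rfl := X.left_unique hx hx'
    rfl
  · rintro ⟨x, ξ, h, hx⟩
    exact ⟨⟨⟨ξ, by simpa using h⟩, x, hx⟩, rfl⟩

-- The group `H × N` acts on the points fixed along `ι` by some `ξ ∈ C`; this uses the invariance of
-- `C`. If such a point is not fixed by a homomorphism defined on all of `N`, its stabilizer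
-- projects injectively onto a proper subgroup of `N`, of index divisible by `p`, so its orbit has
-- length divisible by `p |H|`.
open scoped Classical in
theorem card_fixed_congruence {p : ℕ} [Fact p.Prime] (hN : IsPGroup p N) (X : Biset G H)
    (ι : Q →* N) (β : N →* G) (C : Set (Q →* H))
    (hH : ∀ (h : H), ∀ ξ ∈ C, ∀ ξ' : Q →* H, (∀ q, ξ' q = h * ξ q * h⁻¹) → ξ' ∈ C)
    (hn : ∀ n q, ∃ q', ι q' = n * ι q * n⁻¹)
    (hC : ∀ (n : N), ∀ ξ ∈ C, ∀ ξ' : Q →* H,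
      (∀ q q', ι q' = n * ι q * n⁻¹ → ξ' q' = ξ q) → ξ' ∈ C) :
    ∃ m, ∑ ξ with ξ ∈ C, Nat.card (X.fixed ξ (β.comp ι)) =
      ∑ χ : N →* H with χ.comp ι ∈ C, Nat.card (X.fixed χ β) + p * Nat.card H * m := by
  have e0 := X.card_iUnion_fixed β {χ : N →* H | χ.comp ι ∈ C}
  simp only [Set.mem_ofPred_eq] at e0
  rw [← e0, ← X.card_iUnion_fixed (β.comp ι) C]
  let Y := {x // ∃ ξ ∈ C, x ∈ X.fixed ξ (β.comp ι)}
  let Y₀ : Set Y := {x | ∃ χ : N →* H, χ.comp ι ∈ C ∧ x.1 ∈ X.fixed χ β}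
  let _ : MulAction (H × N) X.carrier :=
    { smul := fun a x => a.1 • op (β a.2)⁻¹ • x
      one_smul := fun x => by change (1 : H) • op (β 1)⁻¹ • x = x; simp
      mul_smul := fun a b x => by
        change (a.1 * b.1) • op (β (a.2 * b.2))⁻¹ • x = a.1 • op (β a.2)⁻¹ • b.1 • op (β b.2)⁻¹ • x
        rw [map_mul, mul_inv_rev, MulOpposite.op_mul, mul_smul, mul_smul, smul_comm b.1] }
  have hsmul : ∀ (a : H × N) (x : X.carrier), a • x = a.1 • op (β a.2)⁻¹ • x := fun _ _ => rfl
  have hY : ∀ (a : H × N) (x : X.carrier), (∃ ξ ∈ C, x ∈ X.fixed ξ (β.comp ι)) →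
      ∃ ξ ∈ C, a • x ∈ X.fixed ξ (β.comp ι) := by
    rintro ⟨h, n⟩ x ⟨ξ, hξ, hx⟩
    have star : ∀ q q', ι q' = n * ι q * n⁻¹ →
        (h * ξ q * h⁻¹) • (h, n) • x = op (β (ι q')) • (h, n) • x := by
      intro q q' e
      simp only [hsmul, ← smul_comm _ (op (β (ι q')))]
      rw [mul_smul, inv_smul_smul, mul_smul, smul_comm (ξ q), hx q, ← mul_smul (op _),
        ← mul_smul (op _), ← MulOpposite.op_mul, ← MulOpposite.op_mul, e]
      simp [mul_assoc]
    obtain ⟨ξ', hξ'⟩ := X.exists_mem_fixed (β.comp ι) ((h, n) • x) fun q => by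
      obtain ⟨q', e⟩ := hn n⁻¹ q
      exact ⟨_, star q' q (by rw [e]; group)⟩
    refine ⟨ξ', hH h ((MulAut.conj h⁻¹).toMonoidHom.comp ξ') (hC n ξ hξ _ fun q q' e => ?_) ξ'
      fun q => ?_, hξ'⟩
    · have := X.smul_left_cancel_of_free ((hξ' q').trans (star q q' e).symm)
      simp [this, mul_assoc]
    · simp [mul_assoc]
  have hY₀ : ∀ (a : H × N) (x : X.carrier), (∃ χ : N →* H, χ.comp ι ∈ C ∧ x ∈ X.fixed χ β) →
      ∃ χ : N →* H, χ.comp ι ∈ C ∧ a • x ∈ X.fixed χ β := by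
    rintro ⟨h, n⟩ x ⟨χ, hχ, hx⟩
    refine ⟨(MulAut.conj (h * χ n⁻¹)).toMonoidHom.comp χ, ?_, fun m => ?_⟩
    · exact hH (h * χ n⁻¹) _ hχ _ fun q => rfl
    · have : (h, n) • x = (h * χ n⁻¹) • x := by
        rw [hsmul, mul_smul, hx, map_inv]
      rw [this, ← smul_comm _ (op (β m)), ← hx m, ← mul_smul, ← mul_smul]
      simp [mul_assoc]
  let _ : MulAction (H × N) Y :=
    { smul := fun a x => ⟨a • x.1, hY a x.1 x.2⟩
      one_smul := fun x => Subtype.ext (one_smul _ x.1)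
      mul_smul := fun a b x => Subtype.ext (mul_smul a b x.1) }
  let _ : MulAction (H × N) (Y₀ᶜ : Set Y) :=
    { smul := fun a x => ⟨a • x.1, fun h => x.2 (by
        have := hY₀ a⁻¹ _ h
        rwa [show a⁻¹ • (a • x.1).1 = x.1.1 from inv_smul_smul a x.1.1] at this)⟩
      one_smul := fun x => Subtype.ext (one_smul _ x.1)
      mul_smul := fun a b x => Subtype.ext (mul_smul a b x.1) }
  have hdvd : p * Nat.card H ∣ Nat.card (Y₀ᶜ : Set Y) := by
    refine dvd_card_of_dvd_orbits (Γ := H × N) _ ?_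
    rintro ⟨⟨x, ξ, hξ, hx⟩, hx₀⟩
    let y : (Y₀ᶜ : Set Y) := ⟨⟨x, ξ, hξ, hx⟩, hx₀⟩
    change p * Nat.card H ∣ Nat.card (MulAction.orbit (H × N) y)
    have hstab : ∀ a : H × N, a ∈ MulAction.stabilizer (H × N) y ↔ a.1 • x = op (β a.2) • x := by
      intro a
      rw [MulAction.mem_stabilizer_iff, Subtype.ext_iff, Subtype.ext_iff]
      change a.1 • op (β a.2)⁻¹ • x = x ↔ _
      rw [smul_comm, MulOpposite.op_inv, inv_smul_eq_iff]
    let L := MulAction.stabilizer (H × N) y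
    let L' := L.map (MonoidHom.snd H N)
    have hcard : Nat.card L' = Nat.card L := by
      refine (Nat.card_congr (Equiv.ofBijective (fun a : L => (⟨a.1.2, a.1, a.2, rfl⟩ : L'))
        ⟨?_, ?_⟩)).symm
      · rintro ⟨⟨a, n⟩, ha⟩ ⟨⟨b, n'⟩, hb⟩ e
        obtain rfl : n = n' := congrArg Subtype.val e
        obtain rfl := X.smul_left_cancel_of_free
          (((hstab _).1 ha).trans ((hstab _).1 hb).symm)
        rfl
      · rintro ⟨_, a, ha, rfl⟩
        exact ⟨⟨a, ha⟩, rfl⟩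
    have htop : L' ≠ ⊤ := by
      intro htop
      obtain ⟨χ, hχ⟩ := X.exists_mem_fixed β x fun n => by
        obtain ⟨⟨a, n⟩, ha, rfl⟩ : n ∈ L' := htop ▸ Subgroup.mem_top n
        exact ⟨a, (hstab _).1 ha⟩
      have hχ' : x ∈ X.fixed (χ.comp ι) (β.comp ι) := fun q => hχ (ι q)
      refine hx₀ ⟨χ, ?_, hχ⟩
      rwa [X.left_unique hχ' hx]
    have hp : p ∣ L'.index := by
      obtain ⟨n, hn⟩ := hN.index L'
      rcases n with _ | n
      · exact absurd (Subgroup.index_eq_one.1 (by simpa using hn)) htop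
      · exact ⟨p ^ n, by rw [hn, pow_succ']⟩
    have hidx : Nat.card (MulAction.orbit (H × N) y) = Nat.card H * L'.index := by
      have h1 := L.card_mul_index
      have h2 := L'.card_mul_index
      rw [Nat.card_prod, ← h2, hcard, MulAction.index_stabilizer] at h1
      refine Nat.eq_of_mul_eq_mul_left (Nat.card_pos (α := L)) ?_
      rw [mul_left_comm, ← h1]
      rfl
    rw [hidx, mul_comm p]
    exact mul_dvd_mul_left _ hp
  obtain ⟨m, hm⟩ := hdvd
  refine ⟨m, ?_⟩
  rw [← hm, ← Nat.card_congr (Equiv.Set.sumCompl Y₀), Nat.card_sum]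
  congr 1
  refine Nat.card_congr (Equiv.subtypeSubtypeEquivSubtype (p := fun x => ∃ ξ ∈ C,
    x ∈ X.fixed ξ (β.comp ι)) (q := fun x => ∃ χ : N →* H, χ.comp ι ∈ C ∧ x ∈ X.fixed χ β) ?_)
  rintro x ⟨χ, hχ, hx⟩
  exact ⟨_, hχ, fun q => hx (ι q)⟩

end
end Biset
namespace Burnside

section

variable {k : Type} [CommRing k]
variable {G H : Type u} [Group G] [Group H] [Finite H]
variable {Q N : Type*} [Group Q] [Group N] [Finite Q] [Finite N]

omit [Finite H] in
theorem dvd_of_cls {d : k} (L : Burnside k G H →ₗ[k] k) (h : ∀ X, d ∣ L (cls k X))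
    (z : Burnside k G H) : d ∣ L z := by
  induction z using induction with
  | add x x' hx hx' => rw [map_add]; exact dvd_add hx hx'
  | smul a x hx => rw [map_smul]; exact hx.mul_left a
  | cls X => exact h X

open scoped Classical in
theorem mark_congruence {p : ℕ} [Fact p.Prime] (hN : IsPGroup p N) (z : Burnside k G H)
    (ι : Q →* N) (β : N →* G) (C : Set (Q →* H))
    (hH : ∀ (h : H), ∀ ξ ∈ C, ∀ ξ' : Q →* H, (∀ q, ξ' q = h * ξ q * h⁻¹) → ξ' ∈ C)
    (hn : ∀ n q, ∃ q', ι q' = n * ι q * n⁻¹)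
    (hC : ∀ (n : N), ∀ ξ ∈ C, ∀ ξ' : Q →* H,
      (∀ q q', ι q' = n * ι q * n⁻¹ → ξ' q' = ξ q) → ξ' ∈ C) :
    (p * Nat.card H : k) ∣ ∑ ξ with ξ ∈ C, mark ξ (β.comp ι) z -
      ∑ χ : N →* H with χ.comp ι ∈ C, mark χ β z := by
  have := dvd_of_cls (d := (p * Nat.card H : k)) (∑ ξ with ξ ∈ C, mark ξ (β.comp ι) -
      ∑ χ : N →* H with χ.comp ι ∈ C, mark χ β) (fun X => by
    obtain ⟨m, hm⟩ := X.card_fixed_congruence hN ι β C hH hn hC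
    have := congrArg (Nat.cast (R := k)) hm
    push_cast at this
    simp only [LinearMap.sub_apply, LinearMap.sum_apply, mark_cls, this]
    exact ⟨m, by ring⟩) z
  simpa only [LinearMap.sub_apply, LinearMap.sum_apply] using this

/-- Over the trivial group every point is fixed, so each column sum is congruent to the number of
points. -/
theorem sum_mark_congruence_trivial {p : ℕ} [Fact p.Prime] (hN : IsPGroup p N)
    (β : N →* G) (z : Burnside k G H) :
    (p * Nat.card H : k) ∣ mark (1 : Unit →* H) (1 : Unit →* G) z - ∑ χ : N →* H, mark χ β z := by
  have := mark_congruence hN z (1 : Unit →* N) β Set.univ (fun _ _ _ _ _ => trivial)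
    (fun n q => ⟨q, by simp⟩) (fun _ _ _ _ _ => trivial)
  simp only [Set.mem_univ, Finset.filter_true] at this
  rwa [Fintype.sum_eq_single 1 fun ξ h => absurd (Subsingleton.elim ξ 1) h,
    MonoidHom.comp_one] at this

/-- All sums `∑ α, mark α β z` agree modulo `p |H|`. -/
theorem sum_mark_congruence {p : ℕ} [Fact p.Prime] (hN : IsPGroup p N) (hQ : IsPGroup p Q)
    (β : N →* G) (γ : Q →* G) (z : Burnside k G H) :
    (p * Nat.card H : k) ∣ ∑ χ : N →* H, mark χ β z - ∑ χ : Q →* H, mark χ γ z := by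
  have := dvd_sub (sum_mark_congruence_trivial hQ γ z) (sum_mark_congruence_trivial hN β z)
  rwa [sub_sub_sub_cancel_left] at this

omit [Finite H] [Finite N] in
/-- The marks at the subgroups `⟨Δ, w⟩`, for a normal subgroup `Δ`, satisfy the Cauchy–Frobenius
congruence. -/
theorem card_dvd_sum_mark [Fintype N] (a : N →* H) (b : N →* G) (Δ : Subgroup N) [Δ.Normal]
    (z : Burnside k G H) :
    (Nat.card N : k) ∣ ∑ w : N, mark (a.comp (Δ ⊔ Subgroup.zpowers w).subtype)
      (b.comp (Δ ⊔ Subgroup.zpowers w).subtype) z := by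
  classical
  have := dvd_of_cls (d := (Nat.card N : k)) (∑ w : N,
      mark (a.comp (Δ ⊔ Subgroup.zpowers w).subtype)
        (b.comp (Δ ⊔ Subgroup.zpowers w).subtype)) (fun X => ?_) z
  · simpa only [LinearMap.sum_apply] using this
  let _ : MulAction N X.carrier :=
    { smul := fun w x => a w • op (b w)⁻¹ • x
      one_smul := fun x => by change a 1 • op (b 1)⁻¹ • x = x; simp
      mul_smul := fun v w x => by
        change a (v * w) • op (b (v * w))⁻¹ • x = a v • op (b v)⁻¹ • a w • op (b w)⁻¹ • x
        rw [map_mul, map_mul, mul_inv_rev, MulOpposite.op_mul, mul_smul, mul_smul,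
          smul_comm (a w)] }
  have hsmul : ∀ (w : N) (x : X.carrier), w • x = x ↔ a w • x = op (b w) • x := by
    intro w x
    change a w • op (b w)⁻¹ • x = x ↔ _
    rw [smul_comm, MulOpposite.op_inv, inv_smul_eq_iff]
  -- Since `Δ` is normal, `N` acts on its fixed points, and the points fixed by `⟨Δ, w⟩` are those
  -- of `Y` fixed by `w`. The orbit-counting lemma then gives the divisibility.
  let Y : Set X.carrier := {x | ∀ w ∈ Δ, w • x = x}
  let _ : MulAction N Y :=
    { smul := fun v x => ⟨v • x.1, fun w hw => by
        have := x.2 _ (Subgroup.Normal.conj_mem' ‹Δ.Normal› w hw v)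
        rwa [mul_smul, mul_smul, inv_smul_eq_iff] at this⟩
      one_smul := fun x => Subtype.ext (one_smul _ x.1)
      mul_smul := fun v w x => Subtype.ext (mul_smul v w x.1) }
  have hfix : ∀ w : N, Nat.card (MulAction.fixedBy Y w) =
      Nat.card (X.fixed (a.comp (Δ ⊔ Subgroup.zpowers w).subtype)
        (b.comp (Δ ⊔ Subgroup.zpowers w).subtype)) := by
    intro w
    have h1 : ∀ x : X.carrier, x ∈ X.fixed (a.comp (Δ ⊔ Subgroup.zpowers w).subtype)
        (b.comp (Δ ⊔ Subgroup.zpowers w).subtype) ↔ x ∈ Y ∧ w • x = x := by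
      intro x
      have h2 : x ∈ X.fixed (a.comp (Δ ⊔ Subgroup.zpowers w).subtype)
        (b.comp (Δ ⊔ Subgroup.zpowers w).subtype) ↔
          Δ ⊔ Subgroup.zpowers w ≤ MulAction.stabilizer N x := by
        simp only [Biset.mem_fixed, Subtype.forall, SetLike.le_def, MulAction.mem_stabilizer_iff,
          hsmul]
        rfl
      rw [h2, sup_le_iff, Subgroup.zpowers_le]
      rfl
    refine Nat.card_congr
      { toFun := fun x => ⟨x.1.1, (h1 _).2 ⟨x.1.2, congrArg Subtype.val x.2⟩⟩
        invFun := fun x => ⟨⟨x.1, ((h1 _).1 x.2).1⟩, Subtype.ext ((h1 _).1 x.2).2⟩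
        left_inv := fun x => rfl
        right_inv := fun x => rfl }
  have _ : Fintype Y := Fintype.ofFinite _
  have burnside := MulAction.sum_card_fixedBy_eq_card_orbits_mul_card_group N Y
  simp only [← Nat.card_eq_fintype_card, hfix] at burnside
  simp only [LinearMap.sum_apply, mark_cls]
  rw [← Nat.cast_sum, burnside, Nat.cast_mul]
  exact Dvd.intro_left _ rfl

end
end Burnside

/-! ### Homomorphisms related by a fusion system, and a saturation criterion. -/

namespace FusionSystem

variable {S : Type u} [Group S] (F : FusionSystem S)

/-- A homomorphism `φ : P → S` is a morphism of `F`. -/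
def Mem {P : Subgroup S} (φ : P →* S) : Prop :=
  (Subgroup.topEquiv.symm.toMonoidHom.comp φ : P →* (⊤ : Subgroup S)) ∈ F.Hom P ⊤

variable {F}

theorem Mem.injective {P : Subgroup S} {φ : P →* S} (h : F.Mem φ) : Function.Injective φ :=
  (Function.Injective.of_comp_iff Subgroup.topEquiv.symm.injective _).1 (F.injective _ h)

theorem mem_of_conj {P : Subgroup S} (g : S) {φ : P →* S} (h : ∀ u, φ u = g * u * g⁻¹) :
    F.Mem φ := by
  have h' := F.conj_mem (P := P) (Q := ⊤) g fun _ _ => trivial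
  refine Set.mem_of_eq_of_mem (MonoidHom.ext fun u => Subtype.ext ?_) h'
  exact h u

theorem mem_subtype_comp {P Q : Subgroup S} {φ : P →* Q} (h : φ ∈ F.Hom P Q) :
    F.Mem (Q.subtype.comp φ) := by
  have h' := F.comp_mem _ h _ (F.conj_mem (P := Q) (Q := ⊤) 1 fun _ _ => trivial)
  refine Set.mem_of_eq_of_mem (MonoidHom.ext fun u => Subtype.ext ?_) h'
  change (φ u : S) = 1 * φ u * 1⁻¹
  simp

theorem mem_comp {P Q : Subgroup S} {φ : P →* Q} (h : φ ∈ F.Hom P Q) {ψ : Q →* S}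
    (h' : F.Mem ψ) : F.Mem (ψ.comp φ) := F.comp_mem _ h _ h'

/-- A morphism `P → S` of `F` induces morphisms `P → Q` and `Q → P` if its image is `Q`. -/
theorem Mem.equiv_mem {P Q : Subgroup S} (e : P ≃* Q) (h : F.Mem (Q.subtype.comp e.toMonoidHom)) :
    e.toMonoidHom ∈ F.Hom P Q ∧ e.symm.toMonoidHom ∈ F.Hom Q P := by
  have him : image (Subgroup.topEquiv.symm.toMonoidHom.comp (Q.subtype.comp e.toMonoidHom) :
      P →* (⊤ : Subgroup S)) = Q := by
    ext x
    simp only [image, Subgroup.mem_map, MonoidHom.mem_range]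
    constructor
    · rintro ⟨_, ⟨u, rfl⟩, rfl⟩
      exact (e u).2
    · intro hx
      exact ⟨⟨x, trivial⟩, ⟨e.symm ⟨x, hx⟩, Subtype.ext (congrArg Q.subtype
        (e.apply_symm_apply ⟨x, hx⟩))⟩, rfl⟩
  have h1 := F.iso_mem _ h (e.trans (MulEquiv.subgroupCongr him.symm)) fun _ => rfl
  -- The axiom speaks of `image φ`, which is equal to `Q` but not definitionally; conjugation by `1`
  -- passes between the two.
  have h2 := F.comp_mem _ h1.1 _ (F.conj_mem (Q := Q) 1 (by rw [him]; simp))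
  have h3 := F.comp_mem _ (F.conj_mem (P := Q) 1 (by rw [him]; simp)) _ h1.2
  constructor
  · refine Set.mem_of_eq_of_mem (MonoidHom.ext fun u => Subtype.ext ?_) h2
    change (e u : S) = 1 * e u * 1⁻¹
    simp
  · refine Set.mem_of_eq_of_mem (MonoidHom.ext fun u => ?_) h3
    change e.symm u = e.symm _
    exact congrArg e.symm (Subtype.ext (show (u : S) = 1 * u * 1⁻¹ by simp))

theorem inclusion_mem {P Q : Subgroup S} (h : P ≤ Q) : Subgroup.inclusion h ∈ F.Hom P Q := by
  have h' := F.conj_mem (P := P) (Q := Q) 1 fun x hx => by simpa using h hx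
  refine Set.mem_of_eq_of_mem (MonoidHom.ext fun u => Subtype.ext ?_) h'
  change (u : S) = 1 * u * 1⁻¹
  simp

theorem hom_mem_iff {P Q : Subgroup S} {φ : P →* Q} : φ ∈ F.Hom P Q ↔ F.Mem (Q.subtype.comp φ) := by
  refine ⟨mem_subtype_comp, fun h => ?_⟩
  have hinj : Function.Injective φ := Function.Injective.of_comp (f := Q.subtype) h.injective
  let Q' := φ.range.map Q.subtype
  let e : P ≃* Q' := (MonoidHom.ofInjective hinj).trans
    (φ.range.equivMapOfInjective Q.subtype Q.subtype_injective)
  have hle : Q' ≤ Q := Subgroup.map_subtype_le _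
  have he : F.Mem (Q'.subtype.comp e.toMonoidHom) := h
  exact F.comp_mem _ (Mem.equiv_mem e he).1 _ (inclusion_mem hle)

variable (F)

/-- `α` and `β` have the same kernel and `α = φ ∘ β` for a morphism `φ` of `F` defined on the
image of `β`. -/
def Rel {Q : Type*} [Group Q] (α β : Q →* S) : Prop :=
  ∃ φ : β.range →* S, F.Mem φ ∧ ∀ q, φ (β.rangeRestrict q) = α q

variable {F}

section Rel

variable {Q Q' : Type*} [Group Q] [Group Q'] {α β γ : Q →* S}

theorem Rel.refl (α : Q →* S) : F.Rel α α :=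
  ⟨α.range.subtype, mem_of_conj 1 (by simp), fun _ => rfl⟩

theorem Rel.exists_equiv (h : F.Rel α β) : ∃ e : β.range ≃* α.range,
    (∀ q, e (β.rangeRestrict q) = α.rangeRestrict q) ∧ F.Mem (α.range.subtype.comp e.toMonoidHom) := by
  obtain ⟨φ, hφ, h⟩ := h
  have hr : φ.range = α.range := by
    ext x
    constructor
    · rintro ⟨⟨_, q, rfl⟩, rfl⟩
      exact ⟨q, (h q).symm⟩
    · rintro ⟨q, rfl⟩
      exact ⟨_, h q⟩
  exact ⟨(MonoidHom.ofInjective hφ.injective).trans (MulEquiv.subgroupCongr hr),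
    fun q => Subtype.ext (h q), hφ⟩

theorem Rel.symm (h : F.Rel α β) : F.Rel β α := by
  obtain ⟨e, he, hm⟩ := h.exists_equiv
  refine ⟨β.range.subtype.comp e.symm.toMonoidHom, mem_subtype_comp (Mem.equiv_mem e hm).2,
    fun q => ?_⟩
  rw [← he q]
  exact congrArg Subtype.val (e.symm_apply_apply _)

theorem Rel.trans (h : F.Rel α β) (h' : F.Rel β γ) : F.Rel α γ := by
  obtain ⟨φ, hφ, h⟩ := h
  obtain ⟨e, he, hm⟩ := h'.exists_equiv
  exact ⟨φ.comp e.toMonoidHom, mem_comp (Mem.equiv_mem e hm).1 hφ,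
    fun q => (congrArg φ (he q)).trans (h q)⟩

/-- With morphisms viewed as a relation between homomorphisms from a common source, restriction is
precomposition. -/
theorem Rel.comp (h : F.Rel α β) (ι : Q' →* Q) : F.Rel (α.comp ι) (β.comp ι) := by
  obtain ⟨φ, hφ, h⟩ := h
  have hle : (β.comp ι).range ≤ β.range := by
    rintro _ ⟨q, rfl⟩
    exact ⟨ι q, rfl⟩
  exact ⟨φ.comp (Subgroup.inclusion hle), mem_comp (inclusion_mem hle) hφ, fun q => h (ι q)⟩

theorem Rel.ker_eq (h : F.Rel α β) : α.ker = β.ker := by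
  obtain ⟨φ, hφ, h⟩ := h
  ext q
  rw [MonoidHom.mem_ker, MonoidHom.mem_ker, ← h, map_eq_one_iff φ hφ.injective, Subtype.ext_iff]
  rfl

theorem Rel.injective (h : F.Rel α β) (hβ : Function.Injective β) : Function.Injective α := by
  rwa [← MonoidHom.ker_eq_bot_iff, h.ker_eq, MonoidHom.ker_eq_bot_iff]

theorem rel_of_conj (g : S) (h : ∀ q, α q = g * β q * g⁻¹) : F.Rel α β :=
  ⟨(MulAut.conj g).toMonoidHom.comp β.range.subtype, mem_of_conj g fun _ => rfl,
    fun q => (h q).symm⟩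

theorem mem_iff_rel {P : Subgroup S} {φ : P →* S} : F.Mem φ ↔ F.Rel φ P.subtype := by
  have hle : P ≤ P.subtype.range := P.range_subtype.ge
  have hle' : P.subtype.range ≤ P := P.range_subtype.le
  constructor
  · exact fun h => ⟨φ.comp (Subgroup.inclusion hle'), mem_comp (inclusion_mem hle') h, fun q => rfl⟩
  · rintro ⟨ψ, hψ, h⟩
    have : φ = ψ.comp (Subgroup.inclusion hle) := MonoidHom.ext fun q => (h q).symm
    rw [this]
    exact mem_comp (inclusion_mem hle) hψ

theorem hom_mem_iff_rel {P Q : Subgroup S} {φ : P →* Q} :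
    φ ∈ F.Hom P Q ↔ F.Rel (Q.subtype.comp φ) P.subtype := by
  rw [hom_mem_iff, mem_iff_rel]

end Rel

variable (F)

/-- An isomorphism between subgroups of `S` that belongs to `F`. -/
def IsoMem {P Q : Subgroup S} (e : P ≃* Q) : Prop :=
  F.Rel (Q.subtype.comp e.toMonoidHom) P.subtype

variable {F}

theorem IsoMem.symm {P Q : Subgroup S} {e : P ≃* Q} (h : F.IsoMem e) : F.IsoMem e.symm := by
  have := (Rel.comp h e.symm.toMonoidHom).symm
  have h2 : (Q.subtype.comp e.toMonoidHom).comp e.symm.toMonoidHom = Q.subtype :=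
    MonoidHom.ext fun q => congrArg Subtype.val (e.apply_symm_apply q)
  rwa [h2] at this

theorem IsoMem.trans {P Q R : Subgroup S} {e : P ≃* Q} {f : Q ≃* R} (h : F.IsoMem e)
    (h' : F.IsoMem f) : F.IsoMem (e.trans f) :=
  Rel.trans (Rel.comp h' e.toMonoidHom) h

theorem conj_iff {P Q : Subgroup S} : F.Conj P Q ↔ ∃ e : P ≃* Q, F.IsoMem e := by
  constructor
  · rintro ⟨φ, h, hb⟩
    exact ⟨MulEquiv.ofBijective φ hb, hom_mem_iff_rel.1 h⟩
  · rintro ⟨e, h⟩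
    exact ⟨e.toMonoidHom, hom_mem_iff_rel.2 h, e.bijective⟩

theorem mem_aut_iff {P : Subgroup S} {e : MulAut P} : e ∈ F.aut P ↔ F.IsoMem (P := P) (Q := P) e :=
  hom_mem_iff_rel

theorem autS_le_aut (P : Subgroup S) : autS P ≤ F.aut P := by
  rintro _ ⟨n, rfl⟩
  exact mem_aut_iff.2 (rel_of_conj n fun q => rfl)

theorem map_congr_aut {P Q : Subgroup S} {e : P ≃* Q} (h : F.IsoMem e) :
    (F.aut P).map (MulAut.congr e).toMonoidHom = F.aut Q := by
  have key : ∀ {P Q : Subgroup S} {e : P ≃* Q}, F.IsoMem e → ∀ a ∈ F.aut P,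
      MulAut.congr e a ∈ F.aut Q := fun h a ha =>
    mem_aut_iff.2 ((h.symm.trans (mem_aut_iff.1 ha)).trans h)
  refine le_antisymm ?_ fun b hb => ⟨MulAut.congr e.symm b, key h.symm b hb, ?_⟩
  · rintro _ ⟨a, ha, rfl⟩
    exact key h a ha
  · ext u
    simp [MulAut.congr]

theorem IsoMem.card_aut {P Q : Subgroup S} {e : P ≃* Q} (h : F.IsoMem e) :
    Nat.card (F.aut P) = Nat.card (F.aut Q) := by
  rw [← map_congr_aut h]
  exact (Subgroup.card_map_of_injective (MulAut.congr e).injective).symm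

theorem card_autS_mul (P : Subgroup S) :
    Nat.card (autS P) * Nat.card (Subgroup.centralizer (P : Set S)) =
      Nat.card (Subgroup.normalizer (P : Set S)) := by
  have h := P.normalizerMonoidHom.ker.card_mul_index
  rw [Subgroup.index_ker, Subgroup.normalizerMonoidHom_ker, mul_comm] at h
  rw [← h]
  congr 1
  exact (Nat.card_congr
    (Subgroup.subgroupOfEquivOfLe (Subgroup.centralizer_le_normalizer _)).toEquiv).symm

/-- `n` normalizes `Q` and its conjugation action corresponds under `e : Q ≃ P` to conjugation by
an element of `S`. -/
def Compatible {Q P : Subgroup S} (e : Q ≃* P) (n : S) : Prop :=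
  n ∈ Subgroup.normalizer (Q : Set S) ∧
    ∃ y : S, ∀ u v : Q, (v : S) = n * u * n⁻¹ → (e v : S) = y * e u * y⁻¹

theorem mem_normalizer_of_compatible {Q P : Subgroup S} {e : Q ≃* P} {n y : S}
    (hn : n ∈ Subgroup.normalizer (Q : Set S))
    (h : ∀ u v : Q, (v : S) = n * u * n⁻¹ → (e v : S) = y * e u * y⁻¹) :
    y ∈ Subgroup.normalizer (P : Set S) := by
  rw [Subgroup.mem_normalizer_iff]
  intro x
  constructor
  · intro hx
    have := h (e.symm ⟨x, hx⟩) ⟨_, (Subgroup.mem_normalizer_iff.1 hn _).1 (e.symm ⟨x, hx⟩).2⟩ rfl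
    rw [e.apply_symm_apply] at this
    rw [← this]
    exact (e _).2
  · intro hx
    let v := e.symm ⟨_, hx⟩
    have hv : n⁻¹ * v * n ∈ Q := by
      rw [Subgroup.mem_normalizer_iff.1 hn]
      convert v.2 using 1
      group
    have := h ⟨_, hv⟩ v (by simp [mul_assoc])
    rw [e.apply_symm_apply] at this
    have h2 : x = e ⟨_, hv⟩ := by simpa using this
    rw [h2]
    exact (e _).2

theorem mem_extender_iff {P Q : Subgroup S} {φ : P →* Q} {n : S} :
    n ∈ extender φ ↔ n ∈ Subgroup.normalizer (P : Set S) ∧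
      ∃ y ∈ Subgroup.normalizer (image φ : Set S),
        ∀ u v : P, (v : S) = n * u * n⁻¹ → (φ v : S) = y * φ u * y⁻¹ := by
  constructor
  · rintro ⟨hn, y, hy, h⟩
    refine ⟨hn, y, hy, fun u v e => ?_⟩
    rw [← h u]
    exact congrArg (fun w => (φ w : S)) (Subtype.ext e)
  · rintro ⟨hn, y, hy, h⟩
    exact ⟨hn, y, hy, fun u => h u _ rfl⟩

variable (F)

/-- Every `F`-isomorphism onto `P` extends to each group of compatible elements. -/
def Receptive (P : Subgroup S) : Prop :=
  ∀ (Q : Subgroup S) (e : Q ≃* P), F.IsoMem e → ∀ (N : Subgroup S) (hN : Q ≤ N),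
    (∀ n ∈ N, Compatible e n) →
      ∃ χ : N →* S, F.Rel χ N.subtype ∧ ∀ u : Q, χ (Subgroup.inclusion hN u) = e u

/-- `Aut_S(P)` has index prime to `p` in `Aut_F(P)`. -/
def Automized (p : ℕ) (P : Subgroup S) : Prop := ¬ p ∣ (autS P).relIndex (F.aut P)

variable {F}

theorem isPGroup_autS {p : ℕ} (hS : IsPGroup p S) (P : Subgroup S) : IsPGroup p (autS P) := by
  have := ((hS.to_subgroup (Subgroup.normalizer (P : Set S))).to_subgroup ⊤).map
    P.normalizerMonoidHom
  rwa [← MonoidHom.range_eq_map] at this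

/-- Transported by `e`, the group `Aut_S(P)` is a `p`-subgroup of `Aut_F(P₀)`, so some `g` in
`Aut_F(P₀)` conjugates it into the Sylow subgroup `Aut_S(P₀)`. After replacing `e` by `g ∘ e`, every
element of `N_S(P)` is compatible, and receptivity extends the isomorphism. -/
theorem exists_extension_normalizer [Finite S] {p : ℕ} [Fact p.Prime] (hS : IsPGroup p S)
    {P P₀ : Subgroup S} {e : P ≃* P₀} (he : F.IsoMem e) (hr : F.Receptive P₀)
    (ha : F.Automized p P₀) :
    ∃ (e' : P ≃* P₀) (α : Subgroup.normalizer (P : Set S) →* S), F.IsoMem e' ∧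
      F.Rel α (Subgroup.normalizer (P : Set S)).subtype ∧
      ∀ u : P, α (Subgroup.inclusion Subgroup.le_normalizer u) = e' u := by
  have : Finite (MulAut P₀) := DFunLike.finite _
  let K := F.aut P₀
  let T : Sylow p K := IsPGroup.toSylow (P := (autS P₀).subgroupOf K)
    ((isPGroup_autS hS P₀).comap_of_injective K.subtype K.subtype_injective) ha
  let A : Subgroup K := ((autS P).map (MulAut.congr e).toMonoidHom).subgroupOf K
  have hA : IsPGroup p A := ((isPGroup_autS hS P).map _).comap_of_injective K.subtype
    K.subtype_injective
  obtain ⟨T', hT'⟩ := hA.exists_le_sylow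
  obtain ⟨g, hg⟩ := MulAction.exists_smul_eq K T' T
  have hgA : ∀ a ∈ A, g * a * g⁻¹ ∈ (autS P₀).subgroupOf K := by
    intro a ha
    have h1 : g * a * g⁻¹ ∈ g • T' := Subgroup.smul_mem_pointwise_smul a (MulAut.conj g) T'.1 (hT' ha)
    rw [hg] at h1
    exact h1
  let e' : P ≃* P₀ := e.trans (g : MulAut P₀)
  have he' : F.IsoMem e' := he.trans (mem_aut_iff.1 g.2)
  obtain ⟨α, hα, h⟩ := hr P e' he' _ Subgroup.le_normalizer fun n hn => by
    refine ⟨hn, ?_⟩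
    have h1 : MulAut.congr e (P.normalizerMonoidHom ⟨n, hn⟩) ∈ K := by
      rw [← show _ = K from map_congr_aut he]
      exact ⟨_, autS_le_aut P ⟨_, rfl⟩, rfl⟩
    obtain ⟨y, hy⟩ := hgA ⟨_, h1⟩ ⟨_, ⟨_, rfl⟩, rfl⟩
    refine ⟨y, fun u v huv => ?_⟩
    have h2 := congrArg (fun a : MulAut P₀ => (a (e' u) : S)) hy
    have h3 : (y : S) * e' u * (y : S)⁻¹ = _ := h2
    rw [h3]
    have h4 : v = P.normalizerMonoidHom ⟨n, hn⟩ u := Subtype.ext huv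
    rw [h4]
    simp [e', MulAut.congr]
  exact ⟨e', α, he', hα, h⟩

theorem map_mem_normalizer {P P₀ : Subgroup S} {e : P ≃* P₀}
    {α : Subgroup.normalizer (P : Set S) →* S}
    (h : ∀ u : P, α (Subgroup.inclusion Subgroup.le_normalizer u) = e u)
    (n : Subgroup.normalizer (P : Set S)) : α n ∈ Subgroup.normalizer (P₀ : Set S) :=
  mem_normalizer_of_compatible (e := e) n.2 fun u v huv => by
    rw [← h, ← h, ← map_mul, ← map_inv, ← map_mul]
    exact congrArg α (Subtype.ext huv)

theorem map_mem_centralizer_iff {P P₀ : Subgroup S} {e : P ≃* P₀}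
    {α : Subgroup.normalizer (P : Set S) →* S} (hα : Function.Injective α)
    (h : ∀ u : P, α (Subgroup.inclusion Subgroup.le_normalizer u) = e u)
    (n : Subgroup.normalizer (P : Set S)) :
    α n ∈ Subgroup.centralizer (P₀ : Set S) ↔ (n : S) ∈ Subgroup.centralizer (P : Set S) := by
  rw [Subgroup.mem_centralizer_iff, Subgroup.mem_centralizer_iff]
  have key : ∀ u : P, (e u : S) * α n = α n * e u ↔ (u : S) * n = n * u := by
    intro u
    rw [← h, ← map_mul, ← map_mul, hα.eq_iff, Subtype.ext_iff]
    rfl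
  constructor
  · exact fun H u hu => (key ⟨u, hu⟩).1 (H _ (e _).2)
  · intro H u hu
    have := (key (e.symm ⟨u, hu⟩)).2 (H _ (e.symm _).2)
    rwa [e.apply_symm_apply] at this

theorem card_centralizer_le [Finite S] {P P₀ : Subgroup S} {e : P ≃* P₀}
    {α : Subgroup.normalizer (P : Set S) →* S} (hα : Function.Injective α)
    (h : ∀ u : P, α (Subgroup.inclusion Subgroup.le_normalizer u) = e u) :
    Nat.card (Subgroup.centralizer (P : Set S)) ≤ Nat.card (Subgroup.centralizer (P₀ : Set S)) := by
  refine Nat.card_le_card_of_injective (fun c => ⟨α ⟨c, Subgroup.centralizer_le_normalizer _ c.2⟩,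
    (map_mem_centralizer_iff hα h _).2 c.2⟩) fun c d hcd => ?_
  have := hα (congrArg Subtype.val hcd)
  exact Subtype.ext (congrArg (fun n : Subgroup.normalizer (P : Set S) => (n : S)) this)

/-- The elements of `C_S(P₀)` lie in the image of a morphism `N_S(P) → S` that maps `P` to `P₀`, if
the centralizers have the same order. -/
theorem exists_eq_of_mem_centralizer [Finite S] {P P₀ : Subgroup S} {e : P ≃* P₀}
    {α : Subgroup.normalizer (P : Set S) →* S} (hα : Function.Injective α)
    (h : ∀ u : P, α (Subgroup.inclusion Subgroup.le_normalizer u) = e u)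
    (hcard : Nat.card (Subgroup.centralizer (P₀ : Set S)) ≤
      Nat.card (Subgroup.centralizer (P : Set S))) {x : S}
    (hx : x ∈ Subgroup.centralizer (P₀ : Set S)) : ∃ n, α n = x := by
  let f : Subgroup.centralizer (P : Set S) → Subgroup.centralizer (P₀ : Set S) := fun c =>
    ⟨α ⟨c, Subgroup.centralizer_le_normalizer _ c.2⟩, (map_mem_centralizer_iff hα h _).2 c.2⟩
  have hf : Function.Injective f := fun c d hcd =>
    Subtype.ext (congrArg (fun n : Subgroup.normalizer (P : Set S) => (n : S))
      (hα (congrArg Subtype.val hcd)))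
  have hb := (Nat.bijective_iff_injective_and_card f).2
    ⟨hf, le_antisymm (card_centralizer_le hα h) hcard⟩
  obtain ⟨c, hc⟩ := hb.2 ⟨x, hx⟩
  exact ⟨_, congrArg Subtype.val hc⟩

theorem card_mul_relIndex {G : Type*} [Group G] {H K : Subgroup G} (h : H ≤ K) :
    Nat.card H * H.relIndex K = Nat.card K := by
  rw [← (H.subgroupOf K).card_mul_index, Subgroup.relIndex,
    Nat.card_congr (Subgroup.subgroupOfEquivOfLe h).toEquiv]

/-- A fusion system on a finite `p`-group is saturated if each subgroup is conjugate to one that is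
receptive and automized. -/
theorem isSaturated_of_exists [Finite S] {p : ℕ} [Fact p.Prime] (hS : IsPGroup p S)
    (h : ∀ P : Subgroup S, ∃ (P₀ : Subgroup S) (e : P ≃* P₀),
      F.IsoMem e ∧ F.Receptive P₀ ∧ F.Automized p P₀) : F.IsSaturated p := by
  constructor
  · intro P hP
    obtain ⟨P₀, e₁, he₁, hr, ha⟩ := h P
    obtain ⟨e, α, he, hα, hαe⟩ := exists_extension_normalizer hS he₁ hr ha
    have hinj : Function.Injective α := hα.injective (Subgroup.subtype_injective _)
    -- As `P` is fully normalized, the embedding of `N_S(P)` into `N_S(P₀)` is bijective;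
    -- consequently `C_S(P)` and `C_S(P₀)` have the same order.
    have hN : Nat.card (Subgroup.normalizer (P₀ : Set S)) =
        Nat.card (Subgroup.normalizer (P : Set S)) :=
      le_antisymm (hP P₀ (conj_iff.2 ⟨e, he⟩)) (Nat.card_le_card_of_injective
        (fun n => ⟨α n, map_mem_normalizer hαe n⟩) fun n m hnm => hinj (congrArg Subtype.val hnm))
    have hC₀ : Nat.card (Subgroup.centralizer (P₀ : Set S)) ≤
        Nat.card (Subgroup.centralizer (P : Set S)) := by
      let f : Subgroup.normalizer (P : Set S) → Subgroup.normalizer (P₀ : Set S) := fun n =>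
        ⟨α n, map_mem_normalizer hαe n⟩
      have hf : Function.Bijective f := (Nat.bijective_iff_injective_and_card f).2
        ⟨fun n m hnm => hinj (congrArg Subtype.val hnm), hN.symm⟩
      have hg : ∀ c : Subgroup.centralizer (P₀ : Set S), ∃ n, α n = c := fun c => by
        obtain ⟨n, hn⟩ := hf.2 ⟨c, Subgroup.centralizer_le_normalizer _ c.2⟩
        exact ⟨n, congrArg Subtype.val hn⟩
      choose g hg using hg
      refine Nat.card_le_card_of_injective (fun c => ⟨g c,
        (map_mem_centralizer_iff hinj hαe _).1 (by rw [hg]; exact c.2)⟩) fun c d hcd => ?_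
      have : g c = g d := Subtype.ext (congrArg
        (fun c : Subgroup.centralizer (P : Set S) => (c : S)) hcd)
      exact Subtype.ext (by rw [← hg c, this, hg d])
    refine ⟨fun Q hQ => ?_, ?_⟩
    · obtain ⟨f, hf⟩ := conj_iff.1 hQ
      -- Every conjugate `Q` has its centralizer embedded in `C_S(P₀)`, which is no larger than
      -- `C_S(P)`.
      obtain ⟨e', α', -, hα', hαe'⟩ := exists_extension_normalizer hS (hf.symm.trans he) hr ha
      exact (card_centralizer_le (hα'.injective (Subgroup.subtype_injective _)) hαe').trans hC₀
    -- Equal orders of normalizers and centralizers give `Aut_S(P)` and `Aut_S(P₀)` the same order,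
    -- so the index prime to `p` passes from `P₀` to `P`.
    · have hC : Nat.card (Subgroup.centralizer (P₀ : Set S)) =
          Nat.card (Subgroup.centralizer (P : Set S)) :=
        le_antisymm hC₀ (card_centralizer_le hinj hαe)
      have hS₀ : Nat.card (autS P₀) = Nat.card (autS P) := by
        refine Nat.eq_of_mul_eq_mul_right
          (Nat.card_pos (α := Subgroup.centralizer (P₀ : Set S))) ?_
        rw [card_autS_mul, hC, card_autS_mul, hN]
      have hfin : Finite (MulAut P) := DFunLike.finite _
      have hidx : (autS P).relIndex (F.aut P) = (autS P₀).relIndex (F.aut P₀) := by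
        refine Nat.eq_of_mul_eq_mul_left (Nat.card_pos (α := autS P)) ?_
        rw [card_mul_relIndex (autS_le_aut P), ← hS₀,
          card_mul_relIndex (autS_le_aut P₀), he.card_aut]
      refine ⟨IsPGroup.toSylow (P := (autS P).subgroupOf (F.aut P))
        ((isPGroup_autS hS P).comap_of_injective _ (Subgroup.subtype_injective _))
        (by rw [Automized, ← hidx] at ha; exact ha), ?_⟩
      exact Subgroup.map_subgroupOf_eq_of_le (autS_le_aut P)
  · intro P φ hφ hc
    have hφ' := hom_mem_iff_rel.1 hφ
    let Q := image φ
    let f : P ≃* Q := (MonoidHom.ofInjective (F.injective φ hφ)).trans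
      (φ.range.equivMapOfInjective _ (Subgroup.subtype_injective _))
    have hf : F.IsoMem f := hφ'
    obtain ⟨Q₀, e₁, he₁, hr, ha⟩ := h Q
    obtain ⟨e, β, he, hβ, hβe⟩ := exists_extension_normalizer hS he₁ hr ha
    have hinj : Function.Injective β := hβ.injective (Subgroup.subtype_injective _)
    -- If `y` realizes `n ∈ N_φ` on `Q`, then `β(y)` realizes it on `Q₀`; hence `e ∘ φ` extends to
    -- `N_φ`.
    obtain ⟨χ, hχ, hχe⟩ := hr P (f.trans e) (hf.trans he) (extender φ) (le_extender φ)
      fun n hn => by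
        obtain ⟨hn, y, hy, hny⟩ := mem_extender_iff.1 hn
        refine ⟨hn, β ⟨y, hy⟩, fun u v huv => ?_⟩
        change (e (f v) : S) = β ⟨y, hy⟩ * e (f u) * (β ⟨y, hy⟩)⁻¹
        rw [← hβe, ← hβe, ← map_mul, ← map_inv, ← map_mul]
        exact congrArg β (Subtype.ext (hny u v huv))
    -- Both `χ(n)` and `β(y)` act on `Q₀` in the same way, so they differ by an element of
    -- `C_S(Q₀)`. This lies in the image of `β` because `Q` is fully centralized, and `β⁻¹ ∘ χ` is
    -- then the extension sought.
    have hrange : ∀ n, ∃ m, β m = χ n := by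
      intro n
      obtain ⟨hn, y, hy, hny⟩ := mem_extender_iff.1 n.2
      obtain ⟨c, hc⟩ := exists_eq_of_mem_centralizer hinj hβe
        (hc Q₀ (conj_iff.2 ⟨e, he⟩)) (x := (β ⟨y, hy⟩)⁻¹ * χ n) (by
          rw [Subgroup.mem_centralizer_iff]
          intro x hx
          obtain ⟨u, hu⟩ := (f.trans e).surjective ⟨x, hx⟩
          have hv : (n : S) * u * (n : S)⁻¹ ∈ P := (Subgroup.mem_normalizer_iff.1 hn _).1 u.2
          have hx' : x = (f.trans e) u := (congrArg Subtype.val hu).symm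
          have h1 : ((f.trans e) ⟨_, hv⟩ : S) = χ n * x * (χ n)⁻¹ := by
            rw [hx', ← hχe, ← hχe, ← map_mul, ← map_inv, ← map_mul]
            exact congrArg χ (Subtype.ext rfl)
          have h2 : ((f.trans e) ⟨_, hv⟩ : S) = β ⟨y, hy⟩ * x * (β ⟨y, hy⟩)⁻¹ := by
            rw [hx']
            change (e (f _) : S) = β ⟨y, hy⟩ * e (f u) * (β ⟨y, hy⟩)⁻¹
            rw [← hβe, ← hβe, ← map_mul, ← map_inv, ← map_mul]
            exact congrArg β (Subtype.ext (hny u _ rfl))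
          have h3 := h1.symm.trans h2
          rw [mul_inv_eq_iff_eq_mul] at h3
          have h4 : χ n * x = β ⟨y, hy⟩ * (x * ((β ⟨y, hy⟩)⁻¹ * χ n)) := by
            rw [h3]; group
          rw [mul_assoc, h4, inv_mul_cancel_left])
      exact ⟨⟨y, hy⟩ * c, by rw [map_mul, hc, mul_inv_cancel_left]⟩
    choose m hm using hrange
    let ψ₀ : extender φ →* Subgroup.normalizer (Q : Set S) := MonoidHom.mk' m fun a b => hinj (by
      rw [map_mul, hm, hm, hm, map_mul])
    let ψ : extender φ →* S := (Subgroup.subtype _).comp ψ₀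
    have hψ : F.Rel ψ (extender φ).subtype := by
      have h1 := (hβ.comp ψ₀).symm
      have h2 : β.comp ψ₀ = χ := MonoidHom.ext hm
      rw [h2] at h1
      exact h1.trans hχ
    refine ⟨(Subgroup.topEquiv (G := S)).symm.toMonoidHom.comp ψ, mem_iff_rel.2 hψ, ?_⟩
    refine MonoidHom.ext fun u => Subtype.ext ?_
    have h1 : β (m (Subgroup.inclusion (le_extender φ) u)) =
        β (Subgroup.inclusion Subgroup.le_normalizer (f u)) := by
      rw [hm, hχe, hβe]
      rfl
    exact congrArg (fun n : Subgroup.normalizer (Q : Set S) => (n : S)) (hinj h1)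

theorem exists_fullyNormalized [Finite S] (F : FusionSystem S) (P : Subgroup S) :
    ∃ (P₀ : Subgroup S) (e : P ≃* P₀), F.IsoMem e ∧ F.FullyNormalized P₀ := by
  have hne : {Q : Subgroup S | F.Conj P Q}.Nonempty :=
    ⟨P, conj_iff.2 ⟨MulEquiv.refl P, Rel.refl _⟩⟩
  obtain ⟨P₀, hP₀, hmax⟩ := Set.exists_max_image _
    (fun Q : Subgroup S => Nat.card (Subgroup.normalizer (Q : Set S))) (Set.toFinite _) hne
  obtain ⟨e, he⟩ := conj_iff.1 hP₀
  refine ⟨P₀, e, he, fun Q hQ => ?_⟩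
  obtain ⟨f, hf⟩ := conj_iff.1 hQ
  have hQ' : F.Conj P Q := conj_iff.2 ⟨e.trans f, he.trans hf⟩
  exact hmax Q hQ'

/-- A group of elements compatible with `e` lies in the extender of `e`, and `P` is fully
centralized, so the extension axiom applies. -/
theorem IsSaturated.receptive {p : ℕ} (h : F.IsSaturated p) {P : Subgroup S}
    (hP : F.FullyNormalized P) : F.Receptive P := by
  intro Q e he N hN hc
  let φ : Q →* (⊤ : Subgroup S) := Subgroup.topEquiv.symm.toMonoidHom.comp
    (P.subtype.comp e.toMonoidHom)
  have hφ : φ ∈ F.Hom Q ⊤ := mem_iff_rel.2 he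
  have him : image φ = P := by
    ext x
    simp only [image, Subgroup.mem_map, MonoidHom.mem_range]
    constructor
    · rintro ⟨_, ⟨u, rfl⟩, rfl⟩
      exact (e u).2
    · intro hx
      exact ⟨φ (e.symm ⟨x, hx⟩), ⟨_, rfl⟩, congrArg P.subtype (e.apply_symm_apply ⟨x, hx⟩)⟩
  obtain ⟨ψ, hψ, hψφ⟩ := h.extension Q φ hφ (by rw [him]; exact (h.sylow P hP).1)
  have hle : N ≤ extender φ := by
    intro n hn
    obtain ⟨hn, y, hy⟩ := hc n hn
    exact mem_extender_iff.2 ⟨hn, y, by rw [him]; exact mem_normalizer_of_compatible hn hy, hy⟩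
  refine ⟨((⊤ : Subgroup S).subtype.comp ψ).comp (Subgroup.inclusion hle),
    Rel.comp (hom_mem_iff_rel.1 hψ) (Subgroup.inclusion hle), fun u => ?_⟩
  exact congrArg Subtype.val (DFunLike.congr_fun hψφ u)

theorem IsSaturated.automized [Finite S] {p : ℕ} [Fact p.Prime] (h : F.IsSaturated p)
    {P : Subgroup S} (hP : F.FullyNormalized P) : F.Automized p P := by
  obtain ⟨-, T, hT⟩ := h.sylow P hP
  have hfin : Finite (MulAut P) := DFunLike.finite _
  have : (autS P).subgroupOf (F.aut P) = T := by
    rw [← hT]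
    exact Subgroup.comap_map_eq_self_of_injective (Subgroup.subtype_injective _) _
  rw [Automized, Subgroup.relIndex, this]
  exact T.not_dvd_index

end FusionSystem

open Burnside

/-! ### Conjugacy classes of homomorphisms and orders of centralizers. -/

section ConjAction

variable {S : Type u} [Group S] {Q : Type*} [Group Q]

/-- The action of `S` on the homomorphisms to `S` by conjugation. -/
@[reducible]
def conjHomAction : MulAction S (Q →* S) where
  smul s ξ := (MulAut.conj s).toMonoidHom.comp ξ
  one_smul ξ := MonoidHom.ext fun q => by
    change 1 * ξ q * 1⁻¹ = ξ q
    simp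
  mul_smul s t ξ := MonoidHom.ext fun q => by
    change s * t * ξ q * (s * t)⁻¹ = s * (t * ξ q * t⁻¹) * s⁻¹
    group

attribute [local instance] conjHomAction

theorem conj_smul_apply (s : S) (ξ : Q →* S) (q : Q) : (s • ξ) q = s * ξ q * s⁻¹ := rfl

theorem stabilizer_conj (ξ : Q →* S) :
    MulAction.stabilizer S ξ = Subgroup.centralizer (ξ.range : Set S) := by
  ext s
  rw [MulAction.mem_stabilizer_iff, Subgroup.mem_centralizer_iff]
  constructor
  · rintro h _ ⟨q, rfl⟩
    have := DFunLike.congr_fun h q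
    rw [conj_smul_apply, mul_inv_eq_iff_eq_mul] at this
    exact this.symm
  · intro h
    refine MonoidHom.ext fun q => ?_
    rw [conj_smul_apply, mul_inv_eq_iff_eq_mul]
    exact (h _ ⟨q, rfl⟩).symm

variable [Finite S]

omit [Finite S] in
theorem card_orbit_conj (ξ : Q →* S) : Nat.card (MulAction.orbit S ξ) *
    Nat.card (Subgroup.centralizer (ξ.range : Set S)) = Nat.card S := by
  rw [← stabilizer_conj, mul_comm, ← (MulAction.stabilizer S ξ).card_mul_index,
    MulAction.index_stabilizer]
  rfl

theorem card_centralizer_conj (ξ : Q →* S) (s : S) :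
    Nat.card (Subgroup.centralizer ((s • ξ).range : Set S)) =
      Nat.card (Subgroup.centralizer (ξ.range : Set S)) := by
  have h1 := card_orbit_conj ξ
  have h2 := card_orbit_conj (s • ξ)
  rw [MulAction.orbit_smul, ← h1] at h2
  have : Nat.card (MulAction.orbit S ξ) ≠ 0 := left_ne_zero_of_mul (h1.trans_ne Nat.card_pos.ne')
  exact Nat.eq_of_mul_eq_mul_left (Nat.pos_of_ne_zero this) h2

variable {k : Type} [CommRing k] [Finite Q]

/-- A conjugation invariant sum is divisible by `d |S|` if its terms are divisible by the order of
the centralizer times `d`. -/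
theorem dvd_sum_of_conj_invariant (F : (Q →* S) → k) (hF : ∀ (s : S) ξ, F (s • ξ) = F ξ) (d : k)
    (h : ∀ ξ, d * Nat.card (Subgroup.centralizer (ξ.range : Set S)) ∣ F ξ) :
    d * Nat.card S ∣ ∑ ξ, F ξ := by
  refine dvd_sum_of_dvd_orbits (Γ := S) F hF _ fun ξ => ?_
  obtain ⟨c, hc⟩ := h ξ
  rw [hc, ← card_orbit_conj ξ]
  exact ⟨c, by push_cast; ring⟩

open scoped Classical in
theorem sum_orbit_conj (F : (Q →* S) → k) (hF : ∀ (s : S) ξ, F (s • ξ) = F ξ) (ξ : Q →* S) :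
    ∑ ξ' with ξ' ∈ MulAction.orbit S ξ, F ξ' = Nat.card (MulAction.orbit S ξ) * F ξ := by
  rw [Finset.sum_congr rfl (g := fun _ => F ξ), Finset.sum_const, nsmul_eq_mul]
  · congr 2
    rw [← Fintype.card_coe, ← Nat.card_eq_fintype_card]
    exact Nat.card_congr (Equiv.subtypeEquivRight fun x => by simp)
  · intro x hx
    obtain ⟨s, rfl⟩ := (Finset.mem_filter.1 hx).2
    exact hF s ξ

-- The orbit length times the centralizer order is `|S|`, so divisibility of a whole orbit sum
-- reduces to divisibility of one term.
omit [Finite Q] in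
theorem dvd_card_orbit_mul_iff [IsDomain k] [CharZero k] (d : k) (ξ : Q →* S) (x : k) :
    d * Nat.card S ∣ Nat.card (MulAction.orbit S ξ) * x ↔
      d * Nat.card (Subgroup.centralizer (ξ.range : Set S)) ∣ x := by
  have h := card_orbit_conj ξ
  have h0 : (Nat.card (MulAction.orbit S ξ) : k) ≠ 0 :=
    Nat.cast_ne_zero.2 (left_ne_zero_of_mul (h.trans_ne Nat.card_pos.ne'))
  rw [← mul_dvd_mul_iff_left (a := (Nat.card (MulAction.orbit S ξ) : k)) h0
    (b := d * Nat.card (Subgroup.centralizer (ξ.range : Set S))), ← h]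
  push_cast
  rw [mul_left_comm]

omit [Finite S] [Finite Q] in
theorem mark_smul_left {G : Type u} [Group G] (s : S) (ξ : Q →* S) (β : Q →* G)
    (z : Burnside k G S) : mark (s • ξ) β z = mark ξ β z :=
  mark_conj_left s (fun _ => rfl) z

omit [Finite S] [Finite Q] in
theorem mark_smul_right {H : Type u} [Group H] (s : S) (ξ : Q →* H) (β : Q →* S)
    (z : Burnside k S H) : mark ξ (s • β) z = mark ξ β z :=
  mark_conj_right s (fun _ => rfl) z

omit [Finite S] [Finite Q] in
/-- The marks at `(α, β)` are divisible by the order of the centralizer of the image of `α`. -/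
theorem card_centralizer_dvd_mark {G : Type u} [Group G] (α : Q →* S) (β : Q →* G)
    (z : Burnside k G S) :
    (Nat.card (Subgroup.centralizer (α.range : Set S)) : k) ∣ mark α β z := by
  refine dvd_of_cls (mark α β) (fun X => ?_) z
  rw [mark_cls]
  refine Nat.cast_dvd_cast ?_
  let C := Subgroup.centralizer (α.range : Set S)
  -- The centralizer preserves the fixed points and acts freely on them, so its order divides their
  -- number.
  have hC : ∀ (c : C) (x : X.fixed α β), (c : S) • x.1 ∈ X.fixed α β := by
    intro c x q
    rw [← mul_smul, Subgroup.mem_centralizer_iff.1 c.2 _ ⟨q, rfl⟩, mul_smul, x.2 q, smul_comm]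
  let _ : MulAction C (X.fixed α β) :=
    { smul := fun c x => ⟨(c : S) • x.1, hC c x⟩
      one_smul := fun x => Subtype.ext (one_smul S x.1)
      mul_smul := fun a b x => Subtype.ext (mul_smul (a : S) (b : S) x.1) }
  refine dvd_card_of_dvd_orbits (Γ := C) _ fun x => ?_
  have hs : MulAction.stabilizer C x = ⊥ := by
    rw [eq_bot_iff]
    intro c hc
    exact Subtype.ext (X.left_free c x.1 (congrArg Subtype.val hc))
  have := MulAction.index_stabilizer (G := C) (x := x)
  rw [hs, Subgroup.index_bot] at this
  rw [this]
  rfl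

end ConjAction

/-! ### Idempotents with Frobenius reciprocity and their fusion systems. -/

section FrobeniusIdempotent

attribute [local instance] conjHomAction

variable {k : Type} [CommRing k] {S : Type u} [Group S] [Finite S]

/-- An idempotent `ω` of `A(S, S)` that satisfies Frobenius reciprocity, in terms of marks, and is
not in the Nishida ideal. -/
structure IsFrobeniusIdempotent (ω : Burnside k S S) : Prop where
  idem : comp ω ω = ω
  frobenius : ∀ {Q : Type u} [Group Q] [Finite Q] (α β γ : Q →* S), mark β γ ω ≠ 0 →
    mark α β ω = mark α γ ω
  exists_top : ∃ σ : S →* S, Function.Bijective σ ∧ mark σ (MonoidHom.id S) ω ≠ 0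

/-- `α` and `β` become equal after composition with `ω`. -/
def Sim (ω : Burnside k S S) {Q : Type u} [Group Q] (α β : Q →* S) : Prop :=
  ∀ η : Q →* S, mark η α ω = mark η β ω

variable {ω : Burnside k S S}

omit [Finite S] in
theorem Sim.comp_equiv {Q Q' : Type u} [Group Q] [Group Q'] {α β : Q →* S} (h : Sim ω α β)
    (e : Q' ≃* Q) : Sim ω (α.comp e.toMonoidHom) (β.comp e.toMonoidHom) := by
  intro η
  have hη : η = (η.comp e.symm.toMonoidHom).comp e.toMonoidHom :=
    MonoidHom.ext fun q => congrArg η (e.symm_apply_apply q).symm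
  rw [hη, mark_comp_surjective _ _ _ e.surjective, mark_comp_surjective _ _ _ e.surjective]
  exact h _

omit [Finite S] in
theorem Sim.trans {Q : Type u} [Group Q] {α β γ : Q →* S} (h : Sim ω α β) (h' : Sim ω β γ) :
    Sim ω α γ := fun η => (h η).trans (h' η)

omit [Finite S] in
theorem Sim.symm {Q : Type u} [Group Q] {α β : Q →* S} (h : Sim ω α β) : Sim ω β α :=
  fun η => (h η).symm

variable [IsDomain k] [CharZero k] {p : ℕ} [Fact p.Prime]

omit [Fact (Nat.Prime p)] in
theorem not_mul_card_dvd_card (S : Type u) [Group S] [Finite S] (hp : ¬ (p : k) ∣ 1) :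
    ¬ (p * Nat.card S : k) ∣ Nat.card S := by
  have h0 : (Nat.card S : k) ≠ 0 := Nat.cast_ne_zero.2 Nat.card_pos.ne'
  intro h
  refine hp ((mul_dvd_mul_iff_right h0).1 ?_)
  rwa [one_mul]

namespace IsFrobeniusIdempotent

-- Each `γ` with nonzero mark at `(γ, β)` satisfies `mark α γ ω = mark α β ω`. Hence `ω ∘ ω = ω`
-- reads `mark α β ω` times the column sum equals `mark α β ω` times `|S|`.
omit [CharZero k] in
theorem sum_mark_of_ne_zero (hω : IsFrobeniusIdempotent ω) {Q : Type u} [Group Q] [Finite Q]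
    {α β : Q →* S} (h : mark α β ω ≠ 0) : ∑ γ : Q →* S, mark γ β ω = Nat.card S := by
  have h1 := mark_comp α β ω ω
  rw [hω.idem, Finset.sum_congr rfl (g := fun γ => mark α β ω * mark γ β ω), ← Finset.mul_sum] at h1
  · exact (mul_left_cancel₀ h h1).symm
  · intro γ _
    by_cases h0 : mark γ β ω = 0
    · rw [h0, mul_zero, mul_zero]
    · rw [hω.frobenius α γ β h0]

variable (hω : IsFrobeniusIdempotent ω) (hS : IsPGroup p S) (hp : ¬ (p : k) ∣ 1)

include hω hS hp

/-- The column at the identity of `S` sums to `|S|`, which `p |S|` does not divide. By the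
congruence no column sum vanishes, so each column has a nonzero entry. -/
theorem sum_mark {Q : Type u} [Group Q] [Finite Q] (hQ : IsPGroup p Q) (β : Q →* S) :
    ∑ γ : Q →* S, mark γ β ω = Nat.card S := by
  obtain ⟨σ, -, hσ⟩ := hω.exists_top
  have h1 := hω.sum_mark_of_ne_zero hσ
  have h2 := sum_mark_congruence hS hQ (MonoidHom.id S) β ω
  rw [h1] at h2
  have h3 : ∑ γ : Q →* S, mark γ β ω ≠ 0 := by
    intro h3
    rw [h3, sub_zero] at h2
    exact not_mul_card_dvd_card S hp h2
  obtain ⟨α, -, hα⟩ := Finset.exists_ne_zero_of_sum_ne_zero h3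
  exact hω.sum_mark_of_ne_zero hα

/-- Let `C` be the set of `ξ` whose mark is not divisible by `p` times the centralizer order. If no
`χ` existed, the congruence would make the sum over `C` divisible by `p |S|`; the remaining terms
always sum to a multiple of `p |S|`, contradicting the column sum `|S|`. -/
theorem exists_mark_not_dvd {Q N : Type u} [Group Q] [Group N] [Finite Q] [Finite N]
    (hN : IsPGroup p N) (ι : Q →* N) (hι : Function.Injective ι)
    (hn : ∀ n q, ∃ q', ι q' = n * ι q * n⁻¹) (β : N →* S) :
    ∃ χ : N →* S, mark χ β ω ≠ 0 ∧
      ¬ (p * Nat.card (Subgroup.centralizer ((χ.comp ι).range : Set S)) : k) ∣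
        mark (χ.comp ι) (β.comp ι) ω := by
  classical
  by_contra! hcon
  obtain ⟨C, hC⟩ : ∃ C : Set (Q →* S), ∀ ξ, ξ ∈ C ↔
      ¬ (p * Nat.card (Subgroup.centralizer (ξ.range : Set S)) : k) ∣ mark ξ (β.comp ι) ω :=
    ⟨{ξ | _}, fun _ => Iff.rfl⟩
  have h1 := mark_congruence hN ω ι β C ?_ hn ?_
  · rw [Finset.sum_eq_zero (s := Finset.univ.filter fun χ : N →* S => χ.comp ι ∈ C), sub_zero] at h1
    · have h2 := dvd_sum_of_conj_invariant
        (fun ξ : Q →* S => if ξ ∈ C then 0 else mark ξ (β.comp ι) ω) ?_ (p : k) ?_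
      · rw [Finset.sum_ite, Finset.sum_const_zero, zero_add] at h2
        have h3 := dvd_add h1 h2
        rw [Finset.sum_filter_add_sum_filter_not,
          hω.sum_mark hS hp (hN.of_injective ι hι) (β.comp ι)] at h3
        exact not_mul_card_dvd_card S hp h3
      · intro s ξ
        have : s • ξ ∈ C ↔ ξ ∈ C := by
          rw [hC, hC, card_centralizer_conj, mark_smul_left]
        simp only [this, mark_smul_left]
      · intro ξ
        by_cases h : ξ ∈ C
        · simp [h]
        · simp only [h, if_false]
          exact not_not.1 fun h' => h ((hC ξ).2 h')
    · intro χ hχ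
      by_contra h0
      exact (hC _).1 (Finset.mem_filter.1 hχ).2 (hcon χ h0)
  · intro s ξ hξ ξ' h
    have : ξ' = s • ξ := MonoidHom.ext h
    rwa [hC, this, card_centralizer_conj, mark_smul_left, ← hC]
  -- Conjugation by `n` induces a bijection of `Q` under which `β ∘ ι` changes only by conjugation
  -- in `S`, so the marks are unchanged.
  · intro n ξ hξ ξ' h
    choose f hf using fun q => hn n q
    let f' : Q →* Q := MonoidHom.mk' f fun a b => hι (by rw [hf, map_mul, map_mul, hf, hf]; group)
    have hf' : Function.Surjective f' := by
      intro q
      obtain ⟨q', hq'⟩ := hn n⁻¹ q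
      refine ⟨q', hι ?_⟩
      change ι (f q') = _
      rw [hf, hq']
      group
    have h1 : ξ'.comp f' = ξ := MonoidHom.ext fun q => h q _ (hf q)
    have h2 : ((β.comp ι).comp f') = β n • (β.comp ι) := MonoidHom.ext fun q => by
      change β (ι (f q)) = β n * β (ι q) * (β n)⁻¹
      rw [hf, map_mul, map_mul, map_inv]
    have h3 : mark ξ' (β.comp ι) ω = mark ξ (β.comp ι) ω := by
      rw [← mark_comp_surjective _ _ f' hf', h1, h2, mark_smul_right]
    have h4 : ξ'.range = ξ.range := by
      rw [← h1, MonoidHom.range_comp, MonoidHom.range_eq_top.2 hf', ← MonoidHom.range_eq_map]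
    rwa [hC, h3, h4, ← hC]

/-- The congruences for `α` and `β`, with `C` the conjugacy class of `χ ∘ ι`, have the same sums
over `N`. The marks at `(χ ∘ ι, α ∘ ι)` and `(χ ∘ ι, β ∘ ι)` are therefore congruent modulo `p`
times the centralizer order. By the choice of `χ` both are nonzero, and reciprocity identifies both
columns with that of `χ ∘ ι`. -/
theorem sim_comp_of_normal {Q N : Type u} [Group Q] [Group N] [Finite Q] [Finite N]
    (hN : IsPGroup p N) (ι : Q →* N) (hι : Function.Injective ι)
    (hn : ∀ n q, ∃ q', ι q' = n * ι q * n⁻¹) {α β : N →* S} (h : Sim ω α β) :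
    Sim ω (α.comp ι) (β.comp ι) := by
  classical
  obtain ⟨χ, hχ, hχ'⟩ := hω.exists_mark_not_dvd hS hp hN ι hι hn α
  let C : Set (Q →* S) := MulAction.orbit S (χ.comp ι)
  have hC : ∀ s : S, ∀ ξ ∈ C, ∀ ξ' : Q →* S, (∀ q, ξ' q = s * ξ q * s⁻¹) → ξ' ∈ C := by
    intro s ξ hξ ξ' h
    rw [show ξ' = s • ξ from MonoidHom.ext h]
    exact MulAction.mem_orbit_of_mem_orbit s hξ
  have hC' : ∀ (n : N), ∀ ξ ∈ C, ∀ ξ' : Q →* S,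
      (∀ q q', ι q' = n * ι q * n⁻¹ → ξ' q' = ξ q) → ξ' ∈ C := by
    rintro n _ ⟨s, rfl⟩ ξ' h
    refine ⟨s * χ n⁻¹, MonoidHom.ext fun q => ?_⟩
    obtain ⟨q', hq'⟩ := hn n⁻¹ q
    rw [h q' q (by rw [hq']; group)]
    change s * χ n⁻¹ * χ (ι q) * (s * χ n⁻¹)⁻¹ = s * χ (ι q') * s⁻¹
    rw [hq', map_mul, map_mul]
    simp [mul_assoc]
  have h1 := mark_congruence hN ω ι α C hC hn hC'
  have h2 := mark_congruence hN ω ι β C hC hn hC'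
  rw [sum_orbit_conj _ fun s ξ => mark_smul_left s ξ _ _] at h1 h2
  rw [Finset.sum_congr rfl (fun χ _ => h χ)] at h1
  have h3 := dvd_sub h1 h2
  rw [sub_sub_sub_cancel_right, ← mul_sub, dvd_card_orbit_mul_iff] at h3
  have hα : mark (χ.comp ι) (α.comp ι) ω ≠ 0 := fun h0 => hχ' (h0 ▸ dvd_zero _)
  have hβ : mark (χ.comp ι) (β.comp ι) ω ≠ 0 := by
    intro h0
    rw [h0, sub_zero] at h3
    exact hχ' h3
  exact fun η => (hω.frobenius η _ _ hα).symm.trans (hω.frobenius η _ _ hβ)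

theorem sim_comp {Q N : Type u} [Group Q] [Group N] [Finite N]
    (hN : IsPGroup p N) (ι : Q →* N) (hι : Function.Injective ι) {α β : N →* S}
    (h : Sim ω α β) : Sim ω (α.comp ι) (β.comp ι) := by
  have key : ∀ K : Subgroup N, Sim ω (α.comp K.subtype) (β.comp K.subtype) := by
    intro K
    -- In a `p`-group a proper subgroup is proper and normal in its normalizer, so the normal case
    -- descends from the whole group to `K`.
    induction K using WellFoundedGT.induction with
    | _ K ih =>
      by_cases hK : K = ⊤
      · subst hK
        exact h.comp_equiv Subgroup.topEquiv
      · have := hN.isNilpotent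
        have hlt := Group.normalizerCondition_of_isNilpotent K (lt_top_iff_ne_top.2 hK)
        have h1 := hω.sim_comp_of_normal hS hp (hN.to_subgroup _) (Subgroup.inclusion hlt.le)
          (Subgroup.inclusion_injective _) (fun n q => ⟨⟨_,
            (Subgroup.mem_normalizer_iff.1 n.2 _).1 q.2⟩, rfl⟩) (ih _ hlt)
        exact h1
  have h1 := (key ι.range).comp_equiv (MonoidHom.ofInjective hι)
  exact h1

/-- Some injective `η` has nonzero mark at the inclusion of `P`, hence also at `ξ`, so `ker ξ ≤ ker
η`. Such `η` are found by descent from `S` through normalizers, restricting the `χ` of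
`exists_mark_not_dvd`; reciprocity shows that `χ` is injective. -/
theorem injective_of_sim (P : Subgroup S) {ξ : P →* S} (h : Sim ω ξ P.subtype) :
    Function.Injective ξ := by
  have key : ∀ P : Subgroup S, ∃ η : P →* S, Function.Injective η ∧ mark η P.subtype ω ≠ 0 := by
    intro P
    induction P using WellFoundedGT.induction with
    | _ P ih =>
      by_cases hP : P = ⊤
      · subst hP
        obtain ⟨σ, hσ, h0⟩ := hω.exists_top
        refine ⟨σ.comp (Subgroup.topEquiv (G := S)).toMonoidHom,
          hσ.1.comp (Subgroup.topEquiv (G := S)).injective, ?_⟩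
        rwa [← mark_comp_surjective _ _ (Subgroup.topEquiv (G := S)).toMonoidHom
          (Subgroup.topEquiv (G := S)).surjective] at h0
      · have := hS.isNilpotent
        have hlt := Group.normalizerCondition_of_isNilpotent P (lt_top_iff_ne_top.2 hP)
        obtain ⟨χ, hχ, hχ'⟩ := hω.exists_mark_not_dvd hS hp (hS.to_subgroup _)
          (Subgroup.inclusion hlt.le) (Subgroup.inclusion_injective _) (fun n q => ⟨⟨_,
            (Subgroup.mem_normalizer_iff.1 n.2 _).1 q.2⟩, rfl⟩) (Subgroup.subtype _)
        obtain ⟨η, hη, h0⟩ := ih _ hlt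
        rw [← hω.frobenius η _ _ hχ] at h0
        have hinj : Function.Injective χ := by
          rw [← MonoidHom.ker_eq_bot_iff, eq_bot_iff, ← (MonoidHom.ker_eq_bot_iff η).2 hη]
          exact ker_le_of_mark_ne_zero h0
        exact ⟨_, hinj.comp (Subgroup.inclusion_injective _), fun h0 => hχ' (h0 ▸ dvd_zero _)⟩
  obtain ⟨η, hη, h0⟩ := key P
  rw [← h η] at h0
  rw [← MonoidHom.ker_eq_bot_iff, eq_bot_iff, ← (MonoidHom.ker_eq_bot_iff η).2 hη]
  exact ker_le_of_mark_ne_zero h0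

/-- The fusion system of all `φ` with `ω ∘ [P, φ] = ω ∘ [P, incl]`. -/
def fusionSystem : FusionSystem S where
  Hom P Q := {φ | Sim ω (Q.subtype.comp φ) P.subtype}
  injective φ hφ := Function.Injective.of_comp (f := Subgroup.subtype _)
    (hω.injective_of_sim hS hp _ hφ)
  conj_mem g hg η := mark_conj_right g (fun _ => rfl) ω
  iso_mem := by
    intro P Q φ hφ e he
    have h1 : (image φ).subtype.comp e.toMonoidHom = Q.subtype.comp φ := MonoidHom.ext he
    have h2 : Sim ω ((image φ).subtype.comp e.toMonoidHom) P.subtype := h1 ▸ hφ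
    refine ⟨h2, ?_⟩
    have h3 := (h2.comp_equiv e.symm).symm
    have h4 : ((image φ).subtype.comp e.toMonoidHom).comp e.symm.toMonoidHom =
        (image φ).subtype := MonoidHom.ext fun q => congrArg Subtype.val (e.apply_symm_apply q)
    rwa [h4] at h3
  comp_mem := by
    intro P Q R φ hφ ψ hψ
    have hφ' : Function.Injective φ := Function.Injective.of_comp (f := Subgroup.subtype _)
      (hω.injective_of_sim hS hp _ hφ)
    have h1 := hω.sim_comp hS hp (hS.to_subgroup Q) φ hφ' hψ
    exact Sim.trans h1 hφ

end IsFrobeniusIdempotent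
end FrobeniusIdempotent

/-! ### Right stability in terms of marks. -/

namespace FusionSystem

variable {S : Type u} [Group S] [Finite S] {F : FusionSystem S} {k : Type} [CommRing k]

theorem RightStable.mark_eq {H : Type u} [Group H] {X : Burnside k S H} (hX : F.RightStable X)
    {Q : Type*} [Group Q] {β γ : Q →* S} (h : F.Rel β γ) (α : Q →* H) :
    mark α β X = mark α γ X := by
  obtain ⟨φ, hφ, h⟩ := h
  have h1 := congrArg (mark α γ.rangeRestrict) (hX _ _ hφ)
  rw [mark_comp_ofHom, mark_comp_ofHom] at h1
  have h2 : φ.comp γ.rangeRestrict = β := MonoidHom.ext h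
  rw [← h2]
  exact h1

theorem rightStable_of_mark_eq [IsDomain k] [CharZero k] {H : Type u} [Group H] [Finite H]
    {X : Burnside k S H}
    (h : ∀ (P : Subgroup S) (φ : P →* S), F.Mem φ → ∀ (Q : Subgroup P) (α : Q →* H),
      mark α (φ.comp Q.subtype) X = mark α (P.subtype.comp Q.subtype) X) : F.RightStable X := by
  intro P φ hφ
  refine eq_of_mark_eq fun Q α => ?_
  rw [mark_comp_ofHom, mark_comp_ofHom]
  exact h P ((⊤ : Subgroup S).subtype.comp φ) hφ Q α

end FusionSystem

/-! ### Saturation of the fusion system of an idempotent. -/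

section FrobeniusIdempotent

attribute [local instance] conjHomAction

variable {k : Type} [CommRing k] {S : Type u} [Group S] [Finite S]
variable {ω : Burnside k S S} [IsDomain k] [CharZero k] {p : ℕ} [Fact p.Prime]

namespace IsFrobeniusIdempotent

variable (hω : IsFrobeniusIdempotent ω) (hS : IsPGroup p S) (hp : ¬ (p : k) ∣ 1)

theorem mem_fusionSystem_iff {P : Subgroup S} {φ : P →* S} :
    (hω.fusionSystem hS hp).Mem φ ↔ Sim ω φ P.subtype := Iff.rfl

theorem isoMem_fusionSystem_iff {P Q : Subgroup S} {e : P ≃* Q} :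
    (hω.fusionSystem hS hp).IsoMem e ↔ Sim ω (Q.subtype.comp e.toMonoidHom) P.subtype := by
  rw [FusionSystem.IsoMem, ← FusionSystem.mem_iff_rel, mem_fusionSystem_iff]

/-- Each `γ` with nonzero mark at `(γ, incl)` is a morphism of `F`. For stable `X` its mark thus
factors out of the sum for `X ∘ ω`, leaving the column sum `|S|`. Conversely, `X ∘ ω` inherits
stability from the columns of `ω`. -/
theorem rightStable_iff {H : Type u} [Group H] [Finite H] {X : Burnside k S H} :
    (hω.fusionSystem hS hp).RightStable X ↔ comp X ω = X := by
  have hc : (Nat.card S : k) ≠ 0 := Nat.cast_ne_zero.2 Nat.card_pos.ne'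
  constructor
  · intro hX
    refine eq_of_mark_eq fun P α => mul_right_cancel₀ hc ?_
    rw [mark_comp, ← hω.sum_mark hS hp (hS.to_subgroup P) P.subtype, Finset.mul_sum]
    refine Finset.sum_congr rfl fun γ _ => ?_
    by_cases h0 : mark γ P.subtype ω = 0
    · rw [h0, mul_zero, mul_zero]
    · have h1 : Sim ω γ P.subtype := fun η => hω.frobenius η _ _ h0
      rw [hX.mark_eq (FusionSystem.mem_iff_rel.1 ((hω.mem_fusionSystem_iff hS hp).2 h1)) α]
  · intro hX
    refine FusionSystem.rightStable_of_mark_eq fun P φ hφ Q α => mul_right_cancel₀ hc ?_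
    have h1 := hω.sim_comp hS hp (hS.to_subgroup P) Q.subtype Q.subtype_injective
      ((hω.mem_fusionSystem_iff hS hp).1 hφ)
    rw [← hX, mark_comp, mark_comp]
    exact Finset.sum_congr rfl fun γ _ => by rw [h1]

/-- The congruence is applied to `Q ≤ N` and the conjugacy class of `e`, whose invariance under `N`
is exactly compatibility. Nondivisibility yields `χ : N → S` with nonzero mark that restricts to a
conjugate of `e`; by reciprocity `χ` is a morphism of `F`. -/
theorem receptive_of_not_dvd {P : Subgroup S}
    (hP : ¬ (p * Nat.card (Subgroup.centralizer (P : Set S)) : k) ∣ mark P.subtype P.subtype ω) :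
    (hω.fusionSystem hS hp).Receptive P := by
  classical
  intro Q e he N hN hc
  let ξ : Q →* S := P.subtype.comp e.toMonoidHom
  let ι : Q →* N := Subgroup.inclusion hN
  have hξ : Sim ω ξ Q.subtype := (hω.isoMem_fusionSystem_iff hS hp).1 he
  have hξr : ξ.range = P := by
    rw [MonoidHom.range_comp, MonoidHom.range_eq_top.2 e.surjective, ← MonoidHom.range_eq_map,
      Subgroup.range_subtype]
  have hn : ∀ n q, ∃ q', ι q' = n * ι q * n⁻¹ := fun n q =>
    ⟨⟨_, (Subgroup.mem_normalizer_iff.1 (hc n n.2).1 _).1 q.2⟩, rfl⟩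
  have h1 := mark_congruence (hS.to_subgroup N) ω ι N.subtype (MulAction.orbit S ξ) ?_ hn ?_
  · rw [sum_orbit_conj _ fun s ξ => mark_smul_left s ξ _ _] at h1
    have h2 : mark ξ (N.subtype.comp ι) ω = mark P.subtype P.subtype ω := by
      change mark ξ Q.subtype ω = _
      rw [← hξ ξ]
      exact mark_comp_surjective _ _ _ e.surjective _
    have h3 : ∑ χ : N →* S with χ.comp ι ∈ MulAction.orbit S ξ, mark χ N.subtype ω ≠ 0 := by
      intro h3
      rw [h3, sub_zero, dvd_card_orbit_mul_iff, hξr, h2] at h1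
      exact hP h1
    obtain ⟨χ, hχ, h0⟩ := Finset.exists_ne_zero_of_sum_ne_zero h3
    obtain ⟨s, hs⟩ := (Finset.mem_filter.1 hχ).2
    refine ⟨s⁻¹ • χ, ?_, fun u => ?_⟩
    · rw [← FusionSystem.mem_iff_rel, mem_fusionSystem_iff]
      intro η
      rw [mark_smul_right]
      exact hω.frobenius η _ _ h0
    · have h4 : s⁻¹ • (χ.comp ι) = ξ := by rw [← hs]; exact inv_smul_smul s ξ
      exact DFunLike.congr_fun h4 u
  · intro s ξ' hξ' ξ'' h
    rw [show ξ'' = s • ξ' from MonoidHom.ext h]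
    exact MulAction.mem_orbit_of_mem_orbit s hξ'
  · rintro n _ ⟨s, rfl⟩ ξ' h
    obtain ⟨-, y, hy⟩ := hc n n.2
    refine ⟨s * y⁻¹, MonoidHom.ext fun q => ?_⟩
    obtain ⟨q', hq'⟩ := hn n⁻¹ q
    have hq : ι q = n * ι q' * n⁻¹ := by rw [hq']; group
    rw [h q' q hq]
    have h5 := hy q' q (congrArg Subtype.val hq)
    change s * y⁻¹ * (e q : S) * (s * y⁻¹)⁻¹ = s * (e q' : S) * s⁻¹
    rw [h5]
    group

/-- The marks in the column of `P` are constant on orbits of `S × Aut_F(P)` and sum to `|S|`, so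
some orbit contributes a non-multiple of `p |S|`. For `ξ` in it, with image `P₀` and mark `|C_S(P₀)|
g`, the contribution is `|S| [Aut_F(P₀) : Aut_S(P₀)] g`; thus `p` divides neither the index nor `g`.
-/
theorem exists_automized (P : Subgroup S) : ∃ (P₀ : Subgroup S) (e : P ≃* P₀),
    (hω.fusionSystem hS hp).IsoMem e ∧ (hω.fusionSystem hS hp).Automized p P₀ ∧
    ¬ (p * Nat.card (Subgroup.centralizer (P₀ : Set S)) : k) ∣
      mark P₀.subtype P₀.subtype ω := by
  let F := hω.fusionSystem hS hp
  have hfin : Finite (MulAut P) := DFunLike.finite _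
  let _ : MulAction (S × F.aut P) (P →* S) :=
    { smul := fun a ξ => (a.1 • ξ).comp (a.2⁻¹ : MulAut P).toMonoidHom
      one_smul := fun ξ => by
        change ((1 : S) • ξ).comp ((1 : MulAut P)⁻¹).toMonoidHom = ξ
        rw [one_smul, inv_one]
        rfl
      mul_smul := fun a b ξ => by
        change ((a.1 * b.1) • ξ).comp ((a.2 * b.2 : MulAut P)⁻¹).toMonoidHom =
          (a.1 • (b.1 • ξ).comp (b.2⁻¹ : MulAut P).toMonoidHom).comp (a.2⁻¹ : MulAut P).toMonoidHom
        rw [mul_smul, mul_inv_rev]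
        rfl }
  have hact : ∀ (a : S × F.aut P) (ξ : P →* S),
      a • ξ = (a.1 • ξ).comp (a.2⁻¹ : MulAut P).toMonoidHom := fun _ _ => rfl
  have hinv : ∀ (a : S × F.aut P) (ξ : P →* S), mark (a • ξ) P.subtype ω = mark ξ P.subtype ω := by
    intro a ξ
    have h1 : Sim ω (P.subtype.comp (a.2 : MulAut P).toMonoidHom) P.subtype :=
      (hω.isoMem_fusionSystem_iff hS hp).1 (FusionSystem.mem_aut_iff.1 a.2.2)
    have h2 : (a • ξ).comp (a.2 : MulAut P).toMonoidHom = a.1 • ξ := MonoidHom.ext fun u => by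
      change (a.1 • ξ) ((a.2 : MulAut P)⁻¹ ((a.2 : MulAut P) u)) = _
      rw [MulAut.inv_apply_self]
    have h3 : Function.Surjective (a.2 : MulAut P).toMonoidHom := (a.2 : MulAut P).surjective
    rw [← mark_comp_surjective _ _ _ h3, h2, h1, mark_smul_left]
  have hex : ∃ ξ : P →* S, ¬ (p * Nat.card S : k) ∣
      Nat.card (MulAction.orbit (S × F.aut P) ξ) * mark ξ P.subtype ω := by
    by_contra! hcon
    have := dvd_sum_of_dvd_orbits (Γ := S × F.aut P) (fun ξ : P →* S => mark ξ P.subtype ω) hinv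
      _ hcon
    rw [hω.sum_mark hS hp (hS.to_subgroup P)] at this
    exact not_mul_card_dvd_card S hp this
  obtain ⟨ξ, hξ⟩ := hex
  have h0 : mark ξ P.subtype ω ≠ 0 := fun h0 => hξ (by rw [h0, mul_zero]; exact dvd_zero _)
  have hsim : Sim ω ξ P.subtype := fun η => hω.frobenius η _ _ h0
  have hinj := hω.injective_of_sim hS hp P hsim
  let P₀ := ξ.range
  let e : P ≃* P₀ := MonoidHom.ofInjective hinj
  have he : F.IsoMem e := (hω.isoMem_fusionSystem_iff hS hp).2 hsim
  have hg : mark ξ P.subtype ω = mark P₀.subtype P₀.subtype ω := by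
    rw [← hsim ξ]
    exact mark_comp_surjective P₀.subtype P₀.subtype _ e.surjective _
  -- A pair `(s, a)` fixes `ξ` when conjugation by `s` on `P₀` corresponds to `a`; such `s`
  -- normalizes `P₀` and determines `a`, as `ξ` is injective.
  have hstab : Nat.card (MulAction.stabilizer (S × F.aut P) ξ) =
      Nat.card (Subgroup.normalizer (P₀ : Set S)) := by
    have h1 : ∀ a ∈ MulAction.stabilizer (S × F.aut P) ξ, ∀ u : P,
        a.1 * ξ u * a.1⁻¹ = ξ ((a.2 : MulAut P) u) := by
      intro a ha u
      have := DFunLike.congr_fun (MulAction.mem_stabilizer_iff.1 ha) ((a.2 : MulAut P) u)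
      rw [hact] at this
      rw [← this]
      change _ = a.1 * ξ ((a.2 : MulAut P)⁻¹ ((a.2 : MulAut P) u)) * a.1⁻¹
      rw [MulAut.inv_apply_self]
    have hmem : ∀ a : MulAction.stabilizer (S × F.aut P) ξ,
        a.1.1 ∈ Subgroup.normalizer (P₀ : Set S) := by
      intro a
      rw [Subgroup.mem_normalizer_iff]
      intro x
      constructor
      · rintro ⟨u, rfl⟩
        exact ⟨_, (h1 a a.2 u).symm⟩
      · rintro ⟨v, hv⟩
        obtain ⟨u, rfl⟩ := (a.1.2 : MulAut P).surjective v
        rw [← h1 a a.2 u] at hv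
        exact ⟨u, by simpa using hv⟩
    refine Nat.card_eq_of_bijective (fun a => ⟨a.1.1, hmem a⟩) ⟨?_, ?_⟩
    · rintro ⟨⟨s, a⟩, ha⟩ ⟨⟨t, b⟩, hb⟩ hst
      obtain rfl : s = t := congrArg (fun x : Subgroup.normalizer (P₀ : Set S) => (x : S)) hst
      have hab : a = b := Subtype.ext (MulEquiv.ext fun u => hinj
        ((h1 _ ha u).symm.trans (h1 _ hb u)))
      subst hab
      rfl
    · intro s
      have hb : P₀.normalizerMonoidHom s ∈ F.aut P₀ := FusionSystem.autS_le_aut P₀ ⟨s, rfl⟩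
      have ha : MulAut.congr e.symm (P₀.normalizerMonoidHom s) ∈ F.aut P := by
        rw [← FusionSystem.map_congr_aut he.symm]
        exact ⟨_, hb, rfl⟩
      refine ⟨⟨(s, ⟨_, ha⟩), ?_⟩, rfl⟩
      rw [MulAction.mem_stabilizer_iff, hact]
      refine MonoidHom.ext fun u => ?_
      obtain ⟨v, rfl⟩ := (MulAut.congr e.symm (P₀.normalizerMonoidHom s)).surjective u
      change (s : S) * ξ ((MulAut.congr e.symm (P₀.normalizerMonoidHom s))⁻¹
        (MulAut.congr e.symm (P₀.normalizerMonoidHom s) v)) * (s : S)⁻¹ = _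
      rw [MulAut.inv_apply_self]
      exact (congrArg Subtype.val (e.apply_symm_apply (P₀.normalizerMonoidHom s (e v)))).symm
  have horb : Nat.card (MulAction.orbit (S × F.aut P) ξ) *
      Nat.card (Subgroup.centralizer (P₀ : Set S)) =
      Nat.card S * (FusionSystem.autS P₀).relIndex (F.aut P₀) := by
    have h1 := (MulAction.stabilizer (S × F.aut P) ξ).card_mul_index
    rw [hstab, Nat.card_prod, he.card_aut, MulAction.index_stabilizer,
      ← FusionSystem.card_mul_relIndex (FusionSystem.autS_le_aut P₀),
      ← FusionSystem.card_autS_mul] at h1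
    refine Nat.eq_of_mul_eq_mul_left (Nat.card_pos (α := FusionSystem.autS P₀)) ?_
    rw [mul_left_comm (Nat.card (FusionSystem.autS P₀)) (Nat.card S), ← h1]
    change _ * (Set.ncard _ * _) = _
    ring
  have horb' := congrArg (Nat.cast (R := k)) horb
  push_cast at horb'
  refine ⟨P₀, e, he, fun hdvd => hξ ?_, fun hdvd => hξ ?_⟩
  · obtain ⟨r, hr⟩ := hdvd
    obtain ⟨g, hg⟩ := card_centralizer_dvd_mark ξ P.subtype ω
    rw [hg, ← mul_assoc, horb', hr]
    exact ⟨r * g, by push_cast; ring⟩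
  · obtain ⟨g, hg'⟩ := hdvd
    rw [hg, hg']
    exact ⟨(FusionSystem.autS P₀).relIndex (F.aut P₀) * g, by linear_combination p * g * horb'⟩

theorem isSaturated : (hω.fusionSystem hS hp).IsSaturated p :=
  FusionSystem.isSaturated_of_exists hS fun P => by
    obtain ⟨P₀, e, he, ha, hd⟩ := hω.exists_automized hS hp P
    exact ⟨P₀, e, he, hω.receptive_of_not_dvd hS hp hd, ha⟩

end IsFrobeniusIdempotent

/-- The image of the identity under a retractive transfer is an idempotent that satisfies Frobenius
reciprocity. -/
theorem RetractiveTransfer.isFrobeniusIdempotent {R : Submodule k (Burnside k S S)}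
    {R' : Submodule k (Burnside k S (S × S))} (T : RetractiveTransfer R R')
    (hJ : ¬ R ≤ nishida k S) :
    ∃ ω : Burnside k S S, IsFrobeniusIdempotent ω ∧ (∀ X, X ∈ R ↔ comp X ω = X) ∧
      ∀ X, X ∈ R' ↔ comp X ω = X := by
  let i : Burnside k S S := ofHom k (MonoidHom.id S)
  let ω : Burnside k S S := T.t i
  have ht : ∀ x, (T.t x : Burnside k S S) = comp x ω := fun x => by
    rw [← T.map_comp, comp_ofHom_id]
  have ht' : ∀ z, (T.t' z : Burnside k S (S × S)) = comp z ω := fun z => by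
    rw [← T.natural, comp_ofHom_id]
  have hR : ∀ X, X ∈ R ↔ comp X ω = X := fun X =>
    ⟨fun h => by rw [← ht, T.retract ⟨X, h⟩], fun h => by rw [← h, ← ht]; exact (T.t X).2⟩
  have hR' : ∀ X, X ∈ R' ↔ comp X ω = X := fun X =>
    ⟨fun h => by rw [← ht', T.retract' ⟨X, h⟩], fun h => by rw [← h, ← ht']; exact (T.t' X).2⟩
  refine ⟨ω, ⟨(hR ω).1 (T.t i).2, ?_, ?_⟩, hR, hR'⟩
  · intro Q _ _ α β γ h0
    have hc : (Nat.card S : k) ≠ 0 := Nat.cast_ne_zero.2 Nat.card_pos.ne'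
    have hi : comp i ω = ω := by rw [← T.map_comp, comp_ofHom_id]
    -- Reciprocity for `ω` and the identity: `κ(ω, i) ∘ ω = κ(ω, ω)`.
    have h1 := T.frobenius (T.t i) i
    rw [ht'] at h1
    have h2 := congrArg (fun z => mark (α.prod β) γ z * (Nat.card S : k)) h1
    have h3 : ∀ δ : Q →* S, mark (α.prod β) δ (kappa ω i) * mark δ γ ω =
        mark α β ω * (mark β δ i * mark δ γ ω) := by
      intro δ
      rw [mark_kappa, MonoidHom.fst_comp_prod, MonoidHom.snd_comp_prod, mul_assoc]
      by_cases h : mark β δ i = 0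
      · rw [h, zero_mul, mul_zero, mul_zero]
      -- The identity biset has nonzero marks only at conjugate pairs, and conjugate `β` and `δ`
      -- give equal columns of `ω`.
      · obtain ⟨a, b, hab⟩ := exists_of_mark_basic_ne_zero h
        have hβ : β = (a * b) • δ := MonoidHom.ext fun q => by
          obtain ⟨_, hq⟩ := hab q
          have hq' : b * δ q * b⁻¹ = a⁻¹ * β q * a := hq
          have : β q = a * (a⁻¹ * β q * a) * a⁻¹ := by group
          rw [this, ← hq', conj_smul_apply]
          group
        conv_rhs => rw [hβ, mark_smul_right, ← hβ]
    rw [mark_comp, Finset.sum_congr rfl (fun δ _ => h3 δ), ← Finset.mul_sum, ← mark_comp, hi,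
      mark_kappa, MonoidHom.fst_comp_prod, MonoidHom.snd_comp_prod, ← mul_assoc] at h2
    exact mul_right_cancel₀ h0 (mul_right_cancel₀ hc h2)
  -- Otherwise every `x = x ∘ ω` in `R` has zero marks at automorphisms: a nonzero term of the
  -- composition formula would have injective, hence bijective, middle homomorphism. Then `R` would
  -- lie in the Nishida ideal.
  · by_contra! hcon
    refine hJ fun x hx => mem_nishida fun σ hσ => ?_
    have hc : (Nat.card S : k) ≠ 0 := Nat.cast_ne_zero.2 Nat.card_pos.ne'
    refine (mul_eq_zero.1 ?_).resolve_right hc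
    rw [← (hR x).1 hx, mark_comp]
    refine Finset.sum_eq_zero fun β _ => ?_
    by_contra h0
    have h1 : β.ker = ⊥ := by
      rw [eq_bot_iff, ← (MonoidHom.ker_eq_bot_iff σ).2 hσ.1]
      exact ker_le_of_mark_ne_zero (left_ne_zero_of_mul h0)
    exact right_ne_zero_of_mul h0 (hcon β
      (Finite.injective_iff_bijective.1 ((MonoidHom.ker_eq_bot_iff β).1 h1)))

end FrobeniusIdempotent

/-! ### Normalizers of graphs and orbit counting. -/

section Graph

variable {G H : Type u} [Group G] [Group H]

/-- The graph `{(α(q), q)}` of a homomorphism `α : Q → H`. -/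
def graph (Q : Subgroup G) (α : Q →* H) : Subgroup (H × G) := (α.prod Q.subtype).range

theorem mem_graph {Q : Subgroup G} {α : Q →* H} {w : H × G} :
    w ∈ graph Q α ↔ ∃ q : Q, α q = w.1 ∧ (q : G) = w.2 := by
  simp [graph, MonoidHom.mem_range, Prod.ext_iff]

/-- The normalizer of the graph of a homomorphism. -/
abbrev graphNormalizer (Q : Subgroup G) (α : Q →* H) : Subgroup (H × G) :=
  Subgroup.normalizer (graph Q α : Set (H × G))

/-- The isomorphism of `Q` with the graph of `α : Q → H`, as a homomorphism to the normalizer. -/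
def toGraph (Q : Subgroup G) (α : Q →* H) : Q →* graphNormalizer Q α :=
  (α.prod Q.subtype).codRestrict _ fun q => Subgroup.le_normalizer ⟨q, rfl⟩

theorem range_toGraph (Q : Subgroup G) (α : Q →* H) :
    (toGraph Q α).range = (graph Q α).subgroupOf (graphNormalizer Q α) := by
  ext w
  rw [Subgroup.mem_subgroupOf]
  constructor
  · rintro ⟨q, rfl⟩
    exact ⟨q, rfl⟩
  · rintro ⟨q, hq⟩
    exact ⟨q, Subtype.ext hq⟩

theorem toGraph_injective (Q : Subgroup G) (α : Q →* H) : Function.Injective (toGraph Q α) :=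
  fun _ _ h => Subtype.ext (congrArg (fun w : graphNormalizer Q α => (w : H × G).2) h)

theorem exists_of_mem_graphNormalizer {Q : Subgroup G} {α : Q →* H} {w : H × G}
    (hw : w ∈ graphNormalizer Q α) (q : Q) :
    ∃ hq : w.2 * q * w.2⁻¹ ∈ Q, α ⟨w.2 * q * w.2⁻¹, hq⟩ = w.1 * α q * w.1⁻¹ := by
  obtain ⟨q', h1, h2⟩ := mem_graph.1
    ((Subgroup.mem_normalizer_iff.1 hw _).1 (⟨q, rfl⟩ : (α q, (q : G)) ∈ graph Q α))
  have h2 : (q' : G) = w.2 * q * w.2⁻¹ := h2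
  refine ⟨h2 ▸ q'.2, ?_⟩
  rw [show (⟨_, h2 ▸ q'.2⟩ : Q) = q' from Subtype.ext h2.symm]
  exact h1

variable [Finite G] [Finite H]

theorem mem_graphNormalizer_iff {Q : Subgroup G} {α : Q →* H} {w : H × G} :
    w ∈ graphNormalizer Q α ↔ ∀ q : Q, ∃ hq : w.2 * q * w.2⁻¹ ∈ Q,
      α ⟨w.2 * q * w.2⁻¹, hq⟩ = w.1 * α q * w.1⁻¹ := by
  refine ⟨exists_of_mem_graphNormalizer, fun h => Subgroup.mem_normalizer_fintype ?_⟩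
  rintro _ ⟨q, rfl⟩
  obtain ⟨hq, e⟩ := h q
  exact ⟨⟨_, hq⟩, Prod.ext e rfl⟩

theorem mem_normalizer_of_mem_graphNormalizer {Q : Subgroup G} {α : Q →* H} {w : H × G}
    (hw : w ∈ graphNormalizer Q α) : w.2 ∈ Subgroup.normalizer (Q : Set G) :=
  Subgroup.mem_normalizer_fintype fun q hq => (mem_graphNormalizer_iff.1 hw ⟨q, hq⟩).1

theorem Biset.card_fiber_basicMk (Q : Subgroup G) (α : Q →* H) (a : H) (b : G) :
    Nat.card {c : H × G // basicMk Q α c.1 c.2 = basicMk Q α a b} = Nat.card Q := by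
  symm
  refine Nat.card_eq_of_bijective (fun q => ⟨(a * α q, (q : G)⁻¹ * b), Quotient.sound
    ⟨q, by simp, by simp⟩⟩) ⟨fun q q' h => ?_, ?_⟩
  · have := congrArg (fun c => c.1.2) h
    simpa using this
  · rintro ⟨⟨c, d⟩, h⟩
    obtain ⟨q, h1, h2⟩ := Quotient.exact h
    have h1 : a * α q = c := h1
    have h2 : b = q * d := h2
    exact ⟨q, Subtype.ext (Prod.ext h1 (by simp [h2]))⟩

/-- The class of `(a, b)` is fixed exactly when `(a⁻¹, b)` normalizes the graph, and every point has
`|Q|` representatives. -/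
theorem Biset.card_fixed_basic_mul (Q : Subgroup G) (α : Q →* H) :
    Nat.card ((basic Q α).fixed α Q.subtype) * Nat.card Q = Nat.card (graphNormalizer Q α) := by
  let A := {c : H × G // basicMk Q α c.1 c.2 ∈ (basic Q α).fixed α Q.subtype}
  have h1 : Nat.card A = Nat.card (graphNormalizer Q α) := by
    have key : ∀ c : H × G, basicMk Q α c.1 c.2 ∈ (basic Q α).fixed α Q.subtype ↔
        (c.1⁻¹, c.2) ∈ graphNormalizer Q α := by
      intro c
      rw [mem_graphNormalizer_iff]
      simp only [mem_fixed, smul_basic_eq_iff, inv_inv]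
      rfl
    refine Nat.card_congr
      { toFun := fun c => ⟨(c.1.1⁻¹, c.1.2), (key _).1 c.2⟩
        invFun := fun w => ⟨(w.1.1⁻¹, w.1.2), (key _).2 (by rw [inv_inv]; exact w.2)⟩
        left_inv := fun c => Subtype.ext (Prod.ext (inv_inv _) rfl)
        right_inv := fun w => Subtype.ext (Prod.ext (inv_inv _) rfl) }
  rw [← h1]
  refine (card_eq_card_mul_of_fibers
    (fun c : A => (⟨_, c.2⟩ : (basic Q α).fixed α Q.subtype)) _ ?_).symm
  rintro ⟨x, hx⟩
  obtain ⟨a, b, rfl⟩ := exists_basicMk_eq x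
  rw [← card_fiber_basicMk Q α a b]
  exact Nat.card_congr
    { toFun := fun c => ⟨c.1.1, congrArg Subtype.val c.2⟩
      invFun := fun c => ⟨⟨c.1, by rw [c.2]; exact hx⟩, Subtype.ext c.2⟩
      left_inv := fun _ => rfl
      right_inv := fun _ => rfl }

variable {k : Type} [CommRing k]

theorem Burnside.mark_basic_self_mul (Q : Subgroup G) (α : Q →* H) :
    mark α Q.subtype (basic k Q α) * (Nat.card Q : k) = Nat.card (graphNormalizer Q α) := by
  rw [basic, mark_cls, ← Nat.cast_mul, Biset.card_fixed_basic_mul]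

/-- If the marks of `X` along `(a', b')` agree with those along the two projections of the
normalizer of the graph of `α`, except on the graph itself, then the marks on the graph are
congruent modulo the mark of `[Q, α]`. -/
theorem Burnside.mark_basic_self_dvd_sub [IsDomain k] [CharZero k] {G' H' : Type u} [Group G']
    [Group H'] (Q : Subgroup G) (α : Q →* H) (X : Burnside k G H) (X' : Burnside k G' H')
    (a : graphNormalizer Q α →* H') (b : graphNormalizer Q α →* G')
    (h : ∀ K : Subgroup (graphNormalizer Q α), (toGraph Q α).range < K →
      mark (((MonoidHom.fst H G).comp (Subgroup.subtype _)).comp K.subtype)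
        (((MonoidHom.snd H G).comp (Subgroup.subtype _)).comp K.subtype) X =
      mark (a.comp K.subtype) (b.comp K.subtype) X') :
    mark α Q.subtype (basic k Q α) ∣
      mark α Q.subtype X - mark (a.comp (toGraph Q α)) (b.comp (toGraph Q α)) X' := by
  classical
  have _ := Fintype.ofFinite (graphNormalizer Q α)
  set Δ := (toGraph Q α).range with hΔ
  have _ : Δ.Normal := by rw [hΔ, range_toGraph]; infer_instance
  -- Both sums are divisible by the order of the normalizer. Their terms agree off the graph and
  -- differ by `D` on it, so `|Q| D` is divisible by that order, which is `|Q|` times the mark of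
  -- `[Q, α]`.
  have hdvd := dvd_sub (card_dvd_sum_mark ((MonoidHom.fst H G).comp (Subgroup.subtype _))
    ((MonoidHom.snd H G).comp (Subgroup.subtype _)) Δ X) (card_dvd_sum_mark a b Δ X')
  rw [← Finset.sum_sub_distrib] at hdvd
  have hQ : (Nat.card Q : k) ≠ 0 := Nat.cast_ne_zero.2 Nat.card_pos.ne'
  rw [← mul_dvd_mul_iff_right hQ, mark_basic_self_mul]
  refine hdvd.trans (dvd_of_eq ?_)
  set D := mark α Q.subtype X - mark (a.comp (toGraph Q α)) (b.comp (toGraph Q α)) X' with hD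
  have hterm : ∀ w : graphNormalizer Q α,
      mark (((MonoidHom.fst H G).comp (Subgroup.subtype _)).comp (Δ ⊔ Subgroup.zpowers w).subtype)
        (((MonoidHom.snd H G).comp (Subgroup.subtype _)).comp (Δ ⊔ Subgroup.zpowers w).subtype) X -
      mark (a.comp (Δ ⊔ Subgroup.zpowers w).subtype) (b.comp (Δ ⊔ Subgroup.zpowers w).subtype) X' =
      if w ∈ Δ then D else 0 := by
    intro w
    split_ifs with hw
    · have : Δ ⊔ Subgroup.zpowers w = Δ := sup_eq_left.2 (Subgroup.zpowers_le.2 hw)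
      rw [this, hD, ← mark_comp_surjective (((MonoidHom.fst H G).comp (Subgroup.subtype _)).comp
        Δ.subtype) _ _ (toGraph Q α).rangeRestrict_surjective,
        ← mark_comp_surjective (a.comp Δ.subtype) _ _ (toGraph Q α).rangeRestrict_surjective]
      rfl
    · rw [h, sub_self]
      refine lt_of_le_of_ne le_sup_left fun e => hw ?_
      rw [e]
      exact Subgroup.mem_sup_right (Subgroup.mem_zpowers w)
  rw [Finset.sum_congr rfl fun w _ => hterm w, Finset.sum_ite, Finset.sum_const_zero, add_zero,
    Finset.sum_const, nsmul_eq_mul, mul_comm]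
  congr 2
  rw [← Nat.card_congr (MonoidHom.ofInjective (toGraph_injective Q α)).toEquiv.symm,
    ← Fintype.card_subtype, Nat.card_eq_fintype_card]

end Graph

/-! ### Elements supported on a fusion system. -/

namespace FusionSystem

section Support

variable {S : Type u} [Group S] (F : FusionSystem S) {k : Type} [CommRing k]

/-- The marks of `X` vanish outside `F`. -/
def Supported (X : Burnside k S S) : Prop :=
  ∀ (Q : Type u) [Group Q] [Finite Q] (α β : Q →* S), mark α β X ≠ 0 → F.Rel α β

/-- The marks of `X` at pairs of homomorphisms in `F` with image of order at least `n` depend only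
on the `F`-class of the pair. -/
def StableFrom (n : ℕ) (X : Burnside k S S) : Prop :=
  ∀ (Q : Type u) [Group Q] [Finite Q] (α β α' β' : Q →* S), F.Rel α β → F.Rel α' β' → F.Rel α α' →
    n ≤ Nat.card β.range → mark α β X = mark α' β' X

variable {F}

theorem Supported.add {X Y : Burnside k S S} (hX : F.Supported X) (hY : F.Supported Y) :
    F.Supported (X + Y) := by
  intro Q _ _ α β h
  by_cases h0 : mark α β X = 0
  · rw [map_add, h0, zero_add] at h
    exact hY Q α β h
  · exact hX Q α β h0

theorem Supported.smul {X : Burnside k S S} (c : k) (hX : F.Supported X) : F.Supported (c • X) := by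
  intro Q _ _ α β h
  rw [map_smul] at h
  exact hX Q α β (right_ne_zero_of_smul h)

theorem Supported.sub {X Y : Burnside k S S} (hX : F.Supported X) (hY : F.Supported Y) :
    F.Supported (X - Y) := by
  have := hX.add (hY.smul (-1))
  rwa [neg_one_smul, ← sub_eq_add_neg] at this

theorem Conj.symm {P Q : Subgroup S} (h : F.Conj P Q) : F.Conj Q P := by
  obtain ⟨e, he⟩ := conj_iff.1 h
  exact conj_iff.2 ⟨_, he.symm⟩

theorem Conj.trans {P Q R : Subgroup S} (h : F.Conj P Q) (h' : F.Conj Q R) : F.Conj P R := by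
  obtain ⟨e, he⟩ := conj_iff.1 h
  obtain ⟨e', he'⟩ := conj_iff.1 h'
  exact conj_iff.2 ⟨_, he.trans he'⟩

theorem Rel.conj_range {Q : Type*} [Group Q] {α β : Q →* S} (h : F.Rel α β) :
    F.Conj β.range α.range := by
  obtain ⟨e, -, he⟩ := h.exists_equiv
  exact conj_iff.2 ⟨e, mem_iff_rel.1 he⟩

variable [Finite S]

theorem Supported.comp [IsDomain k] [CharZero k] {X Y : Burnside k S S} (hX : F.Supported X)
    (hY : F.Supported Y) : F.Supported (comp X Y) := by
  intro Q _ _ α β h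
  have h1 : mark α β (Burnside.comp X Y) * (Nat.card S : k) ≠ 0 :=
    mul_ne_zero h (Nat.cast_ne_zero.2 Nat.card_pos.ne')
  rw [mark_comp] at h1
  obtain ⟨γ, -, hγ⟩ := Finset.exists_ne_zero_of_sum_ne_zero h1
  exact (hX Q _ _ (left_ne_zero_of_mul hγ)).trans (hY Q _ _ (right_ne_zero_of_mul hγ))

theorem supported_basic {Q : Subgroup S} {φ : Q →* S} (hφ : F.Mem φ) :
    F.Supported (basic k Q φ) := by
  intro P _ _ α β h
  obtain ⟨a, b, hab⟩ := exists_of_mark_basic_ne_zero h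
  let ι : P →* Q := ((MulAut.conj b).toMonoidHom.comp β).codRestrict Q fun q => (hab q).1
  have h1 : F.Rel (φ.comp ι) (Q.subtype.comp ι) := (mem_iff_rel.1 hφ).comp ι
  have h2 : F.Rel α (φ.comp ι) := rel_of_conj a fun q => by
    rw [show (φ.comp ι) q = a⁻¹ * α q * a from (hab q).2]
    group
  exact (h2.trans h1).trans (rel_of_conj b fun q => rfl)

theorem StableFrom.rightStable [IsDomain k] [CharZero k] {X : Burnside k S S} (hX : F.Supported X)
    (h : F.StableFrom 0 X) : F.RightStable X := by
  refine rightStable_of_mark_eq fun P φ hφ Q α => ?_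
  have h1 : F.Rel (φ.comp Q.subtype) (P.subtype.comp Q.subtype) := (mem_iff_rel.1 hφ).comp _
  by_cases h2 : F.Rel α (φ.comp Q.subtype)
  · exact h _ _ _ _ _ h2 (h2.trans h1) (Rel.refl _) (Nat.zero_le _)
  · rw [not_not.1 (mt (hX _ _ _) h2), not_not.1 (mt (hX _ _ _) fun h3 => h2 (h3.trans h1.symm))]

/-- A choice of fully normalized subgroups in the conjugacy classes of `F`. -/
theorem exists_fullyNormalized_representatives (F : FusionSystem S) :
    ∃ r : Subgroup S → Subgroup S, (∀ Q, F.Conj Q (r Q) ∧ F.FullyNormalized (r Q)) ∧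
      ∀ Q Q', F.Conj Q Q' → r Q = r Q' := by
  -- `Classical.epsilon` depends only on the predicate, which is the same for conjugate subgroups;
  -- so the choice is constant on classes.
  refine ⟨fun Q => Classical.epsilon fun P => F.Conj Q P ∧ F.FullyNormalized P, fun Q => ?_,
    fun Q Q' h => ?_⟩
  · obtain ⟨P, e, he, hP⟩ := F.exists_fullyNormalized Q
    exact Classical.epsilon_spec (p := fun P => F.Conj Q P ∧ F.FullyNormalized P)
      ⟨P, conj_iff.2 ⟨e, he⟩, hP⟩
  · refine congrArg Classical.epsilon (funext fun P => ?_)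
    rw [show F.Conj Q P ↔ F.Conj Q' P from ⟨h.symm.trans, h.trans⟩]

variable {p : ℕ} [Fact p.Prime]

/-- The marks of `X` at the morphisms `ψ` on subgroups of order `n` are congruent to those at
fully normalized subgroups, if `X` is stable above order `n`. -/
theorem IsSaturated.mark_basic_self_dvd_sub [IsDomain k] [CharZero k] (hF : F.IsSaturated p)
    (hS : IsPGroup p S) {X : Burnside k S S} (hX : F.Supported X) {Q : Subgroup S}
    (h : F.StableFrom (Nat.card Q + 1) X) {ψ : Q →* S} (hψ : F.Mem ψ) {P₀ : Subgroup S}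
    (hQ : F.Conj Q P₀) (hP₀ : F.FullyNormalized P₀) :
    mark ψ Q.subtype (basic k Q ψ) ∣ mark ψ Q.subtype X - mark P₀.subtype P₀.subtype X := by
  let P := ψ.range
  let e₀ : Q ≃* P := MonoidHom.ofInjective hψ.injective
  have he₀ : F.IsoMem e₀ := mem_iff_rel.1 hψ
  obtain ⟨e₁, he₁⟩ := conj_iff.1 hQ
  obtain ⟨e, α, he, hα, hαe⟩ := exists_extension_normalizer hS (he₀.symm.trans he₁)
    (hF.receptive hP₀) (hF.automized hP₀)
  let Γ := graphNormalizer Q ψ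
  have hc : ∀ w ∈ Γ, ∀ u v : Q, (v : S) = w.2 * u * w.2⁻¹ → (e₀ v : S) = w.1 * e₀ u * w.1⁻¹ := by
    intro w hw u v huv
    obtain ⟨hq, e⟩ := mem_graphNormalizer_iff.1 hw u
    rw [show v = ⟨_, hq⟩ from Subtype.ext huv]
    exact e
  have hP : ∀ w ∈ Γ, w.1 ∈ Subgroup.normalizer (P : Set S) := fun w hw =>
    mem_normalizer_of_compatible (mem_normalizer_of_mem_graphNormalizer hw) (hc w hw)
  let N := Γ.map (MonoidHom.snd S S)
  have hQN : Q ≤ N := fun q hq => ⟨_, (toGraph Q ψ ⟨q, hq⟩).2, rfl⟩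
  -- For `w` normalizing the graph, conjugation by `w.2` on `Q` corresponds to conjugation by `w.1`
  -- on `P`, hence by `α(w.1)` on `P₀`. The resulting `α` and `χ` carry both projections of `Γ` to
  -- homomorphisms that agree on the graph.
  obtain ⟨χ, hχ, hχe⟩ := hF.receptive hP₀ Q (e₀.trans e) (he₀.trans he) N hQN (by
    rintro _ ⟨w, hw, rfl⟩
    refine ⟨mem_normalizer_of_mem_graphNormalizer hw, α ⟨w.1, hP w hw⟩, fun u v huv => ?_⟩
    change (e (e₀ v) : S) = α ⟨w.1, hP w hw⟩ * e (e₀ u) * (α ⟨w.1, hP w hw⟩)⁻¹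
    rw [← hαe, ← hαe, ← map_mul, ← map_inv, ← map_mul]
    exact congrArg α (Subtype.ext (hc w hw u v huv)))
  let a : Γ →* S := (MonoidHom.fst S S).comp Γ.subtype
  let b : Γ →* S := (MonoidHom.snd S S).comp Γ.subtype
  let ia : Γ →* Subgroup.normalizer (P : Set S) := a.codRestrict _ fun w => hP w w.2
  let ib : Γ →* N := b.codRestrict _ fun w => ⟨w, w.2, rfl⟩
  have ha : F.Rel (α.comp ia) a := hα.comp ia
  have hb : F.Rel (χ.comp ib) b := hχ.comp ib
  have key := Burnside.mark_basic_self_dvd_sub Q ψ X X (α.comp ia) (χ.comp ib) fun K hK => ?_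
  · have h1 : (α.comp ia).comp (toGraph Q ψ) = P₀.subtype.comp (e₀.trans e).toMonoidHom :=
      MonoidHom.ext fun q => hαe (e₀ q)
    have h2 : (χ.comp ib).comp (toGraph Q ψ) = P₀.subtype.comp (e₀.trans e).toMonoidHom :=
      MonoidHom.ext fun q => hχe q
    rw [h1, h2, mark_comp_surjective _ _ _ (e₀.trans e).surjective] at key
    exact key
  · change mark (a.comp K.subtype) (b.comp K.subtype) X = _
    have ha' := ha.comp K.subtype
    have hb' := hb.comp K.subtype
    by_cases hK' : F.Rel (a.comp K.subtype) (b.comp K.subtype)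
    · refine h _ _ _ _ _ hK' ((ha'.trans hK').trans hb'.symm) ha'.symm ?_
      -- Related homomorphisms have the same kernel, and the two coordinates determine `w`. The
      -- second projection is thus injective on `K`, with image of order greater than `|Q|`, where
      -- `X` is stable.
      have hinj : Function.Injective (b.comp K.subtype) := by
        rw [← MonoidHom.ker_eq_bot_iff, eq_bot_iff]
        intro w hw
        have hw' : w ∈ (a.comp K.subtype).ker := by rw [hK'.ker_eq]; exact hw
        exact Subtype.ext (Subtype.ext (Prod.ext hw' hw))
      rw [← Nat.card_congr (MonoidHom.ofInjective hinj).toEquiv,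
        Nat.card_congr (MonoidHom.ofInjective (toGraph_injective Q ψ)).toEquiv]
      exact Set.Finite.card_lt_card (Set.toFinite _) hK
    · rw [not_not.1 (mt (hX _ _ _) hK'), not_not.1 (mt (hX _ _ _) fun h3 =>
        hK' ((ha'.symm.trans h3).trans hb'))]

end Support
end FusionSystem

/-! ### Stable elements of a saturated fusion system. -/

namespace FusionSystem

section Characteristic

variable {S : Type u} [Group S] [Finite S] {F : FusionSystem S} {k : Type} [CommRing k]

theorem mark_basic_top : mark (⊤ : Subgroup S).subtype (⊤ : Subgroup S).subtype
    (basic k (⊤ : Subgroup S) (⊤ : Subgroup S).subtype) =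
      Nat.card (Subgroup.centralizer ((⊤ : Subgroup S) : Set S)) := by
  rw [basic, mark_cls]
  congr 1
  symm
  refine Nat.card_eq_of_bijective (fun z => ⟨Biset.basicMk _ _ z 1, fun q =>
    Biset.smul_basic_eq_iff.2 ⟨trivial, ?_⟩⟩) ⟨fun z z' h => ?_, ?_⟩
  · have h := Subgroup.mem_centralizer_iff.1 z.2 q q.2
    change 1 * (q : S) * 1⁻¹ = (z : S)⁻¹ * q * z
    rw [mul_assoc, mul_assoc, h]
    simp
  · obtain ⟨q, h1, h2⟩ := Quotient.exact (congrArg Subtype.val h)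
    have h1 : (z' : S) * q = z := h1
    have h2 : (1 : S) = q * 1 := h2
    rw [← mul_one (q : S), ← h2, mul_one] at h1
    exact Subtype.ext h1.symm
  · rintro ⟨x, hx⟩
    obtain ⟨a, b, rfl⟩ := Biset.exists_basicMk_eq x
    have hab : Biset.basicMk (⊤ : Subgroup S) (⊤ : Subgroup S).subtype (a * b) 1 =
        Biset.basicMk _ _ a b :=
      Quotient.sound ⟨⟨b, trivial⟩, by simp, by simp⟩
    rw [← hab] at hx
    refine ⟨⟨a * b, Subgroup.mem_centralizer_iff.2 fun s hs => ?_⟩, Subtype.ext hab⟩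
    obtain ⟨_, e⟩ := Biset.smul_basic_eq_iff.1 (hx ⟨s, hs⟩)
    have e : 1 * s * 1⁻¹ = (a * b)⁻¹ * s * (a * b) := e
    rw [one_mul, inv_one, mul_one, mul_assoc, eq_inv_mul_iff_mul_eq] at e
    exact e.symm

theorem card_mem_top : Nat.card {ψ : (⊤ : Subgroup S) →* S // F.Mem ψ} =
    Nat.card (F.aut ⊤) := by
  symm
  refine Nat.card_eq_of_bijective (fun e => ⟨(⊤ : Subgroup S).subtype.comp
    (e : MulAut (⊤ : Subgroup S)).toMonoidHom, mem_iff_rel.2 (mem_aut_iff.1 e.2)⟩)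
    ⟨fun e e' h => ?_, fun ψ => ?_⟩
  · refine Subtype.ext (MulEquiv.ext fun u => Subtype.ext ?_)
    exact DFunLike.congr_fun (congrArg Subtype.val h) u
  · let φ : (⊤ : Subgroup S) →* (⊤ : Subgroup S) := ψ.1.codRestrict ⊤ fun _ => trivial
    have hφ : Function.Injective φ := fun x y h => ψ.2.injective (congrArg Subtype.val h)
    exact ⟨⟨MulEquiv.ofBijective φ (Finite.injective_iff_bijective.1 hφ),
      mem_aut_iff.2 (mem_iff_rel.1 ψ.2)⟩, rfl⟩

/-- The index of `Aut_S(S)` in `Aut_F(S)` is, up to the order of `S`, a sum of marks of a stable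
element. -/
theorem StableFrom.sum_mark_top {X : Burnside k S S} (hX : F.Supported X) (h : F.StableFrom 0 X)
    (hm : mark (⊤ : Subgroup S).subtype (⊤ : Subgroup S).subtype X =
        Nat.card (Subgroup.centralizer ((⊤ : Subgroup S) : Set S))) :
    ∑ ψ : (⊤ : Subgroup S) →* S, mark ψ (⊤ : Subgroup S).subtype X =
      Nat.card S * (autS (⊤ : Subgroup S)).relIndex (F.aut ⊤) := by
  classical
  have h1 : ∀ ψ : (⊤ : Subgroup S) →* S, mark ψ (⊤ : Subgroup S).subtype X =
      if F.Mem ψ then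
        (Nat.card (Subgroup.centralizer ((⊤ : Subgroup S) : Set S)) : k) else 0 := by
    intro ψ
    split_ifs with hψ
    · rw [← hm]
      exact h _ _ _ _ _ (mem_iff_rel.1 hψ) (Rel.refl _) (mem_iff_rel.1 hψ) (Nat.zero_le _)
    · exact not_not.1 (mt (fun h0 => mem_iff_rel.2 (hX _ _ _ h0)) hψ)
  -- There are `|Aut_F(S)|` nonzero terms, each equal to `|Z(S)|`, and `|Aut_S(S)| |Z(S)| = |S|`.
  rw [Finset.sum_congr rfl fun ψ _ => h1 ψ, Finset.sum_ite, Finset.sum_const_zero, add_zero,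
    Finset.sum_const, nsmul_eq_mul, ← Fintype.card_subtype, ← Nat.card_eq_fintype_card,
    card_mem_top, ← card_mul_relIndex (autS_le_aut ⊤), ← Nat.cast_mul, ← Nat.cast_mul]
  congr 1
  have h2 : Nat.card S = Nat.card (Subgroup.normalizer ((⊤ : Subgroup S) : Set S)) := by
    rw [Subgroup.normalizer_eq_top, Subgroup.card_top]
  rw [h2, ← card_autS_mul]
  ring

variable [CharZero k]

/-- Adding multiples of the classes `[Q, ψ]`, for morphisms `ψ` of `F` on subgroups of order `n`,
one can prescribe the marks at these morphisms within their residue classes. -/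
theorem exists_prescribed_marks {n : ℕ} {X : Burnside k S S} (hX : F.Supported X)
    (v : Subgroup S → k) (hv : ∀ Q Q', F.Conj Q Q' → v Q = v Q')
    (hdvd : ∀ (Q : Subgroup S) (ψ : Q →* S), Nat.card Q = n → F.Mem ψ →
      mark ψ Q.subtype (basic k Q ψ) ∣ mark ψ Q.subtype X - v Q)
    (s : Finset (Σ Q : Subgroup S, Q →* S)) : ∃ Y : Burnside k S S, F.Supported Y ∧
      (∀ (Q : Type u) [Group Q] [Finite Q] (α β : Q →* S), n < Nat.card β.range →
        mark α β Y = mark α β X) ∧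
      (∀ (Q : Subgroup S) (ψ : Q →* S), Nat.card Q = n → F.Mem ψ →
        mark ψ Q.subtype Y = v Q ∨ ⟨Q, ψ⟩ ∉ s ∧ mark ψ Q.subtype Y = mark ψ Q.subtype X) := by
  classical
  -- Treating one pair also corrects its conjugates, so a pair outside `s` may already have the
  -- value `v`; the disjunction allows for this.
  induction s using Finset.induction_on with
  | empty => exact ⟨X, hX, fun _ _ _ _ _ _ => rfl, fun Q ψ _ _ => Or.inr ⟨by simp, rfl⟩⟩
  | insert i s _ ih =>
    obtain ⟨Y, hY, hYX, hYv⟩ := ih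
    obtain ⟨L, φ⟩ := i
    by_cases hi : Nat.card L = n ∧ F.Mem φ ∧ mark φ L.subtype Y ≠ v L
    swap
    · refine ⟨Y, hY, hYX, fun Q ψ hQ hψ => ?_⟩
      rcases hYv Q ψ hQ hψ with h1 | ⟨h1, h2⟩
      · exact Or.inl h1
      · by_cases h3 : (⟨Q, ψ⟩ : Σ Q : Subgroup S, Q →* S) = ⟨L, φ⟩
        · cases h3
          exact Or.inl (by_contra fun h4 => hi ⟨hQ, hψ, h4⟩)
        · exact Or.inr ⟨by simp [h1, h3], h2⟩
    obtain ⟨hL, hφ, hne⟩ := hi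
    have hφX : mark φ L.subtype Y = mark φ L.subtype X :=
      ((hYv L φ hL hφ).resolve_left hne).2
    obtain ⟨c, hc⟩ := hdvd L φ hL hφ
    -- The class `[L, φ]` has no marks at larger images, and at order `n` only at pairs conjugate to
    -- `(L, φ)`, where `v` has the same value.
    refine ⟨Y - c • basic k L φ, hY.sub ((supported_basic hφ).smul c), fun Q _ _ α β hβ => ?_,
      fun Q ψ hQ hψ => ?_⟩
    · rw [map_sub, map_smul, hYX Q α β hβ]
      by_cases h0 : mark α β (basic k L φ) = 0
      · rw [h0, smul_zero, sub_zero]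
      · obtain ⟨a, b, hab⟩ := exists_of_mark_basic_ne_zero h0
        refine absurd hβ (not_lt.2 ?_)
        rw [← hL]
        refine Nat.card_le_card_of_injective
          (fun x : β.range => (⟨b * x * b⁻¹, ?_⟩ : L)) fun x y hxy => ?_
        · obtain ⟨q, hq⟩ := x.2
          rw [← hq]
          exact (hab q).1
        · have := congrArg Subtype.val hxy
          exact Subtype.ext (by simpa using this)
    · by_cases h0 : mark ψ Q.subtype (basic k L φ) = 0
      · rw [map_sub, map_smul, h0, smul_zero, sub_zero]
        rcases hYv Q ψ hQ hψ with h1 | ⟨h1, h2⟩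
        · exact Or.inl h1
        · refine Or.inr ⟨?_, h2⟩
          rw [Finset.mem_insert, not_or]
          refine ⟨fun h3 => ?_, h1⟩
          cases h3
          exact mark_basic_self_ne_zero _ _ h0
      · left
        obtain ⟨a, b, hab⟩ := exists_of_mark_basic_ne_zero h0
        let ι : Q →* L := ((MulAut.conj b).toMonoidHom.comp Q.subtype).codRestrict L
          fun q => (hab q).1
        have hι : Function.Injective ι := fun x y hxy => by
          have : b * x * b⁻¹ = b * y * b⁻¹ := congrArg Subtype.val hxy
          exact Subtype.ext (by simpa using this)
        have hb : Function.Bijective ι :=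
          (Nat.bijective_iff_injective_and_card _).2 ⟨hι, hQ.trans hL.symm⟩
        have hmark : ∀ Z : Burnside k S S, mark ψ Q.subtype Z = mark φ L.subtype Z := by
          intro Z
          rw [← mark_comp_surjective φ L.subtype ι hb.2]
          symm
          refine mark_conj a⁻¹ b (fun q => ?_) (fun q => rfl) Z
          rw [inv_inv]
          exact (hab q).2
        have hQL : F.Conj Q L := conj_iff.2 ⟨MulEquiv.ofBijective ι hb,
          rel_of_conj b fun q => rfl⟩
        rw [hmark, hv Q L hQL, map_sub, map_smul, smul_eq_mul, mul_comm, ← hc, hφX]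
        ring

variable [IsDomain k] {p : ℕ} [Fact p.Prime]

/-- Stability of the marks can be extended to subgroups of order `n`. -/
theorem IsSaturated.exists_stableFrom_of_succ (hF : F.IsSaturated p) (hS : IsPGroup p S) {n : ℕ}
    (hn : n ≤ Nat.card S) {X : Burnside k S S} (hX : F.Supported X) (h : F.StableFrom (n + 1) X) :
    ∃ Y : Burnside k S S, F.Supported Y ∧ F.StableFrom n Y ∧
      mark (⊤ : Subgroup S).subtype (⊤ : Subgroup S).subtype Y =
        mark (⊤ : Subgroup S).subtype (⊤ : Subgroup S).subtype X := by
  obtain ⟨r, hr, hr'⟩ := F.exists_fullyNormalized_representatives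
  have _ : Fintype (Σ Q : Subgroup S, Q →* S) := Fintype.ofFinite _
  let v : Subgroup S → k := fun Q => mark (r Q).subtype (r Q).subtype X
  obtain ⟨Y, hY, hYX, hYv⟩ := exists_prescribed_marks (n := n) hX v
    (fun Q Q' hQ => congrArg (fun P : Subgroup S => mark P.subtype P.subtype X) (hr' Q Q' hQ))
    (fun Q ψ hQ hψ => by
      subst hQ
      exact hF.mark_basic_self_dvd_sub hS hX h hψ (hr Q).1 (hr Q).2) Finset.univ
  have hYv : ∀ (Q : Subgroup S) (ψ : Q →* S), Nat.card Q = n → F.Mem ψ →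
      mark ψ Q.subtype Y = v Q := fun Q ψ hQ hψ =>
    (hYv Q ψ hQ hψ).resolve_right fun h => h.1 (Finset.mem_univ _)
  refine ⟨Y, hY, ?_, ?_⟩
  · intro Q _ _ α β α' β' hα hα' hαα' hn
    have hββ' : F.Rel β β' := (hα.symm.trans hαα').trans hα'
    have hcard : Nat.card β'.range = Nat.card β.range := by
      obtain ⟨e, -⟩ := hββ'.exists_equiv
      exact Nat.card_congr e.toEquiv
    rcases hn.lt_or_eq with hn | hn
    · rw [hYX Q α β hn, hYX Q α' β' (by rwa [hcard])]
      exact h Q α β α' β' hα hα' hαα' hn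
    · have key : ∀ α β : Q →* S, F.Rel α β → Nat.card β.range = n → mark α β Y = v β.range := by
        rintro α β ⟨φ, hφ, hα⟩ hβ
        rw [← hYv β.range φ hβ hφ, ← mark_range, show φ.comp β.rangeRestrict = α from
          MonoidHom.ext hα]
      rw [key α β hα hn.symm, key α' β' hα' (by rw [hcard, hn])]
      exact congrArg (fun P : Subgroup S => mark P.subtype P.subtype X)
        (hr' _ _ hββ'.conj_range).symm
  -- When `n = |S|`, the value prescribed at `S` is the old mark, since the representative of `S` is
  -- `S` itself.
  · by_cases hcard : Nat.card (⊤ : Subgroup S) = n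
    · have hmem : F.Mem (⊤ : Subgroup S).subtype := mem_iff_rel.2 (Rel.refl _)
      have hrt : r ⊤ = ⊤ := by
        obtain ⟨e, -⟩ := conj_iff.1 (hr ⊤).1
        refine Subgroup.eq_top_of_card_eq _ ?_
        rw [← Nat.card_congr e.toEquiv, Subgroup.card_top]
      rw [hYv ⊤ _ hcard hmem]
      simp only [v]
      rw [hrt]
    · refine hYX _ _ _ (lt_of_le_of_ne ?_ ?_)
      · rwa [Subgroup.range_subtype, Subgroup.card_top]
      · rw [Subgroup.range_subtype]
        exact Ne.symm hcard

/-- A saturated fusion system has an element supported on it with stable marks. -/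
theorem IsSaturated.exists_stableFrom_zero (hF : F.IsSaturated p) (hS : IsPGroup p S) :
    ∃ X : Burnside k S S, F.Supported X ∧ F.StableFrom 0 X ∧
      mark (⊤ : Subgroup S).subtype (⊤ : Subgroup S).subtype X =
        Nat.card (Subgroup.centralizer ((⊤ : Subgroup S) : Set S)) := by
  refine Nat.decreasingInduction (n := Nat.card S + 1)
    (motive := fun n _ => ∃ X : Burnside k S S, F.Supported X ∧ F.StableFrom n X ∧
      mark (⊤ : Subgroup S).subtype (⊤ : Subgroup S).subtype X =
        Nat.card (Subgroup.centralizer ((⊤ : Subgroup S) : Set S)))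
    (fun n hn ih => ?_) ?_ (Nat.zero_le _)
  · obtain ⟨X, hX, h, hm⟩ := ih
    obtain ⟨Y, hY, h', hm'⟩ := hF.exists_stableFrom_of_succ hS (Nat.lt_succ_iff.1 hn) hX h
    exact ⟨Y, hY, h', hm'.trans hm⟩
  -- The induction starts at order `|S| + 1`, where stability is vacuous.
  · refine ⟨basic k ⊤ (⊤ : Subgroup S).subtype, supported_basic (mem_iff_rel.2 (Rel.refl _)),
      fun Q _ _ α β α' β' _ _ _ h => ?_, mark_basic_top⟩
    exact absurd (β.range.card_le_card_group) (by omega)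

end Characteristic
end FusionSystem

/-! ### Characteristic idempotents and the transfer. -/

namespace FusionSystem

section Projection

variable {S : Type u} [Group S] [Finite S] {F : FusionSystem S} {k : Type} [CommRing k]

theorem RightStable.add {T : Type u} [Group T] {X Y : Burnside k S T} (hX : F.RightStable X)
    (hY : F.RightStable Y) : F.RightStable (X + Y) := fun P φ hφ => by
  simp only [map_add, LinearMap.add_apply, hX P φ hφ, hY P φ hφ]

theorem RightStable.smul {T : Type u} [Group T] {X : Burnside k S T} (c : k)
    (hX : F.RightStable X) : F.RightStable (c • X) := fun P φ hφ => by
  simp only [map_smul, LinearMap.smul_apply, hX P φ hφ]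

theorem RightStable.sub {T : Type u} [Group T] {X Y : Burnside k S T} (hX : F.RightStable X)
    (hY : F.RightStable Y) : F.RightStable (X - Y) := fun P φ hφ => by
  simp only [map_sub, LinearMap.sub_apply, hX P φ hφ, hY P φ hφ]

/-- The support of `Y` restricts the sum to `γ` related to `β`, and there the marks of the stable
`X` do not depend on `γ`. -/
theorem RightStable.mark_comp_mul {T : Type u} [Group T] [Finite T] {X : Burnside k S T}
    (hX : F.RightStable X) {Y : Burnside k S S} (hY : F.Supported Y) {Q : Type u} [Group Q]
    [Finite Q] (α : Q →* T) (β : Q →* S) : mark α β (Burnside.comp X Y) * (Nat.card S : k) =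
      mark α β X * ∑ γ : Q →* S, mark γ β Y := by
  rw [mark_comp, Finset.mul_sum]
  refine Finset.sum_congr rfl fun γ _ => ?_
  by_cases h : mark γ β Y = 0
  · rw [h, mul_zero, mul_zero]
  · rw [hX.mark_eq (hY Q γ β h)]

variable [IsDomain k] [CharZero k]

theorem RightStable.comp {T : Type u} [Group T] [Finite T] (X : Burnside k S T)
    {Y : Burnside k S S} (hY : F.RightStable Y) : F.RightStable (comp X Y) := fun P φ hφ => by
  rw [comp_assoc, comp_assoc, hY P φ hφ]

/-- If the sums of marks of a stable element supported on `F` are `|S|` up to units, then there is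
such an element for which they equal `|S|`. -/
theorem exists_sum_mark_eq {X : Burnside k S S} (hX : F.Supported X) (hX' : F.RightStable X)
    (c : Subgroup S → kˣ) (h : ∀ Q : Subgroup S, ∑ χ : Q →* S, mark χ Q.subtype X = Nat.card S * c Q) :
    ∃ Y : Burnside k S S, F.Supported Y ∧ F.RightStable Y ∧
      ∀ Q : Subgroup S, ∑ χ : Q →* S, mark χ Q.subtype Y = Nat.card S := by
  classical
  have hS : (Nat.card S : k) ≠ 0 := Nat.cast_ne_zero.2 Nat.card_pos.ne'
  have _ := Fintype.ofFinite (Subgroup S)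
  suffices ∀ s : Finset (Subgroup S), ∃ Y : Burnside k S S, F.Supported Y ∧ F.RightStable Y ∧
      ∀ Q ∈ s, ∑ χ : Q →* S, mark χ Q.subtype Y = Nat.card S by
    obtain ⟨Y, hY, hY', h⟩ := this Finset.univ
    exact ⟨Y, hY, hY', fun Q => h Q (Finset.mem_univ _)⟩
  intro s
  induction s using Finset.induction_on with
  | empty => exact ⟨X, hX, hX', by simp⟩
  | insert P s _ ih =>
    obtain ⟨Y, hY, hY', hs⟩ := ih
    -- A column sum `s` of `Y` at `Q` becomes `s + c_P⁻¹ c_Q (|S| - s)`: this is `|S|` at `Q = P`,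
    -- and it preserves the value `|S|` wherever already attained.
    refine ⟨Y + (↑(c P)⁻¹ : k) • (X - Burnside.comp Y X), hY.add ((hX.sub (hY.comp hX)).smul _),
      hY'.add ((hX'.sub (RightStable.comp Y hX')).smul _), fun Q hQ => ?_⟩
    have h1 : (∑ χ : Q →* S, mark χ Q.subtype (Burnside.comp Y X)) * (Nat.card S : k) =
        (∑ χ : Q →* S, mark χ Q.subtype Y) * (Nat.card S * c Q) := by
      rw [Finset.sum_mul, ← h, Finset.sum_mul]
      exact Finset.sum_congr rfl fun χ _ => hY'.mark_comp_mul hX χ _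
    have h2 : ∑ χ : Q →* S, mark χ Q.subtype (Burnside.comp Y X) =
        (∑ χ : Q →* S, mark χ Q.subtype Y) * c Q :=
      mul_right_cancel₀ hS (by rw [h1]; ring)
    simp only [map_add, map_smul, map_sub, smul_eq_mul, Finset.sum_add_distrib,
      ← Finset.mul_sum, Finset.sum_sub_distrib, h, h2]
    rcases Finset.mem_insert.1 hQ with rfl | hQ
    · linear_combination (Nat.card S - ∑ χ : Q →* S, mark χ Q.subtype Y) * (c Q).inv_mul
    · rw [hs Q hQ]
      ring

theorem RightStable.comp_eq {T : Type u} [Group T] [Finite T] {X : Burnside k S T}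
    (hX : F.RightStable X) {ω : Burnside k S S} (hω : F.Supported ω)
    (h : ∀ Q : Subgroup S, ∑ χ : Q →* S, mark χ Q.subtype ω = Nat.card S) :
    Burnside.comp X ω = X := by
  refine eq_of_mark_eq fun Q α => ?_
  have hS : (Nat.card S : k) ≠ 0 := Nat.cast_ne_zero.2 Nat.card_pos.ne'
  exact mul_right_cancel₀ hS (by rw [hX.mark_comp_mul hω, h])

/-- Wherever `ω` has a nonzero mark at `(β, incl)`, the marks of `x` at `β` and at the inclusion
agree, so the factor from `x` comes out of the sum. -/
theorem RightStable.kappa_comp {x : Burnside k S S} (hx : F.RightStable x) (y : Burnside k S S)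
    {ω : Burnside k S S} (hω : F.Supported ω) :
    Burnside.comp (kappa x y) ω = kappa x (Burnside.comp y ω) := by
  refine eq_of_mark_eq fun Q α => ?_
  have hS : (Nat.card S : k) ≠ 0 := Nat.cast_ne_zero.2 Nat.card_pos.ne'
  refine mul_right_cancel₀ hS ?_
  rw [mark_comp, mark_kappa, mul_assoc, mark_comp, Finset.mul_sum]
  refine Finset.sum_congr rfl fun β _ => ?_
  rw [mark_kappa, mul_assoc]
  by_cases h : mark β Q.subtype ω = 0
  · rw [h, mul_zero, mul_zero, mul_zero]
  · rw [hx.mark_eq (hω _ _ _ h)]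

/-- A saturated fusion system over which integers prime to `p` are units modulo `p` has a
characteristic idempotent. -/
theorem IsSaturated.exists_sum_mark_eq {p : ℕ} [Fact p.Prime] (hF : F.IsSaturated p)
    (hS : IsPGroup p S) (hu : ∀ (m : ℕ) (c : k), ¬ p ∣ m → IsUnit (m + p * c)) :
    ∃ ω : Burnside k S S, F.Supported ω ∧ F.RightStable ω ∧
      ∀ Q : Subgroup S, ∑ χ : Q →* S, mark χ Q.subtype ω = Nat.card S := by
  obtain ⟨X, hX, h, hm⟩ := hF.exists_stableFrom_zero (k := k) hS
  have htop : F.Automized p ⊤ := by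
    refine hF.automized fun Q _ => ?_
    exact (Subgroup.card_le_card_group _).trans_eq
      (by rw [Subgroup.normalizer_eq_top, Subgroup.card_top])
  have key : ∀ Q : Subgroup S, ∃ c : kˣ,
      ∑ χ : Q →* S, mark χ Q.subtype X = Nat.card S * c := by
    intro Q
    -- The column over `S` sums to `|S|` times an index prime to `p`. Modulo `p |S|` every other
    -- column sum agrees with it, hence is `|S|` times a unit.
    obtain ⟨c, hc⟩ := sum_mark_congruence (hS.to_subgroup Q) (hS.to_subgroup ⊤) Q.subtype
      (⊤ : Subgroup S).subtype X
    rw [h.sum_mark_top hX hm, sub_eq_iff_eq_add] at hc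
    exact ⟨(hu _ c htop).unit, by rw [hc, IsUnit.unit_spec]; ring⟩
  choose c hc using key
  exact FusionSystem.exists_sum_mark_eq hX (h.rightStable hX) c hc

/-- The right stable elements of a saturated fusion system have a retractive transfer. -/
theorem IsSaturated.nonempty_retractiveTransfer {p : ℕ} [Fact p.Prime] (hF : F.IsSaturated p)
    (hS : IsPGroup p S) (hu : ∀ (m : ℕ) (c : k), ¬ p ∣ m → IsUnit (m + p * c))
    {R : Submodule k (Burnside k S S)} {R' : Submodule k (Burnside k S (S × S))}
    (hR : ∀ X, X ∈ R ↔ F.RightStable X) (hR' : ∀ X, X ∈ R' ↔ F.RightStable X) :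
    Nonempty (RetractiveTransfer R R') := by
  obtain ⟨ω, hω, hω', h⟩ := hF.exists_sum_mark_eq (k := k) hS hu
  exact ⟨{
    t := (Burnside.comp.flip ω).codRestrict R fun x => (hR _).2 (RightStable.comp x hω')
    t' := (Burnside.comp.flip ω).codRestrict R' fun z => (hR' _).2 (RightStable.comp z hω')
    map_comp := fun a x => comp_assoc a x ω
    map_comp' := fun a z => comp_assoc a z ω
    retract := fun x => Subtype.ext (((hR _).1 x.2).comp_eq hω h)
    retract' := fun z => Subtype.ext (((hR' _).1 z.2).comp_eq hω h)
    natural := fun g x => comp_assoc g x ω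
    frobenius := fun x y => ((hR _).1 x.2).kappa_comp y hω }⟩

end Projection
end FusionSystem

/-! ### Arithmetic of the integers localized at `p`. -/

section IntLoc

variable {p : ℕ} [Fact p.Prime]

instance : IsDomain (IntLoc p) := IsLocalization.isDomain_localization
  (Ideal.primeCompl_le_nonZeroDivisors _)

instance : CharZero (IntLoc p) := by
  have : Function.Injective (algebraMap ℤ (IntLoc p)) := IsLocalization.injective _
    (Ideal.primeCompl_le_nonZeroDivisors (Ideal.span {(p : ℤ)}))
  exact charZero_of_injective_algebraMap this

theorem IntLoc.mem_maximalIdeal : (p : IntLoc p) ∈ IsLocalRing.maximalIdeal (IntLoc p) := by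
  have := (IsLocalization.AtPrime.to_map_mem_maximal_iff (IntLoc p) (Ideal.span {(p : ℤ)})
    (p : ℤ)).2 (Ideal.mem_span_singleton_self _)
  simpa using this

theorem IntLoc.not_dvd_one : ¬ (p : IntLoc p) ∣ 1 := fun h =>
  (IsLocalRing.mem_maximalIdeal _).1 IntLoc.mem_maximalIdeal (isUnit_of_dvd_one h)

theorem IntLoc.isUnit_add (m : ℕ) (c : IntLoc p) (hm : ¬ p ∣ m) :
    IsUnit ((m : IntLoc p) + p * c) := by
  by_contra h
  have h1 : (m : IntLoc p) ∈ IsLocalRing.maximalIdeal (IntLoc p) := by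
    have := Ideal.sub_mem _ ((IsLocalRing.mem_maximalIdeal _).2 h)
      (Ideal.mul_mem_right c _ (IntLoc.mem_maximalIdeal (p := p)))
    rwa [add_sub_cancel_right] at this
  have h2 := (IsLocalization.AtPrime.to_map_mem_maximal_iff (IntLoc p) (Ideal.span {(p : ℤ)})
    (m : ℤ)).1 (by simpa using h1)
  rw [Ideal.mem_span_singleton, Int.natCast_dvd_natCast] at h2
  exact hm h2

end IntLoc

end DoubleBurnside

theorem theoremE (p : ℕ) [Fact p.Prime] {S : Type*} [Group S] [Finite S] (hS : IsPGroup p S)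
    (R : Submodule (DoubleBurnside.IntLoc p) (DoubleBurnside.Burnside (DoubleBurnside.IntLoc p) S S))
    (R' : Submodule (DoubleBurnside.IntLoc p)
      (DoubleBurnside.Burnside (DoubleBurnside.IntLoc p) S (S × S)))
    (hR : DoubleBurnside.IsKappaPreserving R R')
    (hJ : ¬ R ≤ DoubleBurnside.Burnside.nishida (DoubleBurnside.IntLoc p) S) :
    (∃ F : DoubleBurnside.FusionSystem S, F.IsSaturated p ∧
      (∀ X, X ∈ R ↔ F.RightStable X) ∧ (∀ X, X ∈ R' ↔ F.RightStable X)) ↔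
      Nonempty (DoubleBurnside.RetractiveTransfer R R') := by
  constructor
  · rintro ⟨F, hF, h, h'⟩
    exact hF.nonempty_retractiveTransfer hS DoubleBurnside.IntLoc.isUnit_add h h'
  · rintro ⟨T⟩
    obtain ⟨ω, hω, h, h'⟩ := T.isFrobeniusIdempotent hJ
    have hp := DoubleBurnside.IntLoc.not_dvd_one (p := p)
    exact ⟨hω.fusionSystem hS hp, hω.isSaturated hS hp,
      fun X => (h X).trans (hω.rightStable_iff hS hp).symm,
      fun X => (h' X).trans (hω.rightStable_iff hS hp).symm⟩
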